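/- Let $n\ge 1$, $\alpha>0$, let $A=(a_{ij})$ be an $n\times n$ matrix of functions in $C^2([0,1])$ and $f\in C^2([0,1])^n$, and let $g_0,g_1\in\mathbb R^n$. Suppose that for all $x\in[0,1]$ and $1\le i\le n$ $$a_{ii}(x)>\sum_{j\ne i}|a_{ij}(x)|,\qquad a_{ij}(x)\le 0\ (j\ne i),\qquad \sum_{j=1}^n a_{ij}(x)>\alpha .$$ Then there is a constant $C>0$, depending only on $n,\alpha,A,f,g_0,g_1$, such that the following holds for all $0<\varepsilon_1<\dots<\varepsilon_n\le 1$ with $\max_i\sqrt{\varepsilon_i}\le\sqrt\alpha/4$ and all integers $N>1$ divisible by $2^{n+1}$. Let $E=\mathrm{diag}(\varepsilon_1,\dots,\varepsilon_n)$ and let $u$ be the solution of $$-Eu''(x)+A(x)u(x)=f(x),\quad x\in(0,1),\qquad u(0)=g_0,\ u(1)=g_1 .$$ Put $\tau_n=\min\{\tfrac14,\,2\sqrt{\varepsilon_n/\alpha}\,\ln N\}$ and $\tau_i=\min\{\tfrac{\tau_{i+1}}2,\,2\sqrt{\varepsilon_i/\alpha}\,\ln N\}$ for $i=n-1,\dots,1$.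 Let $0=x_0<x_1<\dots<x_N=1$ be the mesh which is uniform on each of the following subintervals, with the given number of mesh intervals: $N/2$ on $[\tau_n,1-\tau_n]$; $N/2^{n-i+2}$ on each of $[\tau_i,\tau_{i+1}]$ and $[1-\tau_{i+1},1-\tau_i]$, $1\le i\le n-1$; and $N/2^{n+1}$ on each of $[0,\tau_1]$ and $[1-\tau_1,1]$. With $h_j=x_j-x_{j-1}$, let the mesh function $U$ be the solution of $$-E\,\delta^2U(x_j)+A(x_j)U(x_j)=f(x_j),\quad 1\le j\le N-1,\qquad U(x_0)=g_0,\ U(x_N)=g_1,$$ $$\delta^2U(x_j)=\frac{2}{h_j+h_{j+1}}\left(\frac{U(x_{j+1})-U(x_j)}{h_{j+1}}-\frac{U(x_j)-U(x_{j-1})}{h_j}\right).$$ Then $$\|U-u\|=\max_{0\le j\le N}\ \max_{1\le i\le n}|U_i(x_j)-u_i(x_j)|\le C\,(N^{-1}\ln N)^2 .$$ -/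

import Mathlib

open Set

noncomputable section

/-- The continuous problem `-E u'' + A u = f` on `(0,1)`, `u(0) = g₀`, `u(1) = g₁`, with
`E = diag(ε)`: `u` is continuous on `[0,1]` and twice continuously differentiable on `(0,1)`. -/
structure IsExactSolution {n : ℕ} (ε : Fin n → ℝ) (A : ℝ → Matrix (Fin n) (Fin n) ℝ)
    (f : ℝ → Fin n → ℝ) (g₀ g₁ : Fin n → ℝ) (u : ℝ → Fin n → ℝ) : Prop where
  continuousOn : ContinuousOn u (Icc 0 1)
  contDiffOn : ContDiffOn ℝ 2 u (Ioo 0 1)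
  equation : ∀ x ∈ Ioo (0 : ℝ) 1, ∀ i : Fin n,
    -(ε i * iteratedDeriv 2 (fun y => u y i) x) + ∑ k, A x i k * u x k = f x i
  left_value : u 0 = g₀
  right_value : u 1 = g₁

/-- The transition parameters (with the index shifted by one, so that `τ_n` belongs to the last
element of `Fin n`): `τ_n = min {1/4, 2 √(ε_n/α) ln N}` and
`τ_i = min {τ_{i+1}/2, 2 √(ε_i/α) ln N}` for `i < n`. -/
def transitionParam {n : ℕ} (ε : Fin n → ℝ) (α : ℝ) (N : ℕ) (i : Fin n) : ℝ :=
  if h : (i : ℕ) + 1 < n then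
    min (transitionParam ε α N ⟨(i : ℕ) + 1, h⟩ / 2) (2 * √(ε i / α) * Real.log N)
  else min (1 / 4) (2 * √(ε i / α) * Real.log N)
termination_by n - (i : ℕ)

/-- The end points `0, τ_1, …, τ_n, 1 - τ_n, …, 1 - τ_1, 1` (for `s = 0, …, 2n+1`) of the
`2n+1` subintervals of `[0,1]`. -/
def breakPoint {n : ℕ} (τ : Fin n → ℝ) (s : ℕ) : ℝ :=
  if s = 0 then 0
  else if h : s - 1 < n then τ ⟨s - 1, h⟩
  else if h : 2 * n - s < n ∧ s ≤ 2 * n then 1 - τ ⟨2 * n - s, h.1⟩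
  else 1

/-- The number of mesh intervals in the subinterval number `s = 0, …, 2n`:
`N / 2^(n+1)` in `[0, τ_1]` and `(1 - τ_1, 1]`, `N / 2^(n-i+2)` in `(τ_i, τ_{i+1}]` (`s = i`)
and in `(1 - τ_{i+1}, 1 - τ_i]` (`s = 2n - i`), and `N / 2` in `(τ_n, 1 - τ_n]` (`s = n`). -/
def intervalCount (n N s : ℕ) : ℕ :=
  if s = 0 ∨ s = 2 * n then N / 2 ^ (n + 1)
  else if s < n then N / 2 ^ (n - s + 2)
  else if s = n then N / 2
  else N / 2 ^ (n - (2 * n - s) + 2)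

/-- The number of mesh intervals in the subintervals before the one numbered `s`. -/
def intervalStart (n N s : ℕ) : ℕ := ∑ r ∈ Finset.range s, intervalCount n N r

/-- The mesh points `x_0, …, x_N` of the piecewise uniform mesh with transition parameters `τ`.
Among the first `j` mesh intervals, `min (j - intervalStart n N s) (intervalCount n N s)`
(truncated subtraction) lie in the subinterval number `s`, and each of these has length
`(breakPoint τ (s + 1) - breakPoint τ s) / intervalCount n N s`. -/
def meshPoint {n : ℕ} (τ : Fin n → ℝ) (N j : ℕ) : ℝ :=
  ∑ s ∈ Finset.range (2 * n + 1),
    (min (j - intervalStart n N s) (intervalCount n N s) : ℕ) *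
      ((breakPoint τ (s + 1) - breakPoint τ s) / (intervalCount n N s : ℝ))

/-- `D⁺ V (x_j)`. -/
def forwardDiff (x V : ℕ → ℝ) (j : ℕ) : ℝ := (V (j + 1) - V j) / (x (j + 1) - x j)

/-- `D⁻ V (x_j)`, for `1 ≤ j`. -/
def backwardDiff (x V : ℕ → ℝ) (j : ℕ) : ℝ := (V j - V (j - 1)) / (x j - x (j - 1))

/-- `δ² V (x_j) = (D⁺ V (x_j) - D⁻ V (x_j)) / ((h_j + h_{j+1}) / 2)`, for `1 ≤ j`. -/
def secondDiff (x V : ℕ → ℝ) (j : ℕ) : ℝ :=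
  (forwardDiff x V j - backwardDiff x V j) / (((x j - x (j - 1)) + (x (j + 1) - x j)) / 2)

/-- The discrete problem `-E δ² U + A U = f` at `x_1, …, x_{N-1}`, `U(x_0) = g₀`,
`U(x_N) = g₁`; the mesh function `U` is given by its values `U j` at `x_j`, `0 ≤ j ≤ N`. -/
structure IsDiscreteSolution {n : ℕ} (ε : Fin n → ℝ) (A : ℝ → Matrix (Fin n) (Fin n) ℝ)
    (f : ℝ → Fin n → ℝ) (g₀ g₁ : Fin n → ℝ) (N : ℕ) (x : ℕ → ℝ) (U : ℕ → Fin n → ℝ) :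
    Prop where
  equation : ∀ j : ℕ, 1 ≤ j → j < N → ∀ i : Fin n,
    -(ε i * secondDiff x (fun l => U l i) j) + ∑ k, A (x j) i k * U j k = f (x j) i
  left_value : U 0 = g₀
  right_value : U N = g₁

end

/-! Put q_i = ε_i u_i'' = (Au - f)_i (`reaction`). Being algebraic in u, it is twice differentiable
even though the data are only C². The consistency error at x_j is the second difference quotient of
ε_i u_i minus q_i(x_j), so it is controlled by the oscillation of q_i around x_j. The solution is
not split into smooth and layer parts. Everything rests on bounds for q_i, q_i', q_i'' by the weight
1 + ∑ B_m/ε_m, where B_m(x) = exp(-x√(α/ε_m)) + exp(-(1-x)√(α/ε_m)).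

A priori bounds: w = u'' solves -Ew'' + Aw = f'' - A''u - 2A'u'. It is compared with a combination
of the B_m whose coefficients respect the ordering of the ε_m (`barrier_operator_ge`). The term u'
is interpolated between u and u'' on a short interval, so an estimate with constant S improves to
one with constant P + S/2 (`bootstrap`). Iteration removes the ε-dependent starting constant
(`exists_second_deriv_bound`), and the bounds for q_i and its derivatives follow
(`exists_reactionBound`).

Consistency: near each interior mesh point there is a threshold p. Layers with index at least p are
resolved (stencil width O(√ε_m N⁻¹ ln N)), and the others are O(N⁻²) there
(`exists_mesh_resolution`). At locally equidistant points, symmetric second differences of q_i give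
the order (N⁻¹ ln N)². At the transition points only q_i' can be used, and the bound worsens by the
factor 1 + √ε_i/(x_{j+1} - x_{j-1}).

Stability: there are at most 2n+1 such exceptional points. A barrier with a spike of height 1 and
width √ε_i at each of them has a kink whose second difference produces precisely the missing factor,
at bounded cost (`discrete_stability`). For N below 2^(n+3) a crude bound on the residual suffices.
-/

/-! ### Calculus of twice differentiable functions on the open unit interval. -/

/-- `f'` and `f''` are the first and second derivatives of `f` on `(0,1)`. -/
def TwiceDeriv (f f' f'' : ℝ → ℝ) : Prop :=
  ∀ x ∈ Ioo (0 : ℝ) 1, HasDerivAt f (f' x) x ∧ HasDerivAt f' (f'' x) x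

namespace TwiceDeriv

variable {f f' f'' g g' g'' : ℝ → ℝ}

theorem add (hf : TwiceDeriv f f' f'') (hg : TwiceDeriv g g' g'') :
    TwiceDeriv (fun x => f x + g x) (fun x => f' x + g' x) (fun x => f'' x + g'' x) :=
  fun x hx => ⟨(hf x hx).1.add (hg x hx).1, (hf x hx).2.add (hg x hx).2⟩

theorem sub (hf : TwiceDeriv f f' f'') (hg : TwiceDeriv g g' g'') :
    TwiceDeriv (fun x => f x - g x) (fun x => f' x - g' x) (fun x => f'' x - g'' x) :=
  fun x hx => ⟨(hf x hx).1.sub (hg x hx).1, (hf x hx).2.sub (hg x hx).2⟩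

theorem const_mul (c : ℝ) (hf : TwiceDeriv f f' f'') :
    TwiceDeriv (fun x => c * f x) (fun x => c * f' x) (fun x => c * f'' x) :=
  fun x hx => ⟨(hf x hx).1.const_mul c, (hf x hx).2.const_mul c⟩

theorem mul (hf : TwiceDeriv f f' f'') (hg : TwiceDeriv g g' g'') :
    TwiceDeriv (fun x => f x * g x) (fun x => f' x * g x + f x * g' x)
      (fun x => f'' x * g x + 2 * (f' x * g' x) + f x * g'' x) := by
  intro x hx
  refine ⟨(hf x hx).1.mul (hg x hx).1, ?_⟩
  exact (((hf x hx).2.mul (hg x hx).1).add ((hf x hx).1.mul (hg x hx).2)).congr_deriv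
    (by dsimp only; ring)

theorem sum {ι : Type*} (s : Finset ι) {F F' F'' : ι → ℝ → ℝ}
    (h : ∀ i ∈ s, TwiceDeriv (F i) (F' i) (F'' i)) :
    TwiceDeriv (fun x => ∑ i ∈ s, F i x) (fun x => ∑ i ∈ s, F' i x)
      (fun x => ∑ i ∈ s, F'' i x) :=
  fun x hx => ⟨HasDerivAt.fun_sum fun i hi => (h i hi x hx).1,
    HasDerivAt.fun_sum fun i hi => (h i hi x hx).2⟩

theorem const (c : ℝ) : TwiceDeriv (fun _ => c) (fun _ => 0) (fun _ => 0) :=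
  fun x _ => ⟨hasDerivAt_const x c, hasDerivAt_const x 0⟩

theorem deriv_deriv_eq (hf : TwiceDeriv f f' f'') {x : ℝ} (hx : x ∈ Ioo (0 : ℝ) 1) :
    deriv (deriv f) x = f'' x := by
  have h : deriv f =ᶠ[nhds x] f' := by
    filter_upwards [isOpen_Ioo.mem_nhds hx] with y hy using (hf y hy).1.deriv
  rw [h.deriv_eq, (hf x hx).2.deriv]

/-- If f'' were negative, the second derivative test would make the point a local maximum too. Then
f would be locally constant and f'' would vanish. -/
theorem nonneg_of_isLocalMin (hf : TwiceDeriv f f' f'') {x : ℝ} (hx : x ∈ Ioo (0 : ℝ) 1)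
    (hmin : IsLocalMin f x) : 0 ≤ f'' x := by
  by_contra! hneg
  have hmax : IsLocalMax f x := by
    refine isLocalMax_of_deriv_deriv_neg ?_ hmin.deriv_eq_zero (hf x hx).1.continuousAt
    rwa [hf.deriv_deriv_eq hx]
  have hconst : f =ᶠ[nhds x] fun _ => f x := by
    filter_upwards [hmin, hmax] with y h1 h2 using le_antisymm h2 h1
  have h1 : deriv f =ᶠ[nhds x] fun _ => 0 := by
    filter_upwards [hconst.eventuallyEq_nhds] with y hy
    rw [hy.deriv_eq]; simp
  have h2 := h1.deriv_eq
  rw [hf.deriv_deriv_eq hx] at h2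
  simp at h2
  linarith

end TwiceDeriv

/-- Derivatives within the closed interval are continuous there, hence bounded by compactness, and
in the interior they are ordinary derivatives. -/
theorem exists_twiceDeriv_of_contDiffOn {g : ℝ → ℝ} (hg : ContDiffOn ℝ 2 g (Icc 0 1)) :
    ∃ g' g'' : ℝ → ℝ, TwiceDeriv g g' g'' ∧
      ∃ M, ∀ x ∈ Icc (0 : ℝ) 1, |g x| ≤ M ∧ |g' x| ≤ M ∧ |g'' x| ≤ M := by
  have hU : UniqueDiffOn ℝ (Icc (0 : ℝ) 1) := uniqueDiffOn_Icc zero_lt_one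
  have h1 : ContDiffOn ℝ 1 (derivWithin g (Icc 0 1)) (Icc 0 1) := hg.derivWithin hU (by norm_num)
  have h2 : ContDiffOn ℝ 0 (derivWithin (derivWithin g (Icc 0 1)) (Icc 0 1)) (Icc 0 1) :=
    h1.derivWithin hU (by norm_num)
  have key : ∀ φ : ℝ → ℝ, DifferentiableOn ℝ φ (Icc 0 1) → ∀ x ∈ Ioo (0 : ℝ) 1,
      HasDerivAt φ (derivWithin φ (Icc 0 1) x) x := by
    intro φ hφ x hx
    exact (hφ x (Ioo_subset_Icc_self hx)).hasDerivWithinAt.hasDerivAt (Icc_mem_nhds hx.1 hx.2)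
  obtain ⟨M0, hM0⟩ := isCompact_Icc.exists_bound_of_continuousOn hg.continuousOn
  obtain ⟨M1, hM1⟩ := isCompact_Icc.exists_bound_of_continuousOn h1.continuousOn
  obtain ⟨M2, hM2⟩ := isCompact_Icc.exists_bound_of_continuousOn h2.continuousOn
  refine ⟨_, _, fun x hx => ⟨key _ (hg.differentiableOn (by norm_num)) x hx,
    key _ (h1.differentiableOn (by norm_num)) x hx⟩, max M0 (max M1 M2), fun x hx => ⟨?_, ?_, ?_⟩⟩
  · exact (hM0 x hx).trans (le_max_left _ _)
  · exact (hM1 x hx).trans ((le_max_left _ _).trans (le_max_right _ _))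
  · exact (hM2 x hx).trans ((le_max_right _ _).trans (le_max_right _ _))

/-! ### Quantitative data and the continuous comparison principle. -/

/-- The data of the boundary value problem, together with the derivatives of the coefficients and
the quantitative bounds on which all constants depend. -/
structure SystemData {n : ℕ} (α δ M : ℝ) (A : ℝ → Matrix (Fin n) (Fin n) ℝ)
    (A' A'' : Fin n → Fin n → ℝ → ℝ) (f : ℝ → Fin n → ℝ) (f' f'' : Fin n → ℝ → ℝ)
    (g₀ g₁ : Fin n → ℝ) : Prop where
  alpha_pos : 0 < α
  delta_pos : 0 < δ
  one_le : 1 ≤ M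
  contA : ∀ i k, ContinuousOn (fun x => A x i k) (Icc 0 1)
  contf : ∀ i, ContinuousOn (fun x => f x i) (Icc 0 1)
  derivA : ∀ i k, TwiceDeriv (fun x => A x i k) (A' i k) (A'' i k)
  derivf : ∀ i, TwiceDeriv (fun x => f x i) (f' i) (f'' i)
  off : ∀ x ∈ Icc (0 : ℝ) 1, ∀ i k, i ≠ k → A x i k ≤ 0
  row : ∀ x ∈ Icc (0 : ℝ) 1, ∀ i, α + δ ≤ ∑ k, A x i k
  boundA : ∀ x ∈ Icc (0 : ℝ) 1, ∀ i k, |A x i k| ≤ M ∧ |A' i k x| ≤ M ∧ |A'' i k x| ≤ M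
  boundf : ∀ x ∈ Icc (0 : ℝ) 1, ∀ i, |f x i| ≤ M ∧ |f' i x| ≤ M ∧ |f'' i x| ≤ M
  bound₀ : ∀ i, |g₀ i| ≤ M
  bound₁ : ∀ i, |g₁ i| ≤ M

/-- Compactness turns the strict row-sum inequality into a uniform gap δ. All later constants depend
only on n, α, δ and M, hence not on ε or N. -/
theorem exists_systemData {n : ℕ} {α : ℝ} (hα : 0 < α)
    {A : ℝ → Matrix (Fin n) (Fin n) ℝ} {f : ℝ → Fin n → ℝ} (g₀ g₁ : Fin n → ℝ)
    (hA : ∀ i k, ContDiffOn ℝ 2 (fun x => A x i k) (Icc 0 1))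
    (hf : ∀ i, ContDiffOn ℝ 2 (fun x => f x i) (Icc 0 1))
    (hoff : ∀ x ∈ Icc (0 : ℝ) 1, ∀ i k, i ≠ k → A x i k ≤ 0)
    (hrow : ∀ x ∈ Icc (0 : ℝ) 1, ∀ i, α < ∑ k, A x i k) :
    ∃ δ M A' A'' f' f'', SystemData α δ M A A' A'' f f' f'' g₀ g₁ := by
  choose A' A'' hA2 MA hMA using fun i k => exists_twiceDeriv_of_contDiffOn (hA i k)
  choose f' f'' hf2 Mf hMf using fun i => exists_twiceDeriv_of_contDiffOn (hf i)
  have hδ : ∀ i, ∃ d > 0, ∀ x ∈ Icc (0 : ℝ) 1, α + d ≤ ∑ k, A x i k := by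
    intro i
    have hc : ContinuousOn (fun x => ∑ k, A x i k) (Icc (0 : ℝ) 1) :=
      continuousOn_finsetSum _ fun k _ => (hA i k).continuousOn
    obtain ⟨x, hx, hmin⟩ := isCompact_Icc.exists_isMinOn ⟨0, by simp⟩ hc
    refine ⟨∑ k, A x i k - α, sub_pos.2 (hrow x hx i), fun y hy => ?_⟩
    have : ∑ k, A x i k ≤ ∑ k, A y i k := hmin hy
    linarith
  choose d hd hd' using hδ
  have hδ2 : ∃ δ > 0, ∀ i, δ ≤ d i := by
    rcases isEmpty_or_nonempty (Fin n) with h | h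
    · exact ⟨1, one_pos, fun i => h.elim i⟩
    · obtain ⟨i, hi⟩ := Finite.exists_min d
      exact ⟨d i, hd i, hi⟩
  obtain ⟨δ, hδ, hδd⟩ := hδ2
  set M := 1 + (∑ i, ∑ k, |MA i k|) + (∑ i, |Mf i|) + (∑ i, |g₀ i|) + ∑ i, |g₁ i| with hM
  have p1 : 0 ≤ ∑ i, ∑ k, |MA i k| :=
    Finset.sum_nonneg fun i _ => Finset.sum_nonneg fun k _ => abs_nonneg _
  have p2 : 0 ≤ ∑ i, |Mf i| := Finset.sum_nonneg fun i _ => abs_nonneg _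
  have p3 : 0 ≤ ∑ i, |g₀ i| := Finset.sum_nonneg fun i _ => abs_nonneg _
  have p4 : 0 ≤ ∑ i, |g₁ i| := Finset.sum_nonneg fun i _ => abs_nonneg _
  have hMA' : ∀ i k, MA i k ≤ M := by
    intro i k
    have h1 : |MA i k| ≤ ∑ k, |MA i k| :=
      Finset.single_le_sum (f := fun k => |MA i k|) (fun _ _ => abs_nonneg _) (Finset.mem_univ k)
    have h2 : ∑ k, |MA i k| ≤ ∑ i, ∑ k, |MA i k| :=
      Finset.single_le_sum (f := fun i => ∑ k, |MA i k|)
        (fun _ _ => Finset.sum_nonneg fun _ _ => abs_nonneg _) (Finset.mem_univ i)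
    linarith [le_abs_self (MA i k)]
  have hsing : ∀ (g : Fin n → ℝ) i, |g i| ≤ ∑ i, |g i| := fun g i =>
    Finset.single_le_sum (f := fun i => |g i|) (fun _ _ => abs_nonneg _) (Finset.mem_univ i)
  refine ⟨δ, M, A', A'', f', f'', hα, hδ, by linarith, fun i k => (hA i k).continuousOn,
    fun i => (hf i).continuousOn, hA2, hf2, hoff, fun x hx i => ?_, fun x hx i k => ?_,
    fun x hx i => ?_, fun i => ?_, fun i => ?_⟩
  · linarith [hd' i x hx, hδd i]
  · obtain ⟨h1, h2, h3⟩ := hMA i k x hx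
    exact ⟨h1.trans (hMA' i k), h2.trans (hMA' i k), h3.trans (hMA' i k)⟩
  · obtain ⟨h1, h2, h3⟩ := hMf i x hx
    have h : Mf i ≤ M := by linarith [hsing Mf i, le_abs_self (Mf i)]
    exact ⟨h1.trans h, h2.trans h, h3.trans h⟩
  · linarith [hsing g₀ i]
  · linarith [hsing g₁ i]

section

variable {n : ℕ} {α δ M : ℝ} {A : ℝ → Matrix (Fin n) (Fin n) ℝ}
  {A' A'' : Fin n → Fin n → ℝ → ℝ} {f : ℝ → Fin n → ℝ} {f' f'' : Fin n → ℝ → ℝ}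
  {g₀ g₁ : Fin n → ℝ}

/-- Off-diagonal entries are nonpositive, so lowering y k to the minimal component y i can only
raise the sum. Both comparison principles apply this at a global minimum. -/
theorem SystemData.row_mul_le (hD : SystemData α δ M A A' A'' f f' f'' g₀ g₁) {x : ℝ}
    (hx : x ∈ Icc (0 : ℝ) 1) {i : Fin n} {y : Fin n → ℝ} (hy : ∀ k, y i ≤ y k) :
    ∑ k, A x i k * y k ≤ (∑ k, A x i k) * y i := by
  rw [Finset.sum_mul]
  refine Finset.sum_le_sum fun k _ => ?_
  rcases eq_or_ne i k with rfl | hik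
  · rfl
  · exact mul_le_mul_of_nonpos_left (hy k) (hD.off x hx i k hik)

/-- The comparison principle for the operator `-E v'' + A v`. -/
theorem SystemData.comparison (hD : SystemData α δ M A A' A'' f f' f'' g₀ g₁) {ε : Fin n → ℝ}
    (hε : ∀ i, 0 < ε i) {v v' v'' : Fin n → ℝ → ℝ} (hc : ∀ i, ContinuousOn (v i) (Icc 0 1))
    (hv : ∀ i, TwiceDeriv (v i) (v' i) (v'' i)) (h0 : ∀ i, 0 ≤ v i 0) (h1 : ∀ i, 0 ≤ v i 1)
    (hL : ∀ i, ∀ x ∈ Ioo (0 : ℝ) 1, 0 ≤ -(ε i * v'' i x) + ∑ k, A x i k * v k x) :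
    ∀ i, ∀ x ∈ Icc (0 : ℝ) 1, 0 ≤ v i x := by
  intro i₁ x₁ hx₁
  choose X hX hXmin using fun i => isCompact_Icc.exists_isMinOn ⟨0, by simp⟩ (hc i)
  have : Nonempty (Fin n) := ⟨i₁⟩
  -- The minimum is taken over components and points together. Were it negative, it would be
  -- interior with v'' ≥ 0 and (Av)_i at most the row sum times the minimum, contradicting `hL`.
  obtain ⟨i, hi⟩ := Finite.exists_min fun i => v i (X i)
  refine le_trans ?_ ((hi i₁).trans (hXmin i₁ hx₁))
  by_contra! hneg
  have hne0 : X i ≠ 0 := fun h => by rw [h] at hneg; linarith [h0 i]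
  have hne1 : X i ≠ 1 := fun h => by rw [h] at hneg; linarith [h1 i]
  have hx : X i ∈ Ioo (0 : ℝ) 1 :=
    ⟨lt_of_le_of_ne (hX i).1 hne0.symm, lt_of_le_of_ne (hX i).2 hne1⟩
  have hloc : IsLocalMin (v i) (X i) := (hXmin i).isLocalMin (Icc_mem_nhds hx.1 hx.2)
  have h2 := (hv i).nonneg_of_isLocalMin hx hloc
  have h3 := hL i (X i) hx
  have h4 := hD.row_mul_le (hX i) (i := i) (y := fun k => v k (X i))
    fun k => (hi k).trans (hXmin k (hX i))
  have h5 := hD.row (X i) (hX i) i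
  have h6 := mul_nonneg (hε i).le h2
  have h7 : (∑ k, A (X i) i k) * v i (X i) < 0 :=
    mul_neg_of_pos_of_neg (by linarith [hD.alpha_pos, hD.delta_pos]) hneg
  linarith

/-- A function is bounded by a barrier whose image under the operator `-E v'' + A v` dominates. -/
theorem SystemData.abs_le_of_barrier (hD : SystemData α δ M A A' A'' f f' f'' g₀ g₁)
    {ε : Fin n → ℝ} (hε : ∀ i, 0 < ε i) {v v' v'' b b' b'' : Fin n → ℝ → ℝ}
    (hvc : ∀ i, ContinuousOn (v i) (Icc 0 1)) (hv : ∀ i, TwiceDeriv (v i) (v' i) (v'' i))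
    (hbc : ∀ i, ContinuousOn (b i) (Icc 0 1)) (hb : ∀ i, TwiceDeriv (b i) (b' i) (b'' i))
    (h0 : ∀ i, |v i 0| ≤ b i 0) (h1 : ∀ i, |v i 1| ≤ b i 1)
    (hL : ∀ i, ∀ x ∈ Ioo (0 : ℝ) 1, |-(ε i * v'' i x) + ∑ k, A x i k * v k x| ≤
      -(ε i * b'' i x) + ∑ k, A x i k * b k x) :
    ∀ i, ∀ x ∈ Icc (0 : ℝ) 1, |v i x| ≤ b i x := by
  intro i x hx
  rw [abs_le]
  constructor
  · have := hD.comparison hε (v := fun i x => b i x + v i x)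
      (fun i => (hbc i).add (hvc i)) (fun i => (hb i).add (hv i))
      (fun i => by have := (abs_le.1 (h0 i)).1; linarith)
      (fun i => by have := (abs_le.1 (h1 i)).1; linarith)
      (fun i x hx => by
        have := (abs_le.1 (hL i x hx)).1
        simp only [mul_add, Finset.sum_add_distrib]; linarith) i x hx
    linarith
  · have := hD.comparison hε (v := fun i x => b i x - v i x)
      (fun i => (hbc i).sub (hvc i)) (fun i => (hb i).sub (hv i))
      (fun i => by have := (abs_le.1 (h0 i)).2; linarith)
      (fun i => by have := (abs_le.1 (h1 i)).2; linarith)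
      (fun i x hx => by
        have := (abs_le.1 (hL i x hx)).2
        simp only [mul_sub, Finset.sum_sub_distrib]; linarith) i x hx
    linarith

end

/-! ### Layer functions. -/

/-- The decay rate `√(α / e)` of the layer functions belonging to the parameter `e`. -/
noncomputable def layerRate (α e : ℝ) : ℝ := √(α / e)

/-- The layer function `exp (-r x) + exp (-r (1 - x))` with `r = √(α / e)`. -/
noncomputable def layer (α e x : ℝ) : ℝ :=
  Real.exp (-(layerRate α e * x)) + Real.exp (-(layerRate α e * (1 - x)))

/-- The odd companion of `layer`, so that each is the derivative of the other up to the factor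
`layerRate α e`. -/
noncomputable def oddLayer (α e x : ℝ) : ℝ :=
  -Real.exp (-(layerRate α e * x)) + Real.exp (-(layerRate α e * (1 - x)))

theorem layerRate_nonneg (α e : ℝ) : 0 ≤ layerRate α e := Real.sqrt_nonneg _

theorem layerRate_sq {α e : ℝ} (hα : 0 < α) (he : 0 < e) : layerRate α e ^ 2 = α / e :=
  Real.sq_sqrt (by positivity)

theorem layerRate_pos {α e : ℝ} (hα : 0 < α) (he : 0 < e) : 0 < layerRate α e :=
  Real.sqrt_pos.2 (by positivity)

theorem layerRate_anti {α e e' : ℝ} (hα : 0 < α) (he : 0 < e) (h : e ≤ e') :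
    layerRate α e' ≤ layerRate α e :=
  Real.sqrt_le_sqrt (div_le_div_of_nonneg_left hα.le he h)

theorem hasDerivAt_exp_left (r x : ℝ) :
    HasDerivAt (fun x => Real.exp (-(r * x))) (-(r * Real.exp (-(r * x)))) x := by
  have h : HasDerivAt (fun x : ℝ => -(r * x)) (-(r * 1)) x := ((hasDerivAt_id x).const_mul r).neg
  exact h.exp.congr_deriv (by ring)

theorem hasDerivAt_exp_right (r x : ℝ) :
    HasDerivAt (fun x => Real.exp (-(r * (1 - x)))) (r * Real.exp (-(r * (1 - x)))) x := by
  have h : HasDerivAt (fun x : ℝ => -(r * (1 - x))) (-(r * (-1))) x :=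
    (((hasDerivAt_id x).const_sub 1).const_mul r).neg
  exact h.exp.congr_deriv (by ring)

theorem hasDerivAt_layer (α e x : ℝ) :
    HasDerivAt (layer α e) (layerRate α e * oddLayer α e x) x := by
  refine ((hasDerivAt_exp_left (layerRate α e) x).add
    (hasDerivAt_exp_right (layerRate α e) x)).congr_deriv ?_
  simp only [oddLayer]; ring

theorem hasDerivAt_oddLayer (α e x : ℝ) :
    HasDerivAt (oddLayer α e) (layerRate α e * layer α e x) x := by
  refine ((hasDerivAt_exp_left (layerRate α e) x).neg.add
    (hasDerivAt_exp_right (layerRate α e) x)).congr_deriv ?_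
  simp only [layer]; ring

theorem continuous_layer (α e : ℝ) : Continuous (layer α e) :=
  continuous_iff_continuousAt.2 fun x => (hasDerivAt_layer α e x).continuousAt

theorem continuous_oddLayer (α e : ℝ) : Continuous (oddLayer α e) :=
  continuous_iff_continuousAt.2 fun x => (hasDerivAt_oddLayer α e x).continuousAt

theorem twiceDeriv_layer {α e : ℝ} (hα : 0 < α) (he : 0 < e) :
    TwiceDeriv (layer α e) (fun x => layerRate α e * oddLayer α e x)
      (fun x => α / e * layer α e x) := by
  refine fun x _ => ⟨hasDerivAt_layer α e x, ?_⟩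
  refine ((hasDerivAt_oddLayer α e x).const_mul _).congr_deriv ?_
  rw [← layerRate_sq hα he]; ring

theorem layer_pos (α e x : ℝ) : 0 < layer α e x := by unfold layer; positivity

theorem abs_oddLayer_le (α e x : ℝ) : |oddLayer α e x| ≤ layer α e x := by
  have h1 := Real.exp_pos (-(layerRate α e * x))
  have h2 := Real.exp_pos (-(layerRate α e * (1 - x)))
  rw [abs_le]; unfold oddLayer layer; constructor <;> linarith

theorem layer_mono {α e e' x : ℝ} (hα : 0 < α) (he : 0 < e) (h : e ≤ e')
    (hx : x ∈ Icc (0 : ℝ) 1) : layer α e x ≤ layer α e' x := by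
  have hr := layerRate_anti hα he h
  have hx1 : 0 ≤ 1 - x := sub_nonneg.2 hx.2
  have hx0 := hx.1
  unfold layer
  gcongr

theorem one_le_layer_zero (α e : ℝ) : 1 ≤ layer α e 0 := by
  unfold layer; simp only [mul_zero, neg_zero, Real.exp_zero]
  linarith [Real.exp_pos (-(layerRate α e * (1 - 0)))]

theorem one_le_layer_one (α e : ℝ) : 1 ≤ layer α e 1 := by
  unfold layer; simp only [sub_self, mul_zero, neg_zero, Real.exp_zero]
  linarith [Real.exp_pos (-(layerRate α e * 1))]

/-- The constant 32 comes from exp s ≥ s²/2 at s = r/4. -/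
theorem sq_mul_exp_neg_quarter_le {r : ℝ} (hr : 0 ≤ r) : r ^ 2 * Real.exp (-(r * (1 / 4))) ≤ 32 := by
  have h := Real.quadratic_le_exp_of_nonneg (x := r / 4) (by positivity)
  rw [Real.exp_neg, ← div_eq_mul_inv, div_le_iff₀ (Real.exp_pos _)]
  have : r * (1 / 4) = r / 4 := by ring
  rw [this]; nlinarith

/-- Since 1/e = r²/α for the decay rate r, exponential decay over a distance 1/4 beats the singular
factor uniformly in e. -/
theorem exp_quarter_div_le {α e : ℝ} (hα : 0 < α) (he : 0 < e) {t : ℝ} (ht : 1 / 4 ≤ t) :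
    Real.exp (-(layerRate α e * t)) / e ≤ 32 / α := by
  have hr := layerRate_nonneg α e
  have h1 : Real.exp (-(layerRate α e * t)) ≤ Real.exp (-(layerRate α e * (1 / 4))) := by gcongr
  have h2 := sq_mul_exp_neg_quarter_le hr
  rw [layerRate_sq hα he] at h2
  rw [div_le_div_iff₀ he hα]
  have h3 : α / e * Real.exp (-(layerRate α e * (1 / 4))) * e ≤ 32 * e := by gcongr
  have h4 : α / e * Real.exp (-(layerRate α e * (1 / 4))) * e
      = Real.exp (-(layerRate α e * (1 / 4))) * α := by field_simp
  nlinarith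

/-! ### The weight for second derivatives, and interpolation. -/

/-- The size `1 + ∑ B_m / ε_m` of the second derivatives. -/
noncomputable def layerWeight {n : ℕ} (α : ℝ) (ε : Fin n → ℝ) (x : ℝ) : ℝ := 1 + ∑ m, layer α (ε m) x / ε m

section weight

variable {n : ℕ} {α : ℝ} {ε : Fin n → ℝ}

theorem one_le_layerWeight (hε : ∀ i, 0 < ε i) (x : ℝ) : 1 ≤ layerWeight α ε x := by
  unfold layerWeight
  have : 0 ≤ ∑ m, layer α (ε m) x / ε m :=
    Finset.sum_nonneg fun m _ => div_nonneg (layer_pos _ _ _).le (hε m).le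
  linarith

/-- The left exponentials decrease from x to y, and the right ones, at distance at least 1/4 from
their end point, cost only 32/α each. Up to a constant, the weight does not grow when moving away
from the nearer end point. -/
theorem layerWeight_le_of_le_half (hα : 0 < α) (hε : ∀ i, 0 < ε i) {x y : ℝ} (hxy : x ≤ y)
    (hy : y ≤ 3 / 4) : layerWeight α ε y ≤ (1 + n * (32 / α)) * layerWeight α ε x := by
  have h : layerWeight α ε y ≤ layerWeight α ε x + n * (32 / α) := by
    have : ∑ m, layer α (ε m) y / ε m ≤ ∑ m, (layer α (ε m) x / ε m + 32 / α) := by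
      refine Finset.sum_le_sum fun m _ => ?_
      have h1 := exp_quarter_div_le hα (hε m) (t := 1 - y) (by linarith)
      have hr := layerRate_nonneg α (ε m)
      have h2 : Real.exp (-(layerRate α (ε m) * y)) ≤ layer α (ε m) x := by
        have : Real.exp (-(layerRate α (ε m) * y)) ≤ Real.exp (-(layerRate α (ε m) * x)) := by
          gcongr
        have h3 := Real.exp_pos (-(layerRate α (ε m) * (1 - x)))
        unfold layer; linarith
      have h4 : Real.exp (-(layerRate α (ε m) * y)) / ε m ≤ layer α (ε m) x / ε m := by
        have := (hε m).le
        gcongr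
      rw [layer, add_div]; linarith
    rw [Finset.sum_add_distrib] at this
    simp only [Finset.sum_const, Finset.card_univ, Fintype.card_fin, nsmul_eq_mul] at this
    unfold layerWeight; linarith
  have h1 := one_le_layerWeight (α := α) hε x
  have h2 : 0 ≤ (n : ℝ) * (32 / α) := by positivity
  nlinarith

theorem layer_one_sub (α e x : ℝ) : layer α e (1 - x) = layer α e x := by
  unfold layer; rw [sub_sub_cancel, add_comm]

theorem layerWeight_one_sub (x : ℝ) : layerWeight α ε (1 - x) = layerWeight α ε x := by
  simp only [layerWeight, layer_one_sub]

theorem layerWeight_le_of_half_le (hα : 0 < α) (hε : ∀ i, 0 < ε i) {x y : ℝ} (hxy : y ≤ x)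
    (hy : 1 / 4 ≤ y) : layerWeight α ε y ≤ (1 + n * (32 / α)) * layerWeight α ε x := by
  have := layerWeight_le_of_le_half hα hε (x := 1 - x) (y := 1 - y) (by linarith) (by linarith)
  rwa [layerWeight_one_sub, layerWeight_one_sub] at this

end weight

/-- The mean value theorem gives a point where f' equals the slope over [a, b], and the bound on f''
transports this to c. The length b - a is a free parameter balancing the two terms. -/
theorem abs_deriv_le_of_bounds {f f' f'' : ℝ → ℝ} (hf : TwiceDeriv f f' f'') {a b c K D : ℝ}
    (hab : a < b) (ha : 0 < a) (hb : b < 1) (hc : c ∈ Icc a b) (hK : ∀ y ∈ Icc a b, |f y| ≤ K)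
    (hD : ∀ y ∈ Icc a b, |f'' y| ≤ D) : |f' c| ≤ 2 * K / (b - a) + (b - a) * D := by
  have hsub : ∀ y ∈ Icc a b, y ∈ Ioo (0 : ℝ) 1 := fun y hy =>
    ⟨ha.trans_le hy.1, hy.2.trans_lt hb⟩
  obtain ⟨ξ, hξ, hξ'⟩ := exists_hasDerivAt_eq_slope f f' hab
    (fun y hy => (hf y (hsub y hy)).1.continuousAt.continuousWithinAt)
    (fun y hy => (hf y (hsub y (Ioo_subset_Icc_self hy))).1)
  have hpos : 0 < b - a := sub_pos.2 hab
  have h1 : |f' ξ| ≤ 2 * K / (b - a) := by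
    rw [hξ', abs_div, abs_of_pos hpos]
    gcongr
    have h2 := abs_sub (f b) (f a)
    linarith [hK a ⟨le_rfl, hab.le⟩, hK b ⟨hab.le, le_rfl⟩]
  have h2 : ‖f' c - f' ξ‖ ≤ D * ‖c - ξ‖ :=
    Convex.norm_image_sub_le_of_norm_hasDerivWithin_le
      (fun y hy => (hf y (hsub y hy)).2.hasDerivWithinAt) hD (convex_Icc a b)
      (Ioo_subset_Icc_self hξ) hc
  have hD0 : 0 ≤ D := (abs_nonneg _).trans (hD c hc)
  have h3 : |c - ξ| ≤ b - a := by
    rw [abs_le]; constructor <;> linarith [hc.1, hc.2, hξ.1, hξ.2]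
  rw [Real.norm_eq_abs, Real.norm_eq_abs] at h2
  have h4 : D * |c - ξ| ≤ (b - a) * D := by rw [mul_comm]; gcongr
  have h5 : |f' c| ≤ |f' c - f' ξ| + |f' ξ| := by
    have := abs_add_le (f' c - f' ξ) (f' ξ); simpa using this
  linarith

/-- Interpolation between a function and its second derivative, both measured with the weight. -/
theorem abs_deriv_le_layerWeight {n : ℕ} {α : ℝ} {ε : Fin n → ℝ} (hα : 0 < α)
    (hε : ∀ i, 0 < ε i) {f f' f'' : ℝ → ℝ} (hf : TwiceDeriv f f' f'') {K D : ℝ}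
    (hK0 : 0 ≤ K) (hD0 : 0 ≤ D)
    (hK : ∀ y ∈ Ioo (0 : ℝ) 1, |f y| ≤ K * layerWeight α ε y)
    (hD : ∀ y ∈ Ioo (0 : ℝ) 1, |f'' y| ≤ D * layerWeight α ε y) {l : ℝ} (hl : 0 < l)
    (hl' : l ≤ 1 / 4) {x : ℝ} (hx : x ∈ Ioo (0 : ℝ) 1) :
    |f' x| ≤ (1 + n * (32 / α)) * (2 * K / l + l * D) * layerWeight α ε x := by
  -- The interval has x as an end point and extends towards the middle of [0,1], where the weight is
  -- controlled by its value at x.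
  obtain ⟨a, b, hab, ha, hb, hxab, hw⟩ : ∃ a b, b - a = l ∧ 0 < a ∧ b < 1 ∧ x ∈ Icc a b ∧
      ∀ y ∈ Icc a b, layerWeight α ε y ≤ (1 + n * (32 / α)) * layerWeight α ε x := by
    rcases le_total x (1 / 2) with h | h
    · exact ⟨x, x + l, by ring, hx.1, by linarith, ⟨le_rfl, by linarith⟩, fun y hy =>
        layerWeight_le_of_le_half hα hε hy.1 (by linarith [hy.2])⟩
    · exact ⟨x - l, x, by ring, by linarith, hx.2, ⟨by linarith, le_rfl⟩, fun y hy =>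
        layerWeight_le_of_half_le hα hε hy.2 (by linarith [hy.1])⟩
  set W := (1 + n * (32 / α)) * layerWeight α ε x
  have hsub : ∀ y ∈ Icc a b, y ∈ Ioo (0 : ℝ) 1 := fun y hy =>
    ⟨ha.trans_le hy.1, hy.2.trans_lt hb⟩
  have h := abs_deriv_le_of_bounds hf (K := K * W) (D := D * W) (by linarith) ha hb hxab
    (fun y hy => (hK y (hsub y hy)).trans (by gcongr; exact hw y hy))
    (fun y hy => (hD y (hsub y hy)).trans (by gcongr; exact hw y hy))
  rw [hab] at h
  refine h.trans (le_of_eq ?_)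
  simp only [W]; ring

/-! ### The barrier for the second derivatives. -/

/-- The negative coefficients in row i of the barrier add up to such a geometric sum. A large ρ
makes it small against the positive coefficient ρ^i of B_i/ε_i. -/
theorem sum_ite_lt_pow {n : ℕ} (ρ : ℝ) (i : Fin n) :
    (ρ - 1) * ∑ m : Fin n, (if m < i then ρ ^ (m : ℕ) else 0) = ρ ^ (i : ℕ) - 1 := by
  have h : ∑ m : Fin n, (if m < i then ρ ^ (m : ℕ) else 0) =
      ∑ r ∈ Finset.range i, ρ ^ r := by
    have h1 := Fin.sum_univ_eq_sum_range (fun r => if r < (i : ℕ) then ρ ^ r else 0) n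
    simp only [Fin.lt_def]
    rw [h1, ← Finset.sum_filter]
    congr 1
    ext r
    simp only [Finset.mem_filter, Finset.mem_range]
    have := i.isLt
    omega
  rw [h, mul_geom_sum]

/-- The coefficients of the layer functions in the barrier for the second derivatives. -/
noncomputable def barrierCoeff {n : ℕ} (ρ lam : ℝ) (ε : Fin n → ℝ) (i m : Fin n) : ℝ :=
  if i ≤ m then ρ ^ (m : ℕ) / ε m else -(lam * ρ ^ (m : ℕ) / ε i)

/-- The barrier for the second derivatives of the solution. -/
noncomputable def barrier {n : ℕ} (α ρ lam : ℝ) (ε : Fin n → ℝ) (i : Fin n) (x : ℝ) : ℝ :=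
  1 + ∑ m, barrierCoeff ρ lam ε i m * layer α (ε m) x

/-- The second derivative of `barrier`. -/
noncomputable def barrierDeriv₂ {n : ℕ} (α ρ lam : ℝ) (ε : Fin n → ℝ) (i : Fin n) (x : ℝ) : ℝ :=
  0 + ∑ m, barrierCoeff ρ lam ε i m * (α / ε m * layer α (ε m) x)

theorem exists_twiceDeriv_barrier {n : ℕ} {α : ℝ} (hα : 0 < α) (ρ lam : ℝ) {ε : Fin n → ℝ}
    (hε : ∀ i, 0 < ε i) (i : Fin n) :
    ∃ b', TwiceDeriv (barrier α ρ lam ε i) b' (barrierDeriv₂ α ρ lam ε i) :=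
  ⟨_, (TwiceDeriv.const 1).add (TwiceDeriv.sum Finset.univ fun m _ =>
    (twiceDeriv_layer hα (hε m)).const_mul (barrierCoeff ρ lam ε i m))⟩

theorem continuous_barrier {n : ℕ} (α ρ lam : ℝ) (ε : Fin n → ℝ) (i : Fin n) :
    Continuous (barrier α ρ lam ε i) :=
  continuous_const.add (continuous_finsetSum _ fun _ _ => continuous_const.mul (continuous_layer _ _))

section

variable {n : ℕ} {α δ M : ℝ} {A : ℝ → Matrix (Fin n) (Fin n) ℝ}
  {A' A'' : Fin n → Fin n → ℝ → ℝ} {f : ℝ → Fin n → ℝ} {f' f'' : Fin n → ℝ → ℝ}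
  {g₀ g₁ : Fin n → ℝ} {ρ lam : ℝ} {ε : Fin n → ℝ}

theorem barrierCoeff_le (hρ : 1 ≤ ρ) (hlam : 0 ≤ lam) (hε : ∀ i, 0 < ε i) (k m : Fin n) :
    barrierCoeff ρ lam ε k m ≤ ρ ^ (m : ℕ) / ε m := by
  have h1 := hε m
  have h2 := hε k
  unfold barrierCoeff
  split_ifs
  · exact le_rfl
  · have : 0 ≤ lam * ρ ^ (m : ℕ) / ε k := by positivity
    have : 0 ≤ ρ ^ (m : ℕ) / ε m := by positivity
    linarith

theorem barrier_le (hρ : 1 ≤ ρ) (hlam : 0 ≤ lam) (hε : ∀ i, 0 < ε i) (i : Fin n) (x : ℝ) :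
    barrier α ρ lam ε i x ≤ ρ ^ n * layerWeight α ε x := by
  have hp : 1 ≤ ρ ^ n := one_le_pow₀ hρ
  have h : ∑ m, barrierCoeff ρ lam ε i m * layer α (ε m) x ≤
      ∑ m, ρ ^ n * (layer α (ε m) x / ε m) := by
    refine Finset.sum_le_sum fun m _ => ?_
    have h1 := barrierCoeff_le hρ hlam hε i m
    have h2 : ρ ^ (m : ℕ) / ε m ≤ ρ ^ n / ε m := by
      have := (hε m).le
      gcongr
      exact m.isLt.le
    have h3 := mul_le_mul_of_nonneg_right (h1.trans h2) (layer_pos α (ε m) x).le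
    calc _ ≤ _ := h3
      _ = _ := by ring
  rw [← Finset.mul_sum] at h
  unfold barrier layerWeight
  rw [mul_add]; linarith

/-- For m < i one has B_m ≤ B_i, so the negative terms total at most λ(B_i/ε_i)∑_{m<i} ρ^m. As λ ≤ ρ
- 1, this is at most (ρ^i - 1)B_i/ε_i, and one B_i/ε_i is left of the diagonal term. -/
theorem barrier_ge (hα : 0 < α) (hρ : 1 + lam ≤ ρ) (hlam : 0 ≤ lam) (hε : ∀ i, 0 < ε i)
    (hmono : StrictMono ε) (i : Fin n) {x : ℝ} (hx : x ∈ Icc (0 : ℝ) 1) :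
    1 + layer α (ε i) x / ε i ≤ barrier α ρ lam ε i x := by
  have hρ0 : 0 ≤ ρ := by linarith
  have hB := (layer_pos α (ε i) x).le
  have h : ∑ m, ((if m = i then ρ ^ (i : ℕ) * (layer α (ε i) x / ε i) else 0) -
      (lam * (layer α (ε i) x / ε i)) * (if m < i then ρ ^ (m : ℕ) else 0)) ≤
      ∑ m, barrierCoeff ρ lam ε i m * layer α (ε m) x := by
    refine Finset.sum_le_sum fun m _ => ?_
    have hBm := (layer_pos α (ε m) x).le
    have hεm := hε m
    have hεi := hε i
    unfold barrierCoeff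
    rcases lt_trichotomy m i with hmi | rfl | hmi
    · rw [if_neg hmi.ne, if_pos hmi, if_neg (not_le.2 hmi)]
      have h1 := layer_mono hα (hε m) (hmono hmi).le hx
      have h2 : lam * ρ ^ (m : ℕ) / ε i * layer α (ε m) x ≤
          lam * ρ ^ (m : ℕ) / ε i * layer α (ε i) x := by gcongr
      have h3 : lam * ρ ^ (m : ℕ) / ε i * layer α (ε i) x =
        (lam * (layer α (ε i) x / ε i)) * ρ ^ (m : ℕ) := by ring
      linarith
    · simp only [if_true, lt_irrefl, if_false, le_refl, mul_zero, sub_zero]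
      exact le_of_eq (by ring)
    · rw [if_neg hmi.ne', if_neg (not_lt.2 hmi.le), if_pos hmi.le]
      simp only [mul_zero, sub_zero]
      positivity
  rw [Finset.sum_sub_distrib, ← Finset.mul_sum] at h
  simp only [Finset.sum_ite_eq', Finset.mem_univ, if_true] at h
  have hs := sum_ite_lt_pow ρ i
  set σ := ∑ m : Fin n, (if m < i then ρ ^ (m : ℕ) else 0)
  have hσ : 0 ≤ σ := Finset.sum_nonneg fun m _ => by split_ifs <;> positivity
  have hε' := hε i
  have hq : 0 ≤ layer α (ε i) x / ε i := by positivity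
  have h2 : lam * σ ≤ ρ ^ (i : ℕ) - 1 := by
    rw [← hs]; exact mul_le_mul_of_nonneg_right (by linarith) hσ
  have h3 := mul_le_mul_of_nonneg_left h2 hq
  unfold barrier
  nlinarith

/-- In rows i ≤ m the diffusion term costs only αε_i/ε_m ≤ α, which the row sum covers with δ to
spare. The coefficient of row i is the largest in its column, so `row_mul_le` applies to the
negatives. -/
theorem barrierCoeff_row_of_le (hD : SystemData α δ M A A' A'' f f' f'' g₀ g₁)
    (hρ : 1 ≤ ρ) (hlam : 0 ≤ lam) (hε : ∀ i, 0 < ε i) (hmono : StrictMono ε) {x : ℝ}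
    (hx : x ∈ Icc (0 : ℝ) 1) {i m : Fin n} (him : i ≤ m) :
    δ * (ρ ^ (m : ℕ) / ε m) ≤ -(ε i * (barrierCoeff ρ lam ε i m * (α / ε m))) +
      ∑ k, A x i k * barrierCoeff ρ lam ε k m := by
  have hci : barrierCoeff ρ lam ε i m = ρ ^ (m : ℕ) / ε m := if_pos him
  have h1 := hD.row_mul_le hx (i := i) (y := fun k => -barrierCoeff ρ lam ε k m) fun k => by
    rw [hci]; exact neg_le_neg (barrierCoeff_le hρ hlam hε k m)
  simp only [mul_neg, Finset.sum_neg_distrib, hci] at h1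
  have h2 := hD.row x hx i
  have hεm := hε m
  have hp : 0 ≤ ρ ^ (m : ℕ) / ε m := by positivity
  have h3 : ε i * (ρ ^ (m : ℕ) / ε m * (α / ε m)) ≤ α * (ρ ^ (m : ℕ) / ε m) := by
    have h4 : ε i * (α / ε m) ≤ α := by
      rw [← mul_div_assoc, div_le_iff₀ hεm, mul_comm]
      exact mul_le_mul_of_nonneg_left (hmono.monotone him) hD.alpha_pos.le
    nlinarith
  have h5 := mul_le_mul_of_nonneg_right h2 hp
  rw [hci]
  linarith

/-- In rows i > m a positive coefficient would make the diffusion term hugely negative, hence the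
reversed sign. The term -ε_i c'' then gains λα = Mn + δ times ρ^m/ε_m, which dominates the coupling.
The only deficit is the diagonal one, with 1/ε_i in place of 1/ε_m. -/
theorem barrierCoeff_row_of_lt (hD : SystemData α δ M A A' A'' f f' f'' g₀ g₁)
    (hρ : 1 ≤ ρ) (hlam : lam * α = M * n + δ) (hlam0 : 0 ≤ lam) (hε : ∀ i, 0 < ε i) {x : ℝ}
    (hx : x ∈ Icc (0 : ℝ) 1) {i m : Fin n} (him : m < i) :
    δ * (ρ ^ (m : ℕ) / ε m) - M * lam * ρ ^ (m : ℕ) / ε i ≤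
      -(ε i * (barrierCoeff ρ lam ε i m * (α / ε m))) +
      ∑ k, A x i k * barrierCoeff ρ lam ε k m := by
  have hci : barrierCoeff ρ lam ε i m = -(lam * ρ ^ (m : ℕ) / ε i) := if_neg (not_le.2 him)
  have hM0 : 0 ≤ M := by linarith [hD.one_le]
  have hεm := hε m
  have hεi := hε i
  have h1 : ∑ k, (-(M * (ρ ^ (m : ℕ) / ε m)) -
      (if k = i then M * lam * ρ ^ (m : ℕ) / ε i else 0)) ≤
      ∑ k, A x i k * barrierCoeff ρ lam ε k m := by
    refine Finset.sum_le_sum fun k _ => ?_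
    have hA := abs_le.1 (hD.boundA x hx i k).1
    have hp : 0 ≤ ρ ^ (m : ℕ) / ε m := by positivity
    rcases eq_or_ne k i with rfl | hki
    · rw [if_pos rfl, hci]
      have hq : 0 ≤ lam * ρ ^ (m : ℕ) / ε k := by positivity
      have : A x k k * (lam * ρ ^ (m : ℕ) / ε k) ≤ M * (lam * ρ ^ (m : ℕ) / ε k) :=
        mul_le_mul_of_nonneg_right hA.2 hq
      have h3 : M * lam * ρ ^ (m : ℕ) / ε k = M * (lam * ρ ^ (m : ℕ) / ε k) := by ring
      have h4 := mul_nonneg hM0 hp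
      rw [h3]
      linarith
    · rw [if_neg hki]
      rcases le_or_gt k m with hkm | hkm
      · have : barrierCoeff ρ lam ε k m = ρ ^ (m : ℕ) / ε m := if_pos hkm
        rw [this]
        nlinarith [hA.1]
      · have : barrierCoeff ρ lam ε k m = -(lam * ρ ^ (m : ℕ) / ε k) := if_neg (not_le.2 hkm)
        rw [this]
        have hεk := hε k
        have hq : 0 ≤ lam * ρ ^ (m : ℕ) / ε k := by positivity
        have := mul_nonneg (neg_nonneg.2 (hD.off x hx i k hki.symm)) hq
        have h4 := mul_nonneg hM0 hp
        linarith
  rw [Finset.sum_sub_distrib] at h1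
  simp only [Finset.sum_ite_eq', Finset.mem_univ, if_true, Finset.sum_const, Finset.card_univ,
    Fintype.card_fin, nsmul_eq_mul] at h1
  have h2 : -(ε i * (barrierCoeff ρ lam ε i m * (α / ε m))) =
      (M * n + δ) * (ρ ^ (m : ℕ) / ε m) := by
    rw [hci, ← hlam]; field_simp
  rw [h2]
  linarith

/-- The image of the barrier under the differential operator dominates the weight. -/
theorem barrier_operator_ge (hD : SystemData α δ M A A' A'' f f' f'' g₀ g₁)
    (hlam : lam * α = M * n + δ) (hlam0 : 0 ≤ lam) (hρ : ρ = 1 + M * lam / δ + lam)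
    (hε : ∀ i, 0 < ε i) (hmono : StrictMono ε) (i : Fin n) {x : ℝ} (hx : x ∈ Icc (0 : ℝ) 1) :
    min α δ * layerWeight α ε x ≤
      -(ε i * barrierDeriv₂ α ρ lam ε i x) + ∑ k, A x i k * barrier α ρ lam ε k x := by
  have hδ := hD.delta_pos
  have hM0 : 0 ≤ M := by linarith [hD.one_le]
  have hMl : 0 ≤ M * lam / δ := by positivity
  have hρ1 : 1 ≤ ρ := by linarith
  have hεi := hε i
  have hexp : -(ε i * barrierDeriv₂ α ρ lam ε i x) + ∑ k, A x i k * barrier α ρ lam ε k x =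
      (∑ k, A x i k) + ∑ m, (-(ε i * (barrierCoeff ρ lam ε i m * (α / ε m))) +
        ∑ k, A x i k * barrierCoeff ρ lam ε k m) * layer α (ε m) x := by
    have e1 : ∑ k, A x i k * barrier α ρ lam ε k x = (∑ k, A x i k) +
        ∑ m, (∑ k, A x i k * barrierCoeff ρ lam ε k m) * layer α (ε m) x := by
      simp only [barrier, mul_add, mul_one, Finset.sum_add_distrib, Finset.mul_sum,
        Finset.sum_mul]
      rw [Finset.sum_comm (s := (Finset.univ : Finset (Fin n)))]
      simp only [mul_assoc]
    have e2 : -(ε i * barrierDeriv₂ α ρ lam ε i x) =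
        ∑ m, -(ε i * (barrierCoeff ρ lam ε i m * (α / ε m))) * layer α (ε m) x := by
      rw [barrierDeriv₂, zero_add, Finset.mul_sum, ← Finset.sum_neg_distrib]
      exact Finset.sum_congr rfl fun m _ => by ring
    simp only [add_mul, Finset.sum_add_distrib]
    rw [e1, e2]; ring
  rw [hexp]
  set y := layer α (ε i) x / ε i with hy
  have hB : ∀ m, 0 ≤ layer α (ε m) x := fun m => (layer_pos _ _ _).le
  have hy0 : 0 ≤ y := div_nonneg (hB i) hεi.le
  have hterm : ∑ m : Fin n, (δ * ρ ^ (m : ℕ) * (layer α (ε m) x / ε m) -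
      M * lam * y * (if m < i then ρ ^ (m : ℕ) else 0)) ≤
      ∑ m, (-(ε i * (barrierCoeff ρ lam ε i m * (α / ε m))) +
        ∑ k, A x i k * barrierCoeff ρ lam ε k m) * layer α (ε m) x := by
    refine Finset.sum_le_sum fun m _ => ?_
    rcases lt_or_ge m i with hmi | hmi
    · have h1 := mul_le_mul_of_nonneg_right
        (barrierCoeff_row_of_lt hD hρ1 hlam hlam0 hε hx hmi) (hB m)
      refine le_trans ?_ h1
      rw [if_pos hmi, sub_mul]
      have h2 : M * lam * ρ ^ (m : ℕ) / ε i * layer α (ε m) x ≤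
          M * lam * ρ ^ (m : ℕ) / ε i * layer α (ε i) x := by
        have := layer_mono hD.alpha_pos (hε m) (hmono hmi).le hx
        gcongr
      have h3 : M * lam * ρ ^ (m : ℕ) / ε i * layer α (ε i) x = M * lam * y * ρ ^ (m : ℕ) := by
        rw [hy]; ring
      have h4 : δ * ρ ^ (m : ℕ) * (layer α (ε m) x / ε m) =
        δ * (ρ ^ (m : ℕ) / ε m) * layer α (ε m) x := by ring
      linarith
    · have h1 := mul_le_mul_of_nonneg_right
        (barrierCoeff_row_of_le hD hρ1 hlam0 hε hmono hx hmi) (hB m)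
      refine le_trans (le_of_eq ?_) h1
      rw [if_neg (not_lt.2 hmi)]; ring
  rw [Finset.sum_sub_distrib, ← Finset.mul_sum] at hterm
  have hs := sum_ite_lt_pow ρ i
  set σ := ∑ m : Fin n, (if m < i then ρ ^ (m : ℕ) else 0)
  have hσ : 0 ≤ σ := Finset.sum_nonneg fun m _ => by split_ifs <;> positivity
  -- Here the summand Mλ/δ of ρ is used: the deficits of all columns m < i fit into the excess δ(ρ^i
  -- - 1) of column i. The summand λ of ρ serves the lower bound `barrier_ge`.
  have h2 : M * lam * σ ≤ δ * (ρ ^ (i : ℕ) - 1) := by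
    rw [← hs]
    have : M * lam = δ * (M * lam / δ) := by field_simp
    have h3 : M * lam / δ * σ ≤ (ρ - 1) * σ := mul_le_mul_of_nonneg_right (by linarith) hσ
    calc M * lam * σ = δ * (M * lam / δ * σ) := by rw [this]; field_simp
      _ ≤ δ * ((ρ - 1) * σ) := by gcongr
  have h3 : δ * (ρ ^ (i : ℕ) - 1) * y ≤
      ∑ m : Fin n, δ * (ρ ^ (m : ℕ) - 1) * (layer α (ε m) x / ε m) := by
    refine Finset.single_le_sum
      (f := fun m : Fin n => δ * (ρ ^ (m : ℕ) - 1) * (layer α (ε m) x / ε m))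
      (fun m _ => ?_) (Finset.mem_univ i)
    have h4 : 0 ≤ ρ ^ (m : ℕ) - 1 := sub_nonneg.2 (one_le_pow₀ hρ1)
    have h5 := hB m
    have h6 := hε m
    positivity
  have h4 : ∑ m : Fin n, δ * (ρ ^ (m : ℕ) - 1) * (layer α (ε m) x / ε m) =
      ∑ m : Fin n, δ * ρ ^ (m : ℕ) * (layer α (ε m) x / ε m) -
        δ * ∑ m, layer α (ε m) x / ε m := by
    rw [Finset.mul_sum, ← Finset.sum_sub_distrib]
    exact Finset.sum_congr rfl fun m _ => by ring
  have h5 := mul_le_mul_of_nonneg_right h2 hy0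
  have h6 := hD.row x hx i
  have hsum : 0 ≤ ∑ m, layer α (ε m) x / ε m :=
    Finset.sum_nonneg fun m _ => div_nonneg (hB m) (hε m).le
  have h7 : min α δ * layerWeight α ε x ≤ α + δ * ∑ m, layer α (ε m) x / ε m := by
    unfold layerWeight
    rw [mul_add, mul_one]
    gcongr
    · exact min_le_left _ _
    · exact min_le_right _ _
  linarith

end

/-! ### Bounds for the solution and its second derivatives, uniform in ε. -/

/-- The second derivatives `ε_i u_i'' = (A u)_i - f_i` of a solution. -/
def reaction {n : ℕ} (A : ℝ → Matrix (Fin n) (Fin n) ℝ) (f u : ℝ → Fin n → ℝ) (i : Fin n)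
    (x : ℝ) : ℝ :=
  ∑ k, A x i k * u x k - f x i

section

variable {n : ℕ} {α δ M : ℝ} {A : ℝ → Matrix (Fin n) (Fin n) ℝ}
  {A' A'' : Fin n → Fin n → ℝ → ℝ} {f : ℝ → Fin n → ℝ} {f' f'' : Fin n → ℝ → ℝ}
  {g₀ g₁ : Fin n → ℝ} {ε : Fin n → ℝ} {u : ℝ → Fin n → ℝ}

theorem IsExactSolution.continuousOn_apply (hu : IsExactSolution ε A f g₀ g₁ u) (i : Fin n) :
    ContinuousOn (fun x => u x i) (Icc 0 1) :=
  continuousOn_pi.1 hu.continuousOn i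

theorem IsExactSolution.twiceDeriv (hu : IsExactSolution ε A f g₀ g₁ u) (hε : ∀ i, 0 < ε i)
    (i : Fin n) : TwiceDeriv (fun x => u x i) (deriv fun x => u x i)
      (fun x => (ε i)⁻¹ * reaction A f u i x) := by
  have hc : ContDiffOn ℝ 2 (fun x => u x i) (Ioo 0 1) := contDiffOn_pi.1 hu.contDiffOn i
  have hc1 : ContDiffOn ℝ 1 (deriv fun x => u x i) (Ioo 0 1) :=
    hc.deriv_of_isOpen isOpen_Ioo (by norm_num)
  intro x hx
  refine ⟨((hc.differentiableOn (by norm_num)).differentiableAt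
    (isOpen_Ioo.mem_nhds hx)).hasDerivAt, ?_⟩
  have h := ((hc1.differentiableOn (by norm_num)).differentiableAt
    (isOpen_Ioo.mem_nhds hx)).hasDerivAt
  have h2 := hu.equation x hx i
  rw [iteratedDeriv_succ, iteratedDeriv_one] at h2
  have h3 : reaction A f u i x = ε i * deriv (deriv fun x => u x i) x := by
    simp only [reaction]; linarith
  refine h.congr_deriv ?_
  dsimp only
  rw [h3, inv_mul_cancel_left₀ (hε i).ne']

theorem SystemData.continuousOn_reaction (hD : SystemData α δ M A A' A'' f f' f'' g₀ g₁)
    (hu : IsExactSolution ε A f g₀ g₁ u) (i : Fin n) :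
    ContinuousOn (reaction A f u i) (Icc 0 1) :=
  (continuousOn_finsetSum _ fun k _ => (hD.contA i k).mul (hu.continuousOn_apply k)).sub
    (hD.contf i)

/-- The product rule for Au - f, with u_k'' replaced by q_k/ε_k from the equation. Fourth-order
information on u is thus obtained without assuming a fourth derivative. -/
theorem SystemData.twiceDeriv_reaction (hD : SystemData α δ M A A' A'' f f' f'' g₀ g₁)
    (hu : IsExactSolution ε A f g₀ g₁ u) (hε : ∀ i, 0 < ε i) (i : Fin n) :
    ∃ q', TwiceDeriv (reaction A f u i) q' (fun x => ∑ k, (A'' i k x * u x k +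
      2 * (A' i k x * deriv (fun x => u x k) x) +
      A x i k * ((ε k)⁻¹ * reaction A f u k x)) - f'' i x) :=
  ⟨_, (TwiceDeriv.sum Finset.univ fun k _ => (hD.derivA i k).mul (hu.twiceDeriv hε k)).sub
    (hD.derivf i)⟩

theorem SystemData.abs_solution_le (hD : SystemData α δ M A A' A'' f f' f'' g₀ g₁)
    (hu : IsExactSolution ε A f g₀ g₁ u) (hε : ∀ i, 0 < ε i) {x : ℝ} (hx : x ∈ Icc (0 : ℝ) 1)
    (i : Fin n) : |u x i| ≤ M * (1 + 1 / α) := by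
  have hα := hD.alpha_pos
  have hM : 0 ≤ M := by linarith [hD.one_le]
  have hMK : M ≤ M * (1 + 1 / α) := by
    have : 0 ≤ 1 / α := by positivity
    nlinarith
  refine hD.abs_le_of_barrier hε (v := fun i x => u x i) (b := fun _ _ => M * (1 + 1 / α))
    (b' := fun _ _ => 0) (b'' := fun _ _ => 0)
    hu.continuousOn_apply (hu.twiceDeriv hε) (fun _ => continuousOn_const)
    (fun _ => TwiceDeriv.const _) (fun i => ?_) (fun i => ?_) (fun i x hx => ?_) i x hx
  · rw [hu.left_value]; exact (hD.bound₀ i).trans hMK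
  · rw [hu.right_value]; exact (hD.bound₁ i).trans hMK
  · have hx' := Ioo_subset_Icc_self hx
    have h1 : -(ε i * ((ε i)⁻¹ * reaction A f u i x)) + ∑ k, A x i k * u x k = f x i := by
      rw [mul_inv_cancel_left₀ (hε i).ne', reaction]; ring
    rw [h1, ← Finset.sum_mul]
    have h2 := hD.row x hx' i
    have h3 : α * (M * (1 + 1 / α)) = α * M + M := by field_simp
    have h4 : α * (M * (1 + 1 / α)) ≤ (∑ k, A x i k) * (M * (1 + 1 / α)) := by
      gcongr; linarith [hD.delta_pos]
    have h5 := (hD.boundf x hx' i).1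
    have h6 := mul_nonneg hα.le hM
    linarith

theorem abs_sum_mul_le {a b : Fin n → ℝ} {K L : ℝ} (ha : ∀ k, |a k| ≤ K) (hb : ∀ k, |b k| ≤ L) :
    |∑ k, a k * b k| ≤ n * (K * L) := by
  refine (Finset.abs_sum_le_sum_abs _ _).trans ?_
  have : ∑ k : Fin n, |a k * b k| ≤ ∑ _k : Fin n, K * L := by
    refine Finset.sum_le_sum fun k _ => ?_
    rw [abs_mul]
    exact mul_le_mul (ha k) (hb k) (abs_nonneg _) ((abs_nonneg _).trans (ha k))
  simpa using this

theorem SystemData.abs_reaction_le (hD : SystemData α δ M A A' A'' f f' f'' g₀ g₁)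
    (hu : IsExactSolution ε A f g₀ g₁ u) (hε : ∀ i, 0 < ε i) {x : ℝ} (hx : x ∈ Icc (0 : ℝ) 1)
    (i : Fin n) : |reaction A f u i x| ≤ n * (M * (M * (1 + 1 / α))) + M := by
  have h1 := abs_sum_mul_le (fun k => (hD.boundA x hx i k).1)
    (fun k => hD.abs_solution_le hu hε hx k)
  exact (abs_sub _ _).trans (add_le_add h1 (hD.boundf x hx i).1)

/-- One improvement step for the constant in the bound of the second derivatives. -/
theorem SystemData.bootstrap (hD : SystemData α δ M A A' A'' f f' f'' g₀ g₁)
    (hu : IsExactSolution ε A f g₀ g₁ u) (hε : ∀ i, 0 < ε i) (hmono : StrictMono ε)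
    {lam ρ C l S P : ℝ} (hlam : lam * α = M * n + δ) (hlam0 : 0 ≤ lam)
    (hρ : ρ = 1 + M * lam / δ + lam) (hC : C = 1 + n * (32 / α)) (hl0 : 0 < l) (hl : l ≤ 1 / 4)
    (hl' : 2 * n * M * C * ρ ^ n * l ≤ min α δ / 2) (hS0 : 0 ≤ S)
    (hP : P = (n * (M * (M * (1 + 1 / α))) + M) + (n * (M * (M * (1 + 1 / α))) + M +
      2 * n * M * C * (2 * (M * (1 + 1 / α)) / l)) / min α δ)
    (hS : ∀ i, ∀ x ∈ Icc (0 : ℝ) 1,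
      |(ε i)⁻¹ * reaction A f u i x| ≤ S * barrier α ρ lam ε i x) :
    ∀ i, ∀ x ∈ Icc (0 : ℝ) 1,
      |(ε i)⁻¹ * reaction A f u i x| ≤ (P + S / 2) * barrier α ρ lam ε i x := by
  have hα := hD.alpha_pos
  have hδ := hD.delta_pos
  have hM : 0 ≤ M := by linarith [hD.one_le]
  have hc : 0 < min α δ := lt_min hα hδ
  have hC0 : 0 ≤ C := by rw [hC]; positivity
  have hMl : 0 ≤ M * lam / δ := by positivity
  have hρ1 : 1 ≤ ρ := by linarith
  set K₀ := M * (1 + 1 / α) with hK₀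
  have hK₀0 : 0 ≤ K₀ := by positivity
  set K₁ := n * (M * K₀) + M with hK₁
  have hK₁0 : 0 ≤ K₁ := by positivity
  have hP1 : K₁ ≤ P := by
    have : 0 ≤ (K₁ + 2 * n * M * C * (2 * K₀ / l)) / min α δ := by positivity
    linarith
  have hP0 : 0 ≤ P := hK₁0.trans hP1
  choose q' hq' using hD.twiceDeriv_reaction hu hε
  choose b' hb' using exists_twiceDeriv_barrier hα ρ lam hε
  -- This serves the end points: there B_i ≥ 1, so the barrier is at least 1/ε_i, while q_i is
  -- bounded by K₁ ≤ P.
  have hbd : ∀ i, ∀ x ∈ Icc (0 : ℝ) 1, 1 ≤ layer α (ε i) x →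
      |(ε i)⁻¹ * reaction A f u i x| ≤ (P + S / 2) * barrier α ρ lam ε i x := by
    intro i x hx hB
    have hεi := hε i
    have h1 := hD.abs_reaction_le hu hε hx i
    have h2 := barrier_ge (α := α) (ρ := ρ) hα (by linarith) hlam0 hε hmono i hx
    have h3 : (ε i)⁻¹ ≤ layer α (ε i) x / ε i := by
      rw [← one_div]; gcongr
    rw [abs_mul, abs_of_pos (inv_pos.2 hεi)]
    calc (ε i)⁻¹ * |reaction A f u i x| ≤ (ε i)⁻¹ * K₁ := by gcongr
      _ ≤ barrier α ρ lam ε i x * (P + S / 2) := by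
        apply mul_le_mul (by linarith) (by linarith) hK₁0
        have := inv_pos.2 hεi
        linarith
      _ = _ := mul_comm _ _
  refine hD.abs_le_of_barrier hε
    (fun i => continuousOn_const.mul (hD.continuousOn_reaction hu i))
    (fun i => (hq' i).const_mul _)
    (fun i => continuousOn_const.mul (continuous_barrier α ρ lam ε i).continuousOn)
    (fun i => (hb' i).const_mul _)
    (fun i => hbd i 0 (by simp) (one_le_layer_zero _ _))
    (fun i => hbd i 1 (by simp) (one_le_layer_one _ _)) (fun i x hx => ?_)
  have hx' := Ioo_subset_Icc_self hx
  set w := layerWeight α ε x with hw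
  have hw1 : 1 ≤ w := one_le_layerWeight hε x
  have hbop := barrier_operator_ge hD hlam hlam0 hρ hε hmono i hx'
  -- Interpolation with step l: the assumed constant S enters the bound for u' only with the small
  -- factor l.
  have hU : ∀ k, |deriv (fun x => u x k) x| ≤ C * (2 * K₀ / l + l * (S * ρ ^ n)) * w := by
    intro k
    rw [hC]
    refine abs_deriv_le_layerWeight hα hε (hu.twiceDeriv hε k) hK₀0 (by positivity)
      (fun y hy => ?_) (fun y hy => ?_) hl0 hl hx
    · have h1 := hD.abs_solution_le hu hε (Ioo_subset_Icc_self hy) k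
      have h2 := one_le_layerWeight (α := α) hε y
      nlinarith
    · refine (hS k y (Ioo_subset_Icc_self hy)).trans ?_
      rw [mul_assoc S]
      exact mul_le_mul_of_nonneg_left (barrier_le hρ1 hlam0 hε k y) hS0
  -- The equation differentiated twice: in the system for u'', the terms A u'' cancel and only u and
  -- u' remain on the right.
  have hlhs : -(ε i * ((ε i)⁻¹ * (∑ k, (A'' i k x * u x k +
      2 * (A' i k x * deriv (fun x => u x k) x) +
      A x i k * ((ε k)⁻¹ * reaction A f u k x)) - f'' i x))) +
      ∑ k, A x i k * ((ε k)⁻¹ * reaction A f u k x) =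
      f'' i x - ∑ k, A'' i k x * u x k - 2 * ∑ k, A' i k x * deriv (fun x => u x k) x := by
    rw [mul_inv_cancel_left₀ (hε i).ne']
    simp only [Finset.sum_add_distrib, Finset.mul_sum]
    ring
  rw [hlhs]
  have hrhs : -(ε i * ((P + S / 2) * barrierDeriv₂ α ρ lam ε i x)) +
      ∑ k, A x i k * ((P + S / 2) * barrier α ρ lam ε k x) = (P + S / 2) *
      (-(ε i * barrierDeriv₂ α ρ lam ε i x) + ∑ k, A x i k * barrier α ρ lam ε k x) := by
    rw [mul_add, Finset.mul_sum]
    congr 1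
    · ring
    · exact Finset.sum_congr rfl fun k _ => by ring
  rw [hrhs]
  have e1 := abs_sum_mul_le (fun k => (hD.boundA x hx' i k).2.2)
    (fun k => hD.abs_solution_le hu hε hx' k)
  have e2 := abs_sum_mul_le (fun k => (hD.boundA x hx' i k).2.1) hU
  have e3 := (hD.boundf x hx' i).2.2
  have e4 : |f'' i x - ∑ k, A'' i k x * u x k - 2 * ∑ k, A' i k x * deriv (fun x => u x k) x| ≤
      |f'' i x| + |∑ k, A'' i k x * u x k| +
        2 * |∑ k, A' i k x * deriv (fun x => u x k) x| := by
    have := abs_sub (f'' i x - ∑ k, A'' i k x * u x k)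
      (2 * ∑ k, A' i k x * deriv (fun x => u x k) x)
    have h2 := abs_sub (f'' i x) (∑ k, A'' i k x * u x k)
    rw [abs_mul, abs_two] at this
    linarith
  have e5 : (P + S / 2) * (min α δ * w) ≤ (P + S / 2) *
      (-(ε i * barrierDeriv₂ α ρ lam ε i x) + ∑ k, A x i k * barrier α ρ lam ε k x) := by
    gcongr
  refine e4.trans (le_trans ?_ e5)
  -- By the smallness of l, the part of the right-hand side that contains S consumes only half of S.
  have e6 : 2 * n * M * C * ρ ^ n * l * (S * w) ≤ min α δ / 2 * (S * w) := by gcongr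
  have e7 : P * min α δ = K₁ * min α δ + (K₁ + 2 * n * M * C * (2 * K₀ / l)) := by
    rw [hP]; field_simp
  have e8 : 0 ≤ K₁ * min α δ * w := by positivity
  have e9 : K₁ ≤ K₁ * w := le_mul_of_one_le_right hK₁0 hw1
  have e10 : (P + S / 2) * (min α δ * w) = (P * min α δ) * w + min α δ / 2 * (S * w) := by ring
  rw [e10, e7]
  have e11 : 2 * (n * (M * (C * (2 * K₀ / l + l * (S * ρ ^ n)) * w))) =
    2 * n * M * C * (2 * K₀ / l) * w + 2 * n * M * C * ρ ^ n * l * (S * w) := by ring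
  nlinarith

/-- Bounds for the solution and its second derivative. -/
theorem SystemData.exists_second_deriv_bound
    (hD : SystemData α δ M A A' A'' f f' f'' g₀ g₁) :
    ∃ K, 0 < K ∧ ∀ ε : Fin n → ℝ, StrictMono ε → (∀ i, 0 < ε i) → ∀ u,
      IsExactSolution ε A f g₀ g₁ u → ∀ i, ∀ x ∈ Icc (0 : ℝ) 1, |u x i| ≤ K ∧
        |reaction A f u i x| ≤ K ∧
        |(ε i)⁻¹ * reaction A f u i x| ≤ K * layerWeight α ε x := by
  have hα := hD.alpha_pos
  have hδ := hD.delta_pos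
  have hM : 0 ≤ M := by linarith [hD.one_le]
  have hc : 0 < min α δ := lt_min hα hδ
  obtain ⟨lam, hlam⟩ : ∃ lam, lam = (M * n + δ) / α := ⟨_, rfl⟩
  have hlam0 : 0 ≤ lam := by rw [hlam]; positivity
  have hlam' : lam * α = M * n + δ := by rw [hlam]; field_simp
  obtain ⟨ρ, hρ⟩ : ∃ ρ, ρ = 1 + M * lam / δ + lam := ⟨_, rfl⟩
  have hρ1 : 1 ≤ ρ := by
    have : 0 ≤ M * lam / δ := by positivity
    linarith
  obtain ⟨C, hC⟩ : ∃ C, C = 1 + n * (32 / α) := ⟨_, rfl⟩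
  have hC0 : 0 ≤ C := by rw [hC]; positivity
  obtain ⟨D, hDdef⟩ : ∃ D, D = 2 * n * M * C * ρ ^ n := ⟨_, rfl⟩
  have hD0 : 0 ≤ D := by rw [hDdef]; positivity
  -- The second entry makes D·l at most min α δ / 2, which is what `bootstrap` asks of l. The first
  -- keeps the interpolation interval inside (0,1).
  obtain ⟨l, hl⟩ : ∃ l, l = min (1 / 4) (min α δ / (2 * (D + 1))) := ⟨_, rfl⟩
  have hl0 : 0 < l := by rw [hl]; positivity
  have hl1 : l ≤ 1 / 4 := by rw [hl]; exact min_le_left _ _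
  have hl2 : 2 * n * M * C * ρ ^ n * l ≤ min α δ / 2 := by
    rw [← hDdef]
    have h1 : l ≤ min α δ / (2 * (D + 1)) := by rw [hl]; exact min_le_right _ _
    have h2 : D * (min α δ / (2 * (D + 1))) ≤ min α δ / 2 := by
      rw [mul_div_assoc', div_le_div_iff₀ (by positivity) two_pos]
      nlinarith
    nlinarith
  obtain ⟨P, hP⟩ : ∃ P, P = (n * (M * (M * (1 + 1 / α))) + M) +
      (n * (M * (M * (1 + 1 / α))) + M +
      2 * n * M * C * (2 * (M * (1 + 1 / α)) / l)) / min α δ := ⟨_, rfl⟩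
  have hP0 : 0 ≤ P := by rw [hP]; positivity
  have hK₀ : 0 ≤ M * (1 + 1 / α) := by positivity
  have hK₁ : 0 ≤ n * (M * (M * (1 + 1 / α))) + M := by positivity
  refine ⟨1 + M * (1 + 1 / α) + (n * (M * (M * (1 + 1 / α))) + M) + 2 * P * ρ ^ n, by positivity,
    fun ε hmono hε u hu i x hx => ?_⟩
  have hPρ : 0 ≤ 2 * P * ρ ^ n := by positivity
  refine ⟨by linarith [hD.abs_solution_le hu hε hx i],
    by linarith [hD.abs_reaction_le hu hε hx i], ?_⟩
  set K₁ := n * (M * (M * (1 + 1 / α))) + M with hK₁def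
  -- A crude starting constant, depending on ε. It is halved in each step and disappears in the
  -- limit.
  set S₀ := ∑ i, (ε i)⁻¹ * K₁ with hS₀
  have hS₀0 : 0 ≤ S₀ := Finset.sum_nonneg fun i _ => mul_nonneg (inv_pos.2 (hε i)).le hK₁
  have hb1 : ∀ i, ∀ x ∈ Icc (0 : ℝ) 1, 1 ≤ barrier α ρ lam ε i x := by
    intro i x hx
    have h := barrier_ge (α := α) (ρ := ρ) hα (by
      have : 0 ≤ M * lam / δ := by positivity
      linarith) hlam0 hε hmono i hx
    have := div_pos (layer_pos α (ε i) x) (hε i)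
    linarith
  have hiter : ∀ r : ℕ, ∀ i, ∀ x ∈ Icc (0 : ℝ) 1, |(ε i)⁻¹ * reaction A f u i x| ≤
      (2 * P + S₀ * (1 / 2) ^ r) * barrier α ρ lam ε i x := by
    intro r
    induction r with
    | zero =>
      intro i x hx
      have h1 : |(ε i)⁻¹ * reaction A f u i x| ≤ (ε i)⁻¹ * K₁ := by
        rw [abs_mul, abs_of_pos (inv_pos.2 (hε i))]
        have := (inv_pos.2 (hε i)).le
        have h3 := hD.abs_reaction_le hu hε hx i
        gcongr
      have h2 : (ε i)⁻¹ * K₁ ≤ S₀ := Finset.single_le_sum (f := fun i => (ε i)⁻¹ * K₁)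
        (fun i _ => mul_nonneg (inv_pos.2 (hε i)).le hK₁) (Finset.mem_univ i)
      have h4 := hb1 i x hx
      simp only [pow_zero, mul_one]
      nlinarith
    | succ r ih =>
      have h := hD.bootstrap hu hε hmono hlam' hlam0 hρ hC hl0 hl1 hl2 (by positivity) hP ih
      have e : P + (2 * P + S₀ * (1 / 2) ^ r) / 2 = 2 * P + S₀ * (1 / 2) ^ (r + 1) := by ring
      rwa [e] at h
  have hlim : |(ε i)⁻¹ * reaction A f u i x| ≤ 2 * P * barrier α ρ lam ε i x := by
    have ht : Filter.Tendsto (fun r : ℕ => (2 * P + S₀ * (1 / 2) ^ r) * barrier α ρ lam ε i x)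
        Filter.atTop (nhds ((2 * P + S₀ * 0) * barrier α ρ lam ε i x)) :=
      (((tendsto_pow_atTop_nhds_zero_of_lt_one (by norm_num) (by norm_num)).const_mul
        _).const_add _).mul_const _
    have := ge_of_tendsto' ht fun r => hiter r i x hx
    simpa using this
  refine hlim.trans ?_
  have h1 := mul_le_mul_of_nonneg_left (barrier_le (α := α) hρ1 hlam0 hε i x)
    (show 0 ≤ 2 * P by linarith)
  have h2 := one_le_layerWeight (α := α) hε x
  refine h1.trans ?_
  rw [← mul_assoc]
  gcongr
  linarith

end

/-! ### First derivatives of the reaction terms. -/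

theorem abs_sub_le_sub_of_hasDerivAt {φ φ' G G' : ℝ → ℝ} {a b : ℝ}
    (hφc : ContinuousOn φ (Icc a b)) (hGc : ContinuousOn G (Icc a b))
    (hφ : ∀ x ∈ Ioo a b, HasDerivAt φ (φ' x) x) (hG : ∀ x ∈ Ioo a b, HasDerivAt G (G' x) x)
    (h : ∀ x ∈ Ioo a b, |φ' x| ≤ G' x) (hab : a ≤ b) : |φ b - φ a| ≤ G b - G a := by
  have h1 : MonotoneOn (fun x => G x - φ x) (Icc a b) := by
    refine monotoneOn_of_hasDerivWithinAt_nonneg (convex_Icc a b) (hGc.sub hφc)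
      (f' := fun x => G' x - φ' x) (fun x hx => ?_) (fun x hx => ?_)
    · rw [interior_Icc] at hx ⊢
      exact ((hG x hx).sub (hφ x hx)).hasDerivWithinAt
    · rw [interior_Icc] at hx
      linarith [(abs_le.1 (h x hx)).2]
  have h2 : MonotoneOn (fun x => G x + φ x) (Icc a b) := by
    refine monotoneOn_of_hasDerivWithinAt_nonneg (convex_Icc a b) (hGc.add hφc)
      (f' := fun x => G' x + φ' x) (fun x hx => ?_) (fun x hx => ?_)
    · rw [interior_Icc] at hx ⊢
      exact ((hG x hx).add (hφ x hx)).hasDerivWithinAt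
    · rw [interior_Icc] at hx
      linarith [(abs_le.1 (h x hx)).1]
  have e1 := h1 (left_mem_Icc.2 hab) (right_mem_Icc.2 hab) hab
  have e2 := h2 (left_mem_Icc.2 hab) (right_mem_Icc.2 hab) hab
  simp only at e1 e2
  rw [abs_le]; constructor <;> linarith

theorem mul_layerRate {α e : ℝ} (hα : 0 < α) (he : 0 < e) : e * layerRate α e = √α * √e := by
  unfold layerRate
  rw [Real.sqrt_div hα.le]
  have h := Real.mul_self_sqrt he.le
  have h2 := (Real.sqrt_pos.2 he).ne'
  field_simp
  nlinarith

/-- A function whose second derivative is bounded by the weight `1 + ∑ B_m / ε_m` has a first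
derivative bounded by `1 + ∑ B_m / √ε_m`. -/
theorem abs_deriv_le_of_layerWeight {n : ℕ} {α : ℝ} {ε : Fin n → ℝ} (hα : 0 < α)
    (hε : ∀ i, 0 < ε i) (hε1 : ∀ i, ε i ≤ 1) {f f' f'' : ℝ → ℝ} (hf : TwiceDeriv f f' f'') {K : ℝ}
    (hK0 : 0 ≤ K) (hK : ∀ y ∈ Ioo (0 : ℝ) 1, |f y| ≤ K)
    (hD : ∀ y ∈ Ioo (0 : ℝ) 1, |f'' y| ≤ K * layerWeight α ε y) {x : ℝ}
    (hx : x ∈ Ioo (0 : ℝ) 1) :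
    |f' x| ≤ K * (6 + n * (64 / α) / √α + 1 / √α) *
      (1 + ∑ m, layer α (ε m) x / √(ε m)) := by
  -- A point ξ in the middle, where f' is at most 4K and the layers are harmless, serves as the base
  -- point from which f'' is integrated.
  obtain ⟨ξ, hξ, hξ'⟩ := exists_hasDerivAt_eq_slope f f' (a := 1 / 4) (b := 3 / 4) (by norm_num)
    (fun y hy => (hf y ⟨by linarith [hy.1], by linarith [hy.2]⟩).1.continuousAt.continuousWithinAt)
    (fun y hy => (hf y ⟨by linarith [hy.1], by linarith [hy.2]⟩).1)
  have hsa : 0 < √α := Real.sqrt_pos.2 hα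
  have h1 : |f' ξ| ≤ 4 * K := by
    rw [hξ', abs_div, div_le_iff₀ (by norm_num)]
    have := abs_sub (f (3 / 4)) (f (1 / 4))
    have h2 := hK (3 / 4) (by norm_num)
    have h3 := hK (1 / 4) (by norm_num)
    have h4 : |(3 / 4 - 1 / 4 : ℝ)| = 1 / 2 := by norm_num
    rw [h4]; linarith
  -- G is a primitive of the weight. By `mul_layerRate` its coefficients are 1/(√α √ε_m), so
  -- integration turns 1/ε_m into 1/√ε_m.
  set G : ℝ → ℝ := fun y => y + ∑ m, (ε m * layerRate α (ε m))⁻¹ * oddLayer α (ε m) y with hGdef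
  have hG : ∀ y, HasDerivAt G (layerWeight α ε y) y := by
    intro y
    refine ((hasDerivAt_id y).add (HasDerivAt.fun_sum fun m _ =>
      (hasDerivAt_oddLayer α (ε m) y).const_mul (ε m * layerRate α (ε m))⁻¹)).congr_deriv ?_
    unfold layerWeight
    congr 1
    refine Finset.sum_congr rfl fun m _ => ?_
    have := (layerRate_pos hα (hε m)).ne'
    have := (hε m).ne'
    field_simp
  have hGle : ∀ y ∈ Ioo (0 : ℝ) 1, |G y| ≤ 1 + 1 / √α * ∑ m, layer α (ε m) y / √(ε m) := by
    intro y hy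
    refine (abs_add_le _ _).trans (add_le_add (abs_le.2 ⟨by linarith [hy.1], hy.2.le⟩) ?_)
    refine (Finset.abs_sum_le_sum_abs _ _).trans ?_
    rw [Finset.mul_sum]
    refine Finset.sum_le_sum fun m _ => ?_
    rw [mul_layerRate hα (hε m), abs_mul]
    have hsm := Real.sqrt_pos.2 (hε m)
    rw [abs_of_pos (by positivity)]
    have := abs_oddLayer_le α (ε m) y
    calc (√α * √(ε m))⁻¹ * |oddLayer α (ε m) y| ≤ (√α * √(ε m))⁻¹ * layer α (ε m) y := by gcongr
      _ = _ := by field_simp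
  have hξI : ξ ∈ Ioo (0 : ℝ) 1 := ⟨by linarith [hξ.1], by linarith [hξ.2]⟩
  have hdiff : ∀ a b, a ∈ Ioo (0 : ℝ) 1 → b ∈ Ioo (0 : ℝ) 1 → a ≤ b →
      |f' b - f' a| ≤ K * G b - K * G a := by
    intro a b ha hb hab
    have hsub : ∀ y ∈ Icc a b, y ∈ Ioo (0 : ℝ) 1 := fun y hy =>
      ⟨ha.1.trans_le hy.1, hy.2.trans_lt hb.2⟩
    exact abs_sub_le_sub_of_hasDerivAt (G := fun y => K * G y)
      (fun y hy => (hf y (hsub y hy)).2.continuousAt.continuousWithinAt)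
      (fun y hy => ((hG y).const_mul K).continuousAt.continuousWithinAt)
      (fun y hy => (hf y (hsub y (Ioo_subset_Icc_self hy))).2) (fun y hy => (hG y).const_mul K)
      (fun y hy => hD y (hsub y (Ioo_subset_Icc_self hy))) hab
  have h2 : |f' x - f' ξ| ≤ K * (|G x| + |G ξ|) := by
    have hb : K * |G x| + K * |G ξ| = K * (|G x| + |G ξ|) := by ring
    have p1 := mul_le_mul_of_nonneg_left (le_abs_self (G x)) hK0
    have p2 := mul_le_mul_of_nonneg_left (neg_abs_le (G x)) hK0
    have p3 := mul_le_mul_of_nonneg_left (le_abs_self (G ξ)) hK0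
    have p4 := mul_le_mul_of_nonneg_left (neg_abs_le (G ξ)) hK0
    rcases le_total x ξ with h | h
    · have := hdiff x ξ hx hξI h
      rw [abs_sub_comm]; linarith
    · have := hdiff ξ x hξI hx h
      linarith
  have h3 : ∑ m, layer α (ε m) ξ / √(ε m) ≤ n * (64 / α) := by
    have : ∑ m, layer α (ε m) ξ / √(ε m) ≤ ∑ _m : Fin n, 64 / α := by
      refine Finset.sum_le_sum fun m _ => ?_
      have p1 := exp_quarter_div_le hα (hε m) (t := ξ) hξ.1.le
      have p2 := exp_quarter_div_le hα (hε m) (t := 1 - ξ) (by linarith [hξ.2])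
      have p3 : layer α (ε m) ξ / √(ε m) ≤ layer α (ε m) ξ / ε m := by
        have := layer_pos α (ε m) ξ
        have := hε m
        gcongr
        exact Real.le_sqrt_of_sq_le (by nlinarith [hε1 m])
      have p4 : layer α (ε m) ξ / ε m = Real.exp (-(layerRate α (ε m) * ξ)) / ε m +
        Real.exp (-(layerRate α (ε m) * (1 - ξ))) / ε m := by rw [layer, add_div]
      have p5 : 64 / α = 32 / α + 32 / α := by ring
      linarith
    simpa using this
  set T := ∑ m, layer α (ε m) x / √(ε m) with hT
  have hT0 : 0 ≤ T := Finset.sum_nonneg fun m _ =>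
    div_nonneg (layer_pos _ _ _).le (Real.sqrt_nonneg _)
  have h4 : |G x| ≤ 1 + 1 / √α * T := hGle x hx
  have h5 := hGle ξ hξI
  have h6 : |f' x| ≤ |f' x - f' ξ| + |f' ξ| := by
    have := abs_add_le (f' x - f' ξ) (f' ξ); simpa using this
  have h7 : 1 / √α * ∑ m, layer α (ε m) ξ / √(ε m) ≤ n * (64 / α) / √α := by
    rw [one_div_mul_eq_div]
    gcongr
  have h8 : |f' x| ≤ K * (6 + n * (64 / α) / √α + 1 / √α * T) := by
    have : K * (|G x| + |G ξ|) ≤ K * (2 + n * (64 / α) / √α + 1 / √α * T) :=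
      mul_le_mul_of_nonneg_left (by linarith) hK0
    nlinarith
  refine h8.trans ?_
  rw [mul_assoc]
  gcongr
  have q1 : 0 ≤ (n : ℝ) * (64 / α) / √α := by positivity
  have q2 : 0 ≤ 1 / √α := by positivity
  nlinarith [mul_nonneg q1 hT0]

section

variable {n : ℕ} {α δ M : ℝ} {A : ℝ → Matrix (Fin n) (Fin n) ℝ}
  {A' A'' : Fin n → Fin n → ℝ → ℝ} {f : ℝ → Fin n → ℝ} {f' f'' : Fin n → ℝ → ℝ}
  {g₀ g₁ : Fin n → ℝ}

/-- The parameter-uniform bounds for `q = ε u''` and its first two derivatives. -/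
structure ReactionBound {n : ℕ} (α K e : ℝ) (ε : Fin n → ℝ) (q q' q'' : ℝ → ℝ) : Prop where
  cont : ContinuousOn q (Icc 0 1)
  twiceDeriv : TwiceDeriv q q' q''
  bound : ∀ x ∈ Icc (0 : ℝ) 1, |q x| ≤ K
  second : ∀ x ∈ Ioo (0 : ℝ) 1, |q'' x| ≤ K * layerWeight α ε x
  first : ∀ x ∈ Ioo (0 : ℝ) 1, |q' x| ≤ K * (1 + ∑ m, layer α (ε m) x / √(ε m))
  first_sqrt : ∀ x ∈ Ioo (0 : ℝ) 1, |q' x| ≤ K * √e * layerWeight α ε x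

/-- The formula for q'' involves u, u' and u'', all bounded by the weight. Two bounds for q' are
needed later: integrating q'' gives 1/√ε_m in place of 1/ε_m, and interpolating between q and q''
gives the factor √ε_i. The former serves components resolved by the mesh, the latter the others. -/
theorem SystemData.exists_reactionBound (hD : SystemData α δ M A A' A'' f f' f'' g₀ g₁) :
    ∃ K, 0 < K ∧ ∀ ε : Fin n → ℝ, StrictMono ε → (∀ i, 0 < ε i) → (∀ i, ε i ≤ 1) → ∀ u,
      IsExactSolution ε A f g₀ g₁ u → ∀ i, ∃ q' q'',
        ReactionBound α K (ε i) ε (reaction A f u i) q' q'' := by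
  have hα := hD.alpha_pos
  have hM : 0 ≤ M := by linarith [hD.one_le]
  obtain ⟨K₀, hK₀, hbd⟩ := hD.exists_second_deriv_bound
  obtain ⟨C, hC⟩ : ∃ C, C = 1 + n * (32 / α) := ⟨_, rfl⟩
  have hC0 : 0 ≤ C := by rw [hC]; positivity
  obtain ⟨K₂, hK₂⟩ : ∃ K₂, K₂ = n * (M * K₀) + 2 * (n * (M * (C * (2 * K₀ / (1 / 4) +
    1 / 4 * K₀)))) + n * (M * K₀) + M + K₀ := ⟨_, rfl⟩
  have hK₂0 : 0 ≤ K₂ := by rw [hK₂]; positivity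
  have hK₀₂ : K₀ ≤ K₂ := by
    rw [hK₂]
    have : 0 ≤ n * (M * K₀) + 2 * (n * (M * (C * (2 * K₀ / (1 / 4) +
    1 / 4 * K₀)))) + n * (M * K₀) + M := by positivity
    linarith
  obtain ⟨c₁, hc₁⟩ : ∃ c₁, c₁ = 6 + n * (64 / α) / √α + 1 / √α := ⟨_, rfl⟩
  have hc₁0 : 0 ≤ c₁ := by rw [hc₁]; positivity
  obtain ⟨K, hK⟩ : ∃ K, K = K₂ + K₂ * c₁ + C * (8 * K₀ + K₂ / 4) := ⟨_, rfl⟩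
  have t1 : 0 ≤ K₂ * c₁ := by positivity
  have t2 : 0 ≤ C * (8 * K₀ + K₂ / 4) := by positivity
  refine ⟨K, by linarith, fun ε hmono hε hε1 u hu i => ?_⟩
  obtain ⟨q', hq'⟩ := hD.twiceDeriv_reaction hu hε i
  have hw1 := one_le_layerWeight (α := α) hε
  have hsecond : ∀ x ∈ Ioo (0 : ℝ) 1, |∑ k, (A'' i k x * u x k +
      2 * (A' i k x * deriv (fun x => u x k) x) +
      A x i k * ((ε k)⁻¹ * reaction A f u k x)) - f'' i x| ≤ K₂ * layerWeight α ε x := by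
    intro x hx
    have hx' := Ioo_subset_Icc_self hx
    set w := layerWeight α ε x with hw
    have hU : ∀ k, |deriv (fun x => u x k) x| ≤ C * (2 * K₀ / (1 / 4) + 1 / 4 * K₀) * w := by
      intro k
      rw [hC]
      refine abs_deriv_le_layerWeight hα hε (hu.twiceDeriv hε k) hK₀.le hK₀.le
        (fun y hy => ?_) (fun y hy => ?_) (by norm_num) le_rfl hx
      · exact (hbd ε hmono hε u hu k y (Ioo_subset_Icc_self hy)).1.trans
          (le_mul_of_one_le_right hK₀.le (hw1 y))
      · exact (hbd ε hmono hε u hu k y (Ioo_subset_Icc_self hy)).2.2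
    have e1 := abs_sum_mul_le (fun k => (hD.boundA x hx' i k).2.2)
      (fun k => (hbd ε hmono hε u hu k x hx').1)
    have e2 := abs_sum_mul_le (fun k => (hD.boundA x hx' i k).2.1) hU
    have e3 := abs_sum_mul_le (fun k => (hD.boundA x hx' i k).1)
      (fun k => (hbd ε hmono hε u hu k x hx').2.2)
    have e4 := (hD.boundf x hx' i).2.2
    simp only [Finset.sum_add_distrib, ← Finset.mul_sum]
    have e5 := abs_sub (∑ k, A'' i k x * u x k + 2 * ∑ k, A' i k x * deriv (fun x => u x k) x +
      ∑ k, A x i k * ((ε k)⁻¹ * reaction A f u k x)) (f'' i x)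
    have e6 := abs_add_three (∑ k, A'' i k x * u x k)
      (2 * ∑ k, A' i k x * deriv (fun x => u x k) x)
      (∑ k, A x i k * ((ε k)⁻¹ * reaction A f u k x))
    rw [abs_mul, abs_two] at e6
    have r1 : n * (M * K₀) ≤ n * (M * K₀) * w := le_mul_of_one_le_right (by positivity) (hw1 x)
    have r2 : M ≤ M * w := le_mul_of_one_le_right hM (hw1 x)
    have r3 : 0 ≤ K₀ * w := by have := hw1 x; positivity
    have r4 : K₂ * w = n * (M * K₀) * w + 2 * (n * (M * (C * (2 * K₀ / (1 / 4) +
      1 / 4 * K₀) * w))) + n * (M * (K₀ * w)) + M * w + K₀ * w := by rw [hK₂]; ring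
    linarith
  refine ⟨q', _, hD.continuousOn_reaction hu i, hq', fun x hx => ?_, fun x hx => ?_,
    fun x hx => ?_, fun x hx => ?_⟩
  · linarith [(hbd ε hmono hε u hu i x hx).2.1]
  · refine (hsecond x hx).trans ?_
    have := hw1 x
    gcongr
    linarith
  · have h1 := abs_deriv_le_of_layerWeight hα hε hε1 hq' hK₂0
      (fun y hy => ((hbd ε hmono hε u hu i y (Ioo_subset_Icc_self hy)).2.1).trans hK₀₂)
      hsecond hx
    rw [← hc₁] at h1
    refine h1.trans ?_
    have : 0 ≤ ∑ m, layer α (ε m) x / √(ε m) := Finset.sum_nonneg fun m _ =>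
      div_nonneg (layer_pos _ _ _).le (Real.sqrt_nonneg _)
    gcongr
    linarith
  · have hεi := hε i
    have hs : 0 < √(ε i) := Real.sqrt_pos.2 hεi
    have hs1 : √(ε i) ≤ 1 := Real.sqrt_le_one.2 (hε1 i)
    -- Since |q_i| = ε_i|u_i''| is at most K₀ε_i times the weight, a step proportional to √ε_i
    -- balances ε_i/l against l.
    have h1 := abs_deriv_le_layerWeight hα hε hq' (K := K₀ * ε i) (by positivity) hK₂0
      (fun y hy => ?_) hsecond (l := √(ε i) / 4) (by positivity) (by linarith) hx
    · rw [← hC] at h1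
      refine h1.trans ?_
      have h2 : 2 * (K₀ * ε i) / (√(ε i) / 4) = 8 * K₀ * √(ε i) := by
        rw [div_eq_iff (by positivity)]
        have := Real.mul_self_sqrt hεi.le
        nlinarith
      have h3 : C * (2 * (K₀ * ε i) / (√(ε i) / 4) + √(ε i) / 4 * K₂) ≤ K * √(ε i) := by
        rw [h2, show C * (8 * K₀ * √(ε i) + √(ε i) / 4 * K₂) =
          C * (8 * K₀ + K₂ / 4) * √(ε i) by ring]
        gcongr
        linarith
      exact mul_le_mul_of_nonneg_right h3 (by linarith [hw1 x])
    · have h2 := (hbd ε hmono hε u hu i y (Ioo_subset_Icc_self hy)).2.2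
      rw [abs_mul, abs_of_pos (inv_pos.2 hεi)] at h2
      calc |reaction A f u i y| = ε i * ((ε i)⁻¹ * |reaction A f u i y|) := by
            rw [mul_inv_cancel_left₀ hεi.ne']
        _ ≤ ε i * (K₀ * layerWeight α ε y) := by gcongr
        _ = _ := by ring

end

/-! ### Second difference quotients and consistency by comparison. -/

/-- The second difference quotient of `V` on the points `a < c < b`. -/
noncomputable def diffQuot₂ (V : ℝ → ℝ) (a c b : ℝ) : ℝ :=
  ((V b - V c) / (b - c) - (V c - V a) / (c - a)) / (((c - a) + (b - c)) / 2)

theorem diffQuot₂_add (V W : ℝ → ℝ) (a c b : ℝ) :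
    diffQuot₂ (fun y => V y + W y) a c b = diffQuot₂ V a c b + diffQuot₂ W a c b := by
  unfold diffQuot₂; ring

theorem diffQuot₂_sub (V W : ℝ → ℝ) (a c b : ℝ) :
    diffQuot₂ (fun y => V y - W y) a c b = diffQuot₂ V a c b - diffQuot₂ W a c b := by
  unfold diffQuot₂; ring

theorem diffQuot₂_sq (K : ℝ) {a c b : ℝ} (hac : a < c) (hcb : c < b) :
    diffQuot₂ (fun y => K * (y ^ 2 / 2)) a c b = K := by
  unfold diffQuot₂
  have h1 : c - a ≠ 0 := (sub_pos.2 hac).ne'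
  have h2 : b - c ≠ 0 := (sub_pos.2 hcb).ne'
  have h3 : c - a + (b - c) ≠ 0 := by
    have : 0 < c - a + (b - c) := by linarith
    exact this.ne'
  have e1 : (K * (b ^ 2 / 2) - K * (c ^ 2 / 2)) / (b - c) = K * (b + c) / 2 := by
    rw [div_eq_iff h2]; ring
  have e2 : (K * (c ^ 2 / 2) - K * (a ^ 2 / 2)) / (c - a) = K * (c + a) / 2 := by
    rw [div_eq_iff h1]; ring
  rw [e1, e2, div_eq_iff (by positivity)]
  ring

theorem diffQuot₂_of_equidistant (V : ℝ → ℝ) {c t : ℝ} :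
    diffQuot₂ V (c - t) c (c + t) = (V (c + t) + V (c - t) - 2 * V c) / t ^ 2 := by
  unfold diffQuot₂
  rw [show c - (c - t) = t by ring, show c + t - c = t by ring, show (t + t) / 2 = t by ring,
    ← sub_div, div_div, ← sq]
  congr 1; ring

theorem diffQuot₂_nonneg_of_convexOn {V : ℝ → ℝ} {a c b : ℝ} (hac : a < c) (hcb : c < b)
    (hV : ConvexOn ℝ (Icc a b) V) : 0 ≤ diffQuot₂ V a c b := by
  have h := hV.slope_mono_adjacent (left_mem_Icc.2 (hac.trans hcb).le)
    (right_mem_Icc.2 (hac.trans hcb).le) hac hcb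
  unfold diffQuot₂
  have h1 := sub_pos.2 hac
  have h2 := sub_pos.2 hcb
  exact div_nonneg (sub_nonneg.2 h) (by linarith)

theorem diffQuot₂_nonneg {f f' f'' : ℝ → ℝ} {a c b : ℝ} (hac : a < c) (hcb : c < b)
    (hc : ContinuousOn f (Icc a b))
    (hf : ∀ x ∈ Ioo a b, HasDerivAt f (f' x) x ∧ HasDerivAt f' (f'' x) x)
    (h : ∀ x ∈ Ioo a b, 0 ≤ f'' x) : 0 ≤ diffQuot₂ f a c b := by
  refine diffQuot₂_nonneg_of_convexOn hac hcb
    (convexOn_of_hasDerivWithinAt2_nonneg (convex_Icc a b) hc (f' := f') (f'' := f'') ?_ ?_ ?_)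
  all_goals rw [interior_Icc]
  · exact fun x hx => (hf x hx).1.hasDerivWithinAt
  · exact fun x hx => (hf x hx).2.hasDerivWithinAt
  · exact h

/-- Second difference quotients inherit bounds between second derivatives. -/
theorem abs_diffQuot₂_le {f f' f'' F F' F'' : ℝ → ℝ} {a c b : ℝ} (hac : a < c) (hcb : c < b)
    (hfc : ContinuousOn f (Icc a b)) (hFc : ContinuousOn F (Icc a b))
    (hf : ∀ x ∈ Ioo a b, HasDerivAt f (f' x) x ∧ HasDerivAt f' (f'' x) x)
    (hF : ∀ x ∈ Ioo a b, HasDerivAt F (F' x) x ∧ HasDerivAt F' (F'' x) x)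
    (h : ∀ x ∈ Ioo a b, |f'' x| ≤ F'' x) : |diffQuot₂ f a c b| ≤ diffQuot₂ F a c b := by
  have h1 := diffQuot₂_nonneg hac hcb (hFc.add hfc) (f' := fun x => F' x + f' x)
    (f'' := fun x => F'' x + f'' x)
    (fun x hx => ⟨(hF x hx).1.add (hf x hx).1, (hF x hx).2.add (hf x hx).2⟩)
    (fun x hx => by linarith [(abs_le.1 (h x hx)).1])
  have h2 := diffQuot₂_nonneg hac hcb (hFc.sub hfc) (f' := fun x => F' x - f' x)
    (f'' := fun x => F'' x - f'' x)
    (fun x hx => ⟨(hF x hx).1.sub (hf x hx).1, (hF x hx).2.sub (hf x hx).2⟩)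
    (fun x hx => by linarith [(abs_le.1 (h x hx)).2])
  have e1 : diffQuot₂ (F + f) a c b = diffQuot₂ F a c b + diffQuot₂ f a c b :=
    diffQuot₂_add F f a c b
  have e2 : diffQuot₂ (F - f) a c b = diffQuot₂ F a c b - diffQuot₂ f a c b :=
    diffQuot₂_sub F f a c b
  rw [e1] at h1
  rw [e2] at h2
  rw [abs_le]; constructor <;> linarith

theorem hasDerivAt_sq_half (K x : ℝ) :
    HasDerivAt (fun y => K * (y ^ 2 / 2)) (K * x) x ∧ HasDerivAt (fun y => K * y) K x := by
  constructor
  · refine ((((hasDerivAt_id x).pow 2).div_const 2).const_mul K).congr_deriv ?_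
    simp
  · exact ((hasDerivAt_id x).const_mul K).congr_deriv (by ring)

theorem continuous_sq_half (K : ℝ) : Continuous fun y : ℝ => K * (y ^ 2 / 2) := by fun_prop

/-- V - k y²/2 is compared with K y²/2, using that the quotient is exact on quadratics. No
derivative of V beyond the second enters, only the oscillation of q. -/
theorem abs_diffQuot₂_sub_le {V V' q : ℝ → ℝ} {a c b k K : ℝ} (hac : a < c) (hcb : c < b)
    (hVc : ContinuousOn V (Icc a b))
    (hV : ∀ x ∈ Ioo a b, HasDerivAt V (V' x) x ∧ HasDerivAt V' (q x) x)
    (h : ∀ x ∈ Ioo a b, |q x - k| ≤ K) : |diffQuot₂ V a c b - k| ≤ K := by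
  have h1 := abs_diffQuot₂_le hac hcb (hVc.sub (continuous_sq_half k).continuousOn)
    (continuous_sq_half K).continuousOn (f' := fun x => V' x - k * x) (f'' := fun x => q x - k)
    (fun x hx => ⟨(hV x hx).1.sub (hasDerivAt_sq_half k x).1,
      (hV x hx).2.sub (hasDerivAt_sq_half k x).2⟩)
    (fun x _ => hasDerivAt_sq_half K x) h
  rw [diffQuot₂_sq K hac hcb] at h1
  have e : diffQuot₂ (V - fun y => k * (y ^ 2 / 2)) a c b =
      diffQuot₂ V a c b - diffQuot₂ (fun y => k * (y ^ 2 / 2)) a c b := diffQuot₂_sub _ _ _ _ _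
  rwa [e, diffQuot₂_sq k hac hcb] at h1

/-- On equidistant points the consistency error is controlled by symmetric second differences. -/
theorem abs_diffQuot₂_sub_le_of_equidistant {V V' q : ℝ → ℝ} {c h K : ℝ} (hh : 0 < h)
    (hVc : ContinuousOn V (Icc (c - h) (c + h)))
    (hV : ∀ x ∈ Ioo (c - h) (c + h), HasDerivAt V (V' x) x ∧ HasDerivAt V' (q x) x)
    (hq : ∀ t ∈ Ioo (-h) h, |q (c + t) + q (c - t) - 2 * q c| ≤ 2 * K) :
    |diffQuot₂ V (c - h) c (c + h) - q c| ≤ K := by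
  -- Symmetrisation: t ↦ V(c+t) + V(c-t) has second derivative q(c+t) + q(c-t), and its centred
  -- quotient at 0 is twice that of V at c.
  have h1 := abs_diffQuot₂_sub_le (V := fun t => V (c + t) + V (c - t))
    (V' := fun t => V' (c + t) - V' (c - t)) (q := fun t => q (c + t) + q (c - t))
    (a := 0 - h) (c := 0) (b := 0 + h) (k := 2 * q c) (K := 2 * K) (by linarith) (by linarith)
    ?_ (fun t ht => ?_) (fun t ht => hq t (by simpa using ht))
  · rw [diffQuot₂_of_equidistant] at h1 ⊢
    simp only [zero_add, zero_sub, add_zero, sub_zero, sub_neg_eq_add] at h1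
    have e : (V (c + h) + V (c - h) + (V (c + -h) + V (c + h)) - 2 * (V c + V c)) / h ^ 2 -
        2 * q c = 2 * ((V (c + h) + V (c - h) - 2 * V c) / h ^ 2 - q c) := by
      rw [← sub_eq_add_neg]; ring
    rw [e, abs_mul, abs_two] at h1
    linarith
  · refine ContinuousOn.add ?_ ?_
    · exact hVc.comp (by fun_prop) fun t ht => ⟨by linarith [ht.1], by linarith [ht.2]⟩
    · exact hVc.comp (by fun_prop) fun t ht => ⟨by linarith [ht.2], by linarith [ht.1]⟩
  · have m1 : c + t ∈ Ioo (c - h) (c + h) := ⟨by linarith [ht.1], by linarith [ht.2]⟩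
    have m2 : c - t ∈ Ioo (c - h) (c + h) := ⟨by linarith [ht.2], by linarith [ht.1]⟩
    have d1 : HasDerivAt (fun t : ℝ => c + t) 1 t := (hasDerivAt_id t).const_add c
    have d2 : HasDerivAt (fun t : ℝ => c - t) (-1) t := (hasDerivAt_id t).const_sub c
    constructor
    · exact (((hV _ m1).1.comp t d1).add ((hV _ m2).1.comp t d2)).congr_deriv (by ring)
    · exact (((hV _ m1).2.comp t d1).sub ((hV _ m2).2.comp t d2)).congr_deriv (by ring)

/-! ### Consistency bounds in terms of the layers. -/

/-- An upper bound for `layer α e` on the interval `[a, b]`. -/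
noncomputable def layerSup (α e a b : ℝ) : ℝ :=
  Real.exp (-(layerRate α e * a)) + Real.exp (-(layerRate α e * (1 - b)))

theorem layerSup_pos (α e a b : ℝ) : 0 < layerSup α e a b := by unfold layerSup; positivity

theorem layer_le_layerSup {α e a b x : ℝ} (hx : x ∈ Icc a b) :
    layer α e x ≤ layerSup α e a b := by
  have h0 := layerRate_nonneg α e
  have h1 := hx.1
  have h2 := hx.2
  unfold layer layerSup
  gcongr

theorem layerSup_le_two {α e a b : ℝ} (ha : 0 ≤ a) (hb : b ≤ 1) : layerSup α e a b ≤ 2 := by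
  have h0 := layerRate_nonneg α e
  have h1 : Real.exp (-(layerRate α e * a)) ≤ 1 := Real.exp_le_one_iff.2 (by
    have := mul_nonneg h0 ha; linarith)
  have h2 : Real.exp (-(layerRate α e * (1 - b))) ≤ 1 := Real.exp_le_one_iff.2 (by
    have := mul_nonneg h0 (sub_nonneg.2 hb); linarith)
  unfold layerSup; linarith

/-- Two independent estimates: the layer values themselves are at most `layerSup`, and the second
derivative is at most 2α/e on the stencil. The first is used for negligible layers, the second for
resolved ones. -/
theorem layer_second_diff_le {α e c h t : ℝ} (hα : 0 < α) (he : 0 < e) (hc0 : 0 ≤ c - h)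
    (hc1 : c + h ≤ 1) (ht : 0 < t) (hth : t ≤ h) :
    layer α e (c + t) + layer α e (c - t) - 2 * layer α e c ≤
      (2 + 2 * α) * min (layerSup α e (c - h) (c + h)) (h ^ 2 / e) := by
  set β := layerSup α e (c - h) (c + h)
  have hβ := layerSup_pos α e (c - h) (c + h)
  have hsub : ∀ y ∈ Ioo (c - t) (c + t), y ∈ Icc (c - h) (c + h) := fun y hy =>
    ⟨by linarith [hy.1], by linarith [hy.2]⟩
  rw [mul_min_of_nonneg _ _ (by positivity)]
  refine le_min ?_ ?_
  · have h1 : layer α e (c + t) ≤ β := layer_le_layerSup ⟨by linarith, by linarith⟩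
    have h2 : layer α e (c - t) ≤ β := layer_le_layerSup ⟨by linarith, by linarith⟩
    have h3 := layer_pos α e c
    have h4 : 0 ≤ α * β := by positivity
    linarith
  · have h1 := abs_diffQuot₂_le (a := c - t) (c := c) (b := c + t) (by linarith) (by linarith)
      (continuous_layer α e).continuousOn (continuous_sq_half (α / e * β)).continuousOn
      (fun x hx => twiceDeriv_layer hα he x ⟨by linarith [hx.1], by linarith [hx.2]⟩)
      (fun x _ => hasDerivAt_sq_half (α / e * β) x) (fun x hx => by
        have := layer_le_layerSup (α := α) (e := e) (hsub x hx)
        have := layer_pos α e x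
        rw [abs_of_pos (by positivity)]
        gcongr)
    rw [diffQuot₂_sq _ (by linarith) (by linarith), diffQuot₂_of_equidistant] at h1
    have h2 := (le_abs_self _).trans h1
    rw [div_le_iff₀ (by positivity)] at h2
    have h3 : β ≤ 2 := layerSup_le_two hc0 hc1
    have h4 : α / e * β * t ^ 2 ≤ α / e * 2 * h ^ 2 := by gcongr
    have h5 : α / e * 2 * h ^ 2 = 2 * α * (h ^ 2 / e) := by ring
    have h6 : 0 ≤ h ^ 2 / e := by positivity
    nlinarith

section

variable {n : ℕ} {α K e : ℝ} {ε : Fin n → ℝ} {V V' q q' q'' : ℝ → ℝ}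

/-- The consistency error at a point where the mesh is locally uniform. -/
theorem ReactionBound.consistency_of_equidistant (hα : 0 < α) (hε : ∀ i, 0 < ε i)
    (hq : ReactionBound α K e ε q q' q'') (hK0 : 0 ≤ K) (hVc : ContinuousOn V (Icc 0 1))
    (hV : TwiceDeriv V V' q) {c h : ℝ} (hh : 0 < h) (hc0 : 0 ≤ c - h) (hc1 : c + h ≤ 1) :
    |diffQuot₂ V (c - h) c (c + h) - q c| ≤
      K * (2 + 2 / α) * (h ^ 2 + ∑ m, min (layerSup α (ε m) (c - h) (c + h)) (h ^ 2 / ε m)) := by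
  set T := ∑ m, min (layerSup α (ε m) (c - h) (c + h)) (h ^ 2 / ε m) with hT
  have hT0 : 0 ≤ T := Finset.sum_nonneg fun m _ =>
    le_min (layerSup_pos _ _ _ _).le (by have := hε m; positivity)
  have key : ∀ t, 0 < t → t ≤ h → |q (c + t) + q (c - t) - 2 * q c| ≤
      2 * (K * (2 + 2 / α) * (h ^ 2 + T)) := by
    intro t ht hth
    -- G'' is K times the weight, because α⁻¹B_m has second derivative B_m/ε_m. Second differences
    -- of q are therefore dominated by those of G.
    set G : ℝ → ℝ := fun y => K * (1 * (y ^ 2 / 2) + ∑ m, α⁻¹ * layer α (ε m) y) with hG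
    have hGd : TwiceDeriv G _ _ := TwiceDeriv.const_mul K
      (TwiceDeriv.add (fun x _ => hasDerivAt_sq_half 1 x) (TwiceDeriv.sum Finset.univ fun m _ =>
        (twiceDeriv_layer hα (hε m)).const_mul α⁻¹))
    have hGc : Continuous G := continuous_const.mul ((continuous_sq_half 1).add
      (continuous_finsetSum _ fun m _ => continuous_const.mul (continuous_layer _ _)))
    have hsub : ∀ y ∈ Ioo (c - t) (c + t), y ∈ Ioo (0 : ℝ) 1 := fun y hy =>
      ⟨by linarith [hy.1], by linarith [hy.2]⟩
    have h1 := abs_diffQuot₂_le (a := c - t) (c := c) (b := c + t) (by linarith) (by linarith)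
      (hq.cont.mono fun y hy => ⟨by linarith [hy.1], by linarith [hy.2]⟩) hGc.continuousOn
      (fun x hx => hq.twiceDeriv x (hsub x hx)) (fun x hx => hGd x (hsub x hx))
      (fun x hx => (hq.second x (hsub x hx)).trans (le_of_eq (by
        unfold layerWeight
        congr 2
        refine Finset.sum_congr rfl fun m _ => ?_
        have := (hε m).ne'
        field_simp)))
    rw [diffQuot₂_of_equidistant, diffQuot₂_of_equidistant, abs_div,
      abs_of_pos (by positivity : 0 < t ^ 2), div_le_div_iff_of_pos_right (by positivity)] at h1
    have e : G (c + t) + G (c - t) - 2 * G c = K * (t ^ 2 + α⁻¹ * ∑ m,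
        (layer α (ε m) (c + t) + layer α (ε m) (c - t) - 2 * layer α (ε m) c)) := by
      simp only [hG, ← Finset.mul_sum, Finset.sum_sub_distrib, Finset.sum_add_distrib]
      ring
    have h2 : ∑ m, (layer α (ε m) (c + t) + layer α (ε m) (c - t) - 2 * layer α (ε m) c) ≤
        (2 + 2 * α) * T := by
      rw [hT, Finset.mul_sum]
      exact Finset.sum_le_sum fun m _ => layer_second_diff_le hα (hε m) hc0 hc1 ht hth
    rw [e] at h1
    refine h1.trans ?_
    have h3 : α⁻¹ * ∑ m, (layer α (ε m) (c + t) + layer α (ε m) (c - t) - 2 * layer α (ε m) c) ≤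
        α⁻¹ * ((2 + 2 * α) * T) := by gcongr
    have h4 : α⁻¹ * ((2 + 2 * α) * T) = (2 + 2 / α) * T := by field_simp; ring
    have h5 : t ^ 2 ≤ h ^ 2 := by gcongr
    have h6 : 0 ≤ 2 / α := by positivity
    have h7 : t ^ 2 + α⁻¹ * ∑ m, (layer α (ε m) (c + t) + layer α (ε m) (c - t) -
        2 * layer α (ε m) c) ≤ 2 * ((2 + 2 / α) * (h ^ 2 + T)) := by
      nlinarith [mul_nonneg h6 (sq_nonneg h), mul_nonneg h6 hT0, sq_nonneg h]
    calc _ ≤ K * (2 * ((2 + 2 / α) * (h ^ 2 + T))) := mul_le_mul_of_nonneg_left h7 hK0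
      _ = _ := by ring
  refine abs_diffQuot₂_sub_le_of_equidistant hh
    (hVc.mono fun y hy => ⟨by linarith [hy.1], by linarith [hy.2]⟩)
    (fun x hx => hV x ⟨by linarith [hx.1], by linarith [hx.2]⟩) (fun t ht => ?_)
  rcases lt_trichotomy t 0 with h | rfl | h
  · have := key (-t) (by linarith) (by linarith [ht.1])
    rw [← sub_eq_add_neg, sub_neg_eq_add, add_comm (q (c - t))] at this
    exact this
  · have h6 : 0 ≤ 2 / α := by positivity
    rw [add_zero, sub_zero, show q c + q c - 2 * q c = 0 by ring, abs_zero]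
    positivity
  · exact key t h ht.2.le

/-- First-order counterpart of `layer_second_diff_le`: either both values are bounded by `layerSup`,
or the mean value inequality is used with slope at most 2√(α/e). -/
theorem oddLayer_sub_le {α e a b x y : ℝ} (hα : 0 < α) (he : 0 < e) (ha : 0 ≤ a) (hb : b ≤ 1)
    (hx : a ≤ x) (hxy : x ≤ y) (hy : y ≤ b) :
    (√α)⁻¹ * (oddLayer α e y - oddLayer α e x) ≤
      (2 + 2 / √α) * min (layerSup α e a b) ((b - a) / √e) := by
  have hsa : 0 < √α := Real.sqrt_pos.2 hα
  have hse : 0 < √e := Real.sqrt_pos.2 he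
  have hβ := layerSup_pos α e a b
  rw [mul_min_of_nonneg _ _ (by positivity)]
  refine le_min ?_ ?_
  · have h1 := abs_le.1 ((abs_oddLayer_le α e y).trans
      (layer_le_layerSup (a := a) (b := b) ⟨by linarith, hy⟩))
    have h2 := abs_le.1 ((abs_oddLayer_le α e x).trans
      (layer_le_layerSup (a := a) (b := b) ⟨hx, by linarith⟩))
    calc (√α)⁻¹ * (oddLayer α e y - oddLayer α e x) ≤ (√α)⁻¹ * (2 * layerSup α e a b) := by
          gcongr; linarith
      _ = 2 / √α * layerSup α e a b := by ring
      _ ≤ _ := by gcongr; linarith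
  · have h1 := abs_sub_le_sub_of_hasDerivAt (G := fun y => 2 * layerRate α e * y)
      (G' := fun _ => 2 * layerRate α e)
      (continuous_oddLayer α e).continuousOn (by fun_prop)
      (fun x _ => hasDerivAt_oddLayer α e x)
      (fun x _ => ((hasDerivAt_id x).const_mul _).congr_deriv (by ring))
      (fun z hz => by
        have p1 := layer_pos α e z
        have p2 := layerRate_nonneg α e
        have p3 : layer α e z ≤ 2 :=
          (layer_le_layerSup (a := a) (b := b) ⟨by linarith [hz.1], by linarith [hz.2]⟩).trans
            (layerSup_le_two ha hb)
        rw [abs_of_nonneg (by positivity)]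
        nlinarith) hxy
    have h2 := (le_abs_self _).trans h1
    have h3 : layerRate α e = √α / √e := Real.sqrt_div hα.le e
    have h0 : 0 ≤ y - x := sub_nonneg.2 hxy
    calc (√α)⁻¹ * (oddLayer α e y - oddLayer α e x)
        ≤ (√α)⁻¹ * (2 * layerRate α e * (y - x)) := by gcongr; linarith
      _ = 2 * ((y - x) / √e) := by rw [h3]; field_simp
      _ ≤ (2 + 2 / √α) * ((b - a) / √e) := by
          have : 0 ≤ 2 / √α := by positivity
          gcongr
          · linarith

/-- The consistency error on arbitrary points, by the first derivative of the reaction term. -/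
theorem abs_consistency_le {ω : Fin n → ℝ} {L : ℝ} (hα : 0 < α) (hε : ∀ i, 0 < ε i)
    (hω : ∀ m, 0 ≤ ω m) (hL : 0 ≤ L) (hqc : ContinuousOn q (Icc 0 1))
    (hqd : TwiceDeriv q q' q'')
    (hq' : ∀ x ∈ Ioo (0 : ℝ) 1, |q' x| ≤ L * (1 + ∑ m, ω m * (layer α (ε m) x / √(ε m))))
    (hVc : ContinuousOn V (Icc 0 1)) (hV : TwiceDeriv V V' q) {a c b : ℝ} (hac : a < c)
    (hcb : c < b) (ha : 0 ≤ a) (hb : b ≤ 1) :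
    |diffQuot₂ V a c b - q c| ≤ L * (2 + 2 / √α) *
      ((b - a) + ∑ m, ω m * min (layerSup α (ε m) a b) ((b - a) / √(ε m))) := by
  -- G is a primitive of the bound for q'. The factors ω m cover both bounds of `ReactionBound`: ω =
  -- 1 for `first` and ω m = 1/√ε_m for `first_sqrt`.
  set G : ℝ → ℝ := fun y => L * (y + ∑ m, ω m * ((√α)⁻¹ * oddLayer α (ε m) y)) with hG
  have hsa : 0 < √α := Real.sqrt_pos.2 hα
  have hGd : ∀ y, HasDerivAt G (L * (1 + ∑ m, ω m * (layer α (ε m) y / √(ε m)))) y := by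
    intro y
    refine (((hasDerivAt_id y).add (HasDerivAt.fun_sum fun m _ =>
      ((hasDerivAt_oddLayer α (ε m) y).const_mul (√α)⁻¹).const_mul (ω m))).const_mul
        L).congr_deriv ?_
    congr 2
    refine Finset.sum_congr rfl fun m _ => ?_
    have h3 : layerRate α (ε m) = √α / √(ε m) := Real.sqrt_div hα.le _
    rw [h3]
    field_simp
  have hGc : Continuous G := continuous_iff_continuousAt.2 fun y => (hGd y).continuousAt
  have key : ∀ x y, a ≤ x → x ≤ y → y ≤ b → |q y - q x| ≤ L * (2 + 2 / √α) *
      ((b - a) + ∑ m, ω m * min (layerSup α (ε m) a b) ((b - a) / √(ε m))) := by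
    intro x y hx hxy hy
    have h1 := abs_sub_le_sub_of_hasDerivAt
      (hqc.mono fun z hz => ⟨by linarith [hz.1], by linarith [hz.2]⟩) hGc.continuousOn
      (fun z hz => (hqd z ⟨by linarith [hz.1], by linarith [hz.2]⟩).1) (fun z _ => hGd z)
      (fun z hz => hq' z ⟨by linarith [hz.1], by linarith [hz.2]⟩) hxy
    refine h1.trans ?_
    have e : G y - G x = L * ((y - x) + ∑ m, ω m * ((√α)⁻¹ *
        (oddLayer α (ε m) y - oddLayer α (ε m) x))) := by
      simp only [hG, mul_sub, Finset.sum_sub_distrib]; ring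
    rw [e, mul_assoc]
    refine mul_le_mul_of_nonneg_left ?_ hL
    rw [mul_add]
    refine add_le_add ?_ ?_
    · have : 0 ≤ 2 / √α := by positivity
      nlinarith
    · rw [Finset.mul_sum]
      refine Finset.sum_le_sum fun m _ => ?_
      rw [mul_left_comm (2 + 2 / √α)]
      exact mul_le_mul_of_nonneg_left (oddLayer_sub_le hα (hε m) ha hb hx hxy hy) (hω m)
  refine abs_diffQuot₂_sub_le hac hcb
    (hVc.mono fun z hz => ⟨by linarith [hz.1], by linarith [hz.2]⟩)
    (fun z hz => hV z ⟨by linarith [hz.1], by linarith [hz.2]⟩) (fun z hz => ?_)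
  rcases le_total z c with h | h
  · rw [abs_sub_comm]; exact key z c hz.1.le h hcb.le
  · exact key c z hac.le h hz.2.le

end

/-! ### Transition points and their reflection. -/

/-- The points `0, τ_1, …, τ_n, 1/2`. -/
noncomputable def extParam {n : ℕ} (τ : Fin n → ℝ) (s : ℕ) : ℝ :=
  if s ≤ n then breakPoint τ s else 1 / 2

/-- The ordering properties of the transition parameters that determine the mesh. -/
structure IsTransition {n : ℕ} (τ : Fin n → ℝ) : Prop where
  pos : ∀ s, 1 ≤ s → s ≤ n → 0 < extParam τ s
  le_half : ∀ s ≤ n, extParam τ s ≤ extParam τ (s + 1) / 2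

section breakPoints

variable {n : ℕ} {τ : Fin n → ℝ}

theorem extParam_zero : extParam τ 0 = 0 := by simp [extParam, breakPoint]

theorem extParam_last : extParam τ (n + 1) = 1 / 2 := by simp [extParam]

theorem extParam_succ (i : Fin n) : extParam τ (i + 1) = τ i := by
  have := i.isLt
  simp [extParam, breakPoint]

theorem breakPoint_eq_extParam {s : ℕ} (hs : s ≤ n) : breakPoint τ s = extParam τ s := by
  simp [extParam, hs]

theorem breakPoint_reflect {s : ℕ} (hs : s ≤ n) : breakPoint τ (2 * n + 1 - s) = 1 - extParam τ s := by
  rcases Nat.eq_zero_or_pos s with rfl | hpos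
  · rw [extParam_zero]
    have h1 : ¬ (2 * n + 1 - 0 = 0) := by omega
    have h2 : ¬ (2 * n + 1 - 0 - 1 < n) := by omega
    have h3 : ¬ (2 * n - (2 * n + 1 - 0) < n ∧ 2 * n + 1 - 0 ≤ 2 * n) := by omega
    rw [breakPoint, if_neg h1, dif_neg h2, dif_neg h3, sub_zero]
  · have h1 : ¬ (2 * n + 1 - s = 0) := by omega
    have h2 : ¬ (2 * n + 1 - s - 1 < n) := by omega
    have h3 : 2 * n - (2 * n + 1 - s) < n ∧ 2 * n + 1 - s ≤ 2 * n := by omega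
    have h4 : 2 * n - (2 * n + 1 - s) = s - 1 := by omega
    rw [breakPoint, if_neg h1, dif_neg h2, dif_pos h3]
    have h5 := extParam_succ (τ := τ) ⟨s - 1, by omega⟩
    rw [Nat.sub_add_cancel hpos] at h5
    rw [h5]
    simp only [h4]

theorem breakPoint_zero : breakPoint τ 0 = 0 := by simp [breakPoint]

theorem IsTransition.nonneg (h : IsTransition τ) {s : ℕ} (hs : s ≤ n + 1) : 0 ≤ extParam τ s := by
  rcases Nat.eq_zero_or_pos s with rfl | hpos
  · rw [extParam_zero]
  · rcases Nat.lt_or_ge n s with h1 | h1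
    · obtain rfl : s = n + 1 := by omega
      rw [extParam_last]; norm_num
    · exact (h.pos s hpos h1).le

theorem IsTransition.lt_succ (h : IsTransition τ) {s : ℕ} (hs : s ≤ n) :
    extParam τ s < extParam τ (s + 1) := by
  have h1 := h.le_half s hs
  have h2 : 0 < extParam τ (s + 1) := by
    rcases Nat.lt_or_ge s n with h3 | h3
    · exact h.pos _ (by omega) (by omega)
    · obtain rfl : s = n := by omega
      rw [extParam_last]; norm_num
  linarith

theorem IsTransition.mono (h : IsTransition τ) {r s : ℕ} (hrs : r ≤ s) (hs : s ≤ n + 1) :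
    extParam τ r ≤ extParam τ s := by
  induction s, hrs using Nat.le_induction with
  | base => exact le_rfl
  | succ s hrs ih => exact (ih (by omega)).trans (h.lt_succ (by omega)).le

theorem IsTransition.le_quarter (h : IsTransition τ) {s : ℕ} (hs : s ≤ n) :
    extParam τ s ≤ 1 / 4 := by
  have h1 := h.mono hs (by omega)
  have h2 := h.le_half n le_rfl
  rw [extParam_last] at h2
  linarith

theorem breakPoint_reflect_succ {k : ℕ} (hk : k < n) :
    breakPoint τ (2 * n - k) = 1 - extParam τ (k + 1) := by
  rw [← breakPoint_reflect (show k + 1 ≤ n by omega)]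
  congr 1; omega

/-- Position and length of the subinterval number `s`, described through `k = min s (2n - s)`. -/
theorem IsTransition.subinterval (h : IsTransition τ) {s k : ℕ} (hs : s ≤ 2 * n)
    (hk : k = min s (2 * n - s)) :
    extParam τ k ≤ breakPoint τ s ∧ breakPoint τ s < breakPoint τ (s + 1) ∧
      breakPoint τ (s + 1) ≤ 1 - extParam τ k ∧
      breakPoint τ (s + 1) - breakPoint τ s ≤ 2 * extParam τ (k + 1) := by
  have hkn : k ≤ n := by omega
  have h1 := h.lt_succ hkn
  have h2 := h.le_quarter hkn
  have h3 := h.nonneg (show k ≤ n + 1 by omega)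
  rcases lt_trichotomy s n with hsn | rfl | hsn
  · obtain rfl : k = s := by omega
    have h4 := h.le_quarter (show k + 1 ≤ n by omega)
    rw [breakPoint_eq_extParam (show k ≤ n by omega),
      breakPoint_eq_extParam (show k + 1 ≤ n by omega)]
    refine ⟨le_rfl, h1, by linarith, by linarith⟩
  · obtain rfl : k = s := by omega
    have h4 : breakPoint τ (k + 1) = 1 - extParam τ k := by
      rw [← breakPoint_reflect le_rfl]; congr 1; omega
    rw [h4, breakPoint_eq_extParam le_rfl, extParam_last]
    refine ⟨le_rfl, by linarith, le_rfl, by linarith⟩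
  · have hs' : s = 2 * n - k := by omega
    have hkn' : k < n := by omega
    have h4 := h.le_quarter (show k + 1 ≤ n by omega)
    have h5 : breakPoint τ (s + 1) = 1 - extParam τ k := by
      rw [← breakPoint_reflect hkn]; congr 1; omega
    rw [h5, hs', breakPoint_reflect_succ hkn']
    refine ⟨by linarith, by linarith, le_rfl, by linarith⟩

end breakPoints

/-! ### Numbers of mesh intervals. -/

section counts

variable {n N : ℕ}

theorem intervalStart_succ (s : ℕ) :
    intervalStart n N (s + 1) = intervalStart n N s + intervalCount n N s :=
  Finset.sum_range_succ _ _

theorem intervalStart_mono {r s : ℕ} (h : r ≤ s) : intervalStart n N r ≤ intervalStart n N s :=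
  Finset.sum_le_sum_of_subset (Finset.range_subset_range.2 h)

theorem intervalStart_zero : intervalStart n N 0 = 0 := by simp [intervalStart]

theorem intervalCount_of_lt {s : ℕ} (h0 : 1 ≤ s) (h : s < n) :
    intervalCount n N s = N / 2 ^ (n - s + 2) := by
  rw [intervalCount, if_neg (by omega), if_pos h]

theorem intervalCount_of_gt {s : ℕ} (h0 : n < s) (h : s < 2 * n) :
    intervalCount n N s = N / 2 ^ (n - (2 * n - s) + 2) := by
  rw [intervalCount, if_neg (by omega), if_neg (by omega), if_neg (by omega)]

theorem intervalCount_reflect {r s : ℕ} (h : r + s = 2 * n) :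
    intervalCount n N r = intervalCount n N s := by
  wlog hrs : r ≤ s generalizing r s
  · exact (this (by omega) (by omega)).symm
  rcases Nat.eq_zero_or_pos r with rfl | h0
  · obtain rfl : s = 2 * n := by omega
    simp [intervalCount]
  rcases Nat.lt_or_ge r n with h1 | h1
  · rw [intervalCount_of_lt h0 h1, intervalCount_of_gt (by omega) (by omega)]
    congr 3; omega
  · congr 1; omega

theorem le_intervalCount (hn : 1 ≤ n) {s : ℕ} (hs : s ≤ 2 * n) :
    N / 2 ^ (n + 1) ≤ intervalCount n N s := by
  have key : ∀ e, e ≤ n + 1 → N / 2 ^ (n + 1) ≤ N / 2 ^ e := fun e he =>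
    Nat.div_le_div_left (Nat.pow_le_pow_right two_pos he) (by positivity)
  unfold intervalCount
  split_ifs
  · exact le_rfl
  · exact key _ (by omega)
  · simpa using key 1 (by omega)
  · exact key _ (by omega)

/-- With Q = N/2^(n+1), the counts are Q, Q, 2Q, 4Q, …, so the partial sums double. -/
theorem intervalStart_of_le {Q : ℕ} (hN : N = 2 ^ (n + 1) * Q) {s : ℕ} (hs : s + 1 ≤ n) :
    intervalStart n N (s + 1) = 2 ^ s * Q := by
  induction s with
  | zero =>
    rw [intervalStart_succ, intervalStart_zero, intervalCount, if_pos (Or.inl rfl), hN,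
      Nat.mul_div_cancel_left _ (by positivity)]
    simp
  | succ s ih =>
    have h1 : intervalCount n N (s + 1) = 2 ^ s * Q := by
      have e : (2 : ℕ) ^ (n + 1) * Q = 2 ^ (n - (s + 1) + 2) * (2 ^ s * Q) := by
        rw [← mul_assoc, ← pow_add]; congr 2; omega
      rw [intervalCount, if_neg (by omega), if_pos (by omega), hN, e,
        Nat.mul_div_cancel_left _ (by positivity)]
    rw [intervalStart_succ, ih (by omega), h1, pow_succ]; ring

/-- The two outer parts have 2^(n-1)Q intervals each, equal by reflection, and the middle one has
2^n Q. -/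
theorem intervalStart_last (hn : 1 ≤ n) (hN : 2 ^ (n + 1) ∣ N) :
    intervalStart n N (2 * n + 1) = N := by
  obtain ⟨Q, hQ⟩ := hN
  have h1 : intervalStart n N n = 2 ^ (n - 1) * Q := by
    have := intervalStart_of_le hQ (s := n - 1) (by omega)
    rwa [Nat.sub_add_cancel hn] at this
  have h2 : intervalCount n N n = 2 ^ n * Q := by
    rw [intervalCount, if_neg (by omega), if_neg (by omega), if_pos rfl, hQ, pow_succ,
      show 2 ^ n * 2 * Q = 2 * (2 ^ n * Q) by ring, Nat.mul_div_cancel_left _ two_pos]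
  have h3 : ∑ r ∈ Finset.range n, intervalCount n N (n + 1 + r) = intervalStart n N n := by
    rw [intervalStart, ← Finset.sum_range_reflect]
    refine Finset.sum_congr rfl fun r hr => ?_
    have hr' := Finset.mem_range.1 hr
    exact intervalCount_reflect (by omega)
  have h4 : intervalStart n N (2 * n + 1) = intervalStart n N (n + 1) +
      ∑ r ∈ Finset.range n, intervalCount n N (n + 1 + r) := by
    rw [intervalStart, show 2 * n + 1 = n + 1 + n by omega, Finset.sum_range_add]
    rfl
  rw [h4, h3, intervalStart_succ, h1, h2, hQ]
  obtain ⟨m, rfl⟩ : ∃ m, n = m + 1 := ⟨n - 1, by omega⟩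
  simp only [Nat.add_sub_cancel, pow_succ]; ring

theorem exists_interval_of_lt {j K : ℕ} (hj : j < intervalStart n N K) :
    ∃ s < K, intervalStart n N s ≤ j ∧ j < intervalStart n N (s + 1) := by
  induction K with
  | zero => rw [intervalStart_zero] at hj; omega
  | succ K ih =>
    rcases Nat.lt_or_ge j (intervalStart n N K) with h | h
    · obtain ⟨s, hs, h1⟩ := ih h
      exact ⟨s, by omega, h1⟩
    · exact ⟨K, by omega, h, hj⟩

end counts

/-! ### Mesh points and local mesh geometry. -/

section mesh

variable {n N : ℕ} {τ : Fin n → ℝ}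

/-- The length of the mesh intervals in the subinterval number `s`. -/
noncomputable def stepSize {n : ℕ} (τ : Fin n → ℝ) (N s : ℕ) : ℝ :=
  (breakPoint τ (s + 1) - breakPoint τ s) / (intervalCount n N s : ℝ)

/-- Of the sum defining the mesh point, the terms before s are full and telescope to the break
point, and those after s vanish by truncated subtraction. -/
theorem meshPoint_eq (hc : ∀ s ≤ 2 * n, 0 < intervalCount n N s) {s j : ℕ} (hs : s ≤ 2 * n)
    (h1 : intervalStart n N s ≤ j) (h2 : j ≤ intervalStart n N (s + 1)) :
    meshPoint τ N j = breakPoint τ s + ((j : ℝ) - intervalStart n N s) * stepSize τ N s := by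
  have hlt : ∀ K ≤ s, ∑ r ∈ Finset.range K,
      ((min (j - intervalStart n N r) (intervalCount n N r) : ℕ) : ℝ) * stepSize τ N r =
      breakPoint τ K := by
    intro K hK
    induction K with
    | zero => simp [breakPoint_zero]
    | succ K ih =>
      have h3 := intervalStart_mono (n := n) (N := N) hK
      rw [intervalStart_succ] at h3
      have h4 := hc K (by omega)
      have h5 : min (j - intervalStart n N K) (intervalCount n N K) = intervalCount n N K := by
        omega
      have h6 : (intervalCount n N K : ℝ) ≠ 0 := by exact_mod_cast h4.ne'
      rw [Finset.sum_range_succ, ih (by omega), h5, stepSize]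
      field_simp
      ring
  have hge : ∀ d, ∑ r ∈ Finset.range (s + 1 + d),
      ((min (j - intervalStart n N r) (intervalCount n N r) : ℕ) : ℝ) * stepSize τ N r =
      breakPoint τ s + ((j : ℝ) - intervalStart n N s) * stepSize τ N s := by
    intro d
    induction d with
    | zero =>
      rw [intervalStart_succ] at h2
      have h5 : min (j - intervalStart n N s) (intervalCount n N s) = j - intervalStart n N s := by
        omega
      rw [add_zero, Finset.sum_range_succ, hlt s le_rfl, h5, Nat.cast_sub h1]
    | succ d ih =>
      have h3 := intervalStart_mono (n := n) (N := N) (show s + 1 ≤ s + 1 + d by omega)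
      have h5 : min (j - intervalStart n N (s + 1 + d)) (intervalCount n N (s + 1 + d)) = 0 := by
        omega
      rw [← add_assoc, Finset.sum_range_succ, ih, h5]
      simp
  have := hge (2 * n - s)
  rw [show s + 1 + (2 * n - s) = 2 * n + 1 by omega] at this
  exact this

theorem exists_cell (hτ : IsTransition τ) (hn : 1 ≤ n) (hN : 2 ^ (n + 1) ∣ N) (hN0 : 0 < N)
    {j : ℕ} (hj : j < N) : ∃ s ≤ 2 * n, intervalStart n N s ≤ j ∧ j < intervalStart n N (s + 1) ∧
      meshPoint τ N (j + 1) - meshPoint τ N j = stepSize τ N s ∧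
      breakPoint τ s ≤ meshPoint τ N j ∧ meshPoint τ N (j + 1) ≤ breakPoint τ (s + 1) ∧
      0 < stepSize τ N s ∧
      (j = intervalStart n N s → meshPoint τ N j = breakPoint τ s) ∧
      (j + 1 = intervalStart n N (s + 1) → meshPoint τ N (j + 1) = breakPoint τ (s + 1)) := by
  have hc : ∀ s ≤ 2 * n, 0 < intervalCount n N s := fun s hs =>
    lt_of_lt_of_le (Nat.div_pos (Nat.le_of_dvd hN0 hN) (by positivity)) (le_intervalCount hn hs)
  obtain ⟨s, hs, h1, h2⟩ := exists_interval_of_lt (n := n) (N := N) (j := j) (K := 2 * n + 1)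
    (by rwa [intervalStart_last hn hN])
  have hs' : s ≤ 2 * n := by omega
  have e1 := meshPoint_eq (τ := τ) hc hs' h1 h2.le
  have e2 := meshPoint_eq (τ := τ) hc hs' (j := j + 1) (by omega) (by omega)
  have hcs : (0 : ℝ) < intervalCount n N s := by exact_mod_cast hc s hs'
  have hlt := (hτ.subinterval hs' rfl).2.1
  have hH : 0 < stepSize τ N s := div_pos (sub_pos.2 hlt) hcs
  have hH' : intervalCount n N s * stepSize τ N s = breakPoint τ (s + 1) - breakPoint τ s := by
    rw [stepSize]; field_simp
  have h1' : (intervalStart n N s : ℝ) ≤ j := by exact_mod_cast h1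
  have h2' : (j : ℝ) + 1 ≤ intervalStart n N s + intervalCount n N s := by
    rw [intervalStart_succ] at h2; exact_mod_cast h2
  push_cast at e2
  refine ⟨s, hs', h1, h2, ?_, ?_, ?_, hH, fun h => ?_, fun h => ?_⟩
  · rw [e1, e2]; ring
  · rw [e1]
    have := mul_nonneg (sub_nonneg.2 h1') hH.le
    linarith
  · rw [e2]
    have : ((j : ℝ) + 1 - intervalStart n N s) * stepSize τ N s ≤
      intervalCount n N s * stepSize τ N s := mul_le_mul_of_nonneg_right (by linarith) hH.le
    linarith
  · rw [e1, h]; ring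
  · rw [e2]
    have h3 : (j : ℝ) + 1 = intervalStart n N s + intervalCount n N s := by
      rw [intervalStart_succ] at h; exact_mod_cast h
    rw [h3, add_sub_cancel_left, hH']; ring

/-- The subinterval has length at most 2τ_{k+1} and at least N/2^(n+1) mesh intervals, which gives
the constant 2^(n+2). -/
theorem stepSize_le (hτ : IsTransition τ) (hn : 1 ≤ n) (hN : 2 ^ (n + 1) ∣ N) (hN0 : 0 < N)
    {s k : ℕ} (hs : s ≤ 2 * n) (hk : k = min s (2 * n - s)) :
    stepSize τ N s ≤ 2 ^ (n + 2) * extParam τ (k + 1) / N := by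
  have h1 := (hτ.subinterval hs hk).2.2.2
  have h2 := hτ.nonneg (show k + 1 ≤ n + 1 by omega)
  have h3 := le_intervalCount (N := N) hn hs
  have h4 : (N : ℝ) ≤ 2 ^ (n + 1) * intervalCount n N s := by
    have : N ≤ 2 ^ (n + 1) * intervalCount n N s := by
      calc N = 2 ^ (n + 1) * (N / 2 ^ (n + 1)) := (Nat.mul_div_cancel' hN).symm
        _ ≤ _ := Nat.mul_le_mul_left _ h3
    exact_mod_cast this
  have hN' : (0 : ℝ) < N := by exact_mod_cast hN0
  have h5 : (0 : ℝ) < intervalCount n N s := by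
    by_contra! h
    nlinarith [pow_pos (two_pos : (0 : ℝ) < 2) (n + 1)]
  rw [stepSize, div_le_div_iff₀ h5 hN']
  calc _ ≤ 2 * extParam τ (k + 1) * N := by gcongr
    _ ≤ 2 * extParam τ (k + 1) * (2 ^ (n + 1) * intervalCount n N s) := by gcongr
    _ = _ := by ring

theorem meshPoint_zero : meshPoint τ N 0 = 0 := by simp [meshPoint]

theorem meshPoint_last (hτ : IsTransition τ) (hn : 1 ≤ n) (hN : 2 ^ (n + 1) ∣ N) (hN0 : 0 < N) :
    meshPoint τ N N = 1 := by
  obtain ⟨s, hs, h1, h2, -, -, -, -, -, h3⟩ := exists_cell hτ hn hN hN0 (j := N - 1) (by omega)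
  have h4 := intervalStart_mono (n := n) (N := N) (show s + 1 ≤ 2 * n + 1 by omega)
  rw [intervalStart_last hn hN] at h4
  have h5 := h3 (by omega)
  rw [Nat.sub_add_cancel hN0] at h5
  rw [h5]
  have h6 : s = 2 * n := by
    by_contra hne
    have h7 := intervalStart_mono (n := n) (N := N) (show s + 1 + 1 ≤ 2 * n + 1 by omega)
    rw [intervalStart_last hn hN, intervalStart_succ] at h7
    have h8 := le_intervalCount (N := N) hn (show s + 1 ≤ 2 * n by omega)
    have h9 := Nat.div_pos (Nat.le_of_dvd hN0 hN) (show 0 < 2 ^ (n + 1) by positivity)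
    omega
  rw [h6]
  have := breakPoint_reflect (τ := τ) (Nat.zero_le n)
  rwa [extParam_zero, sub_zero, Nat.sub_zero] at this

theorem meshPoint_lt_succ (hτ : IsTransition τ) (hn : 1 ≤ n) (hN : 2 ^ (n + 1) ∣ N) {j : ℕ}
    (hj : j < N) : meshPoint τ N j < meshPoint τ N (j + 1) := by
  obtain ⟨s, -, -, -, h1, -, -, h2, -⟩ := exists_cell hτ hn hN (by omega) hj
  linarith

theorem meshPoint_mono (hτ : IsTransition τ) (hn : 1 ≤ n) (hN : 2 ^ (n + 1) ∣ N) {i j : ℕ}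
    (hij : i ≤ j) (hj : j ≤ N) : meshPoint τ N i ≤ meshPoint τ N j := by
  induction j, hij using Nat.le_induction with
  | base => exact le_rfl
  | succ j hij ih => exact (ih (by omega)).trans (meshPoint_lt_succ hτ hn hN (by omega)).le

theorem meshPoint_mem (hτ : IsTransition τ) (hn : 1 ≤ n) (hN : 2 ^ (n + 1) ∣ N) (hN0 : 0 < N)
    {j : ℕ} (hj : j ≤ N) : meshPoint τ N j ∈ Icc (0 : ℝ) 1 := by
  constructor
  · rw [← meshPoint_zero (τ := τ) (N := N)]
    exact meshPoint_mono hτ hn hN (Nat.zero_le j) hj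
  · rw [← meshPoint_last hτ hn hN hN0]
    exact meshPoint_mono hτ hn hN hj le_rfl

/-- The local geometry of the mesh: near an interior mesh point the mesh intervals are small
compared to some `τ_{k+1}`, and the neighbours are (almost) `τ_k` away from the boundary. -/
theorem mesh_local (hτ : IsTransition τ) (hn : 1 ≤ n) (hN : 2 ^ (n + 1) ∣ N) {j : ℕ}
    (hj : 1 ≤ j) (hjN : j < N) :
    (∃ k ≤ n, extParam τ k * (1 - 2 ^ (n + 2) / N) ≤ meshPoint τ N (j - 1) ∧
      meshPoint τ N (j + 1) ≤ 1 - extParam τ k * (1 - 2 ^ (n + 2) / N) ∧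
      meshPoint τ N j - meshPoint τ N (j - 1) ≤ 2 ^ (n + 2) * extParam τ (k + 1) / N ∧
      meshPoint τ N (j + 1) - meshPoint τ N j ≤ 2 ^ (n + 2) * extParam τ (k + 1) / N) ∧
    ((∀ s, s ≤ 2 * n → j ≠ intervalStart n N s) →
      meshPoint τ N j - meshPoint τ N (j - 1) = meshPoint τ N (j + 1) - meshPoint τ N j) := by
  have hN0 : 0 < N := by omega
  have hNr : (0 : ℝ) < N := by exact_mod_cast hN0
  obtain ⟨s₁, hs₁, a1, a2, a3, a4, a5, a6, -, a8⟩ :=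
    exists_cell hτ hn hN hN0 (j := j - 1) (by omega)
  obtain ⟨s₂, hs₂, b1, b2, b3, b4, b5, b6, b7, -⟩ := exists_cell hτ hn hN hN0 hjN
  rw [Nat.sub_add_cancel hj] at a3 a5 a8
  have hle : s₁ ≤ s₂ := by
    by_contra! h
    have := intervalStart_mono (n := n) (N := N) (show s₂ + 1 ≤ s₁ by omega)
    omega
  have hsmall : ∀ k ≤ n, extParam τ k * (1 - 2 ^ (n + 2) / N) ≤ extParam τ k := fun k hk => by
    have h1 := hτ.nonneg (show k ≤ n + 1 by omega)
    have h2 : 0 ≤ extParam τ k * (2 ^ (n + 2) / N) := by positivity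
    linarith
  rcases hle.eq_or_lt with rfl | hlt
  · refine ⟨⟨min s₁ (2 * n - s₁), by omega, ?_⟩, fun _ => by rw [a3, b3]⟩
    obtain ⟨c1, c2, c3, c4⟩ := hτ.subinterval hs₁ rfl
    have c5 := hsmall (min s₁ (2 * n - s₁)) (by omega)
    have c6 := stepSize_le hτ hn hN hN0 hs₁ rfl
    refine ⟨by linarith, by linarith, by linarith, by linarith⟩
  · have hs : s₂ = s₁ + 1 := by
      by_contra hne
      have h1 := intervalStart_mono (n := n) (N := N) (show s₁ + 1 + 1 ≤ s₂ by omega)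
      rw [intervalStart_succ] at h1
      have h8 := le_intervalCount (N := N) hn (show s₁ + 1 ≤ 2 * n by omega)
      have h9 := Nat.div_pos (Nat.le_of_dvd hN0 hN) (show 0 < 2 ^ (n + 1) by positivity)
      omega
    have hj2 : j = intervalStart n N s₂ := by rw [hs] at b1 ⊢; omega
    refine ⟨?_, fun h => absurd hj2 (h s₂ hs₂)⟩
    have hxj := b7 hj2
    obtain ⟨c1, c2, c3, c4⟩ := hτ.subinterval hs₁ rfl
    obtain ⟨d1, d2, d3, d4⟩ := hτ.subinterval hs₂ rfl
    have c6 := stepSize_le hτ hn hN hN0 hs₁ rfl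
    have d6 := stepSize_le hτ hn hN hN0 hs₂ rfl
    -- At a break point the neighbour on the boundary side lies within 2^(n+2)τ_k/N of it, whence
    -- the factor 1 - 2^(n+2)/N. The other neighbour's step is governed by τ_{k+1}.
    rcases Nat.lt_or_ge n s₂ with hns | hns
    · obtain ⟨k, hk⟩ : ∃ k, k + s₂ = 2 * n + 1 := ⟨2 * n + 1 - s₂, by omega⟩
      have e1 : min s₁ (2 * n - s₁) = k := by omega
      have e2 : min s₂ (2 * n - s₂) + 1 = k := by omega
      have hkn : k ≤ n := by omega
      rw [e1] at c1 c3 c4 c6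
      rw [e2] at d4 d6
      have e3 : breakPoint τ s₂ = 1 - extParam τ k := by
        rw [← breakPoint_reflect hkn]; congr 1; omega
      have c5 := hsmall k hkn
      have e4 := hτ.lt_succ hkn
      have e5 : 2 ^ (n + 2) * extParam τ k / N ≤ 2 ^ (n + 2) * extParam τ (k + 1) / N := by
        gcongr
      have e6 : 2 ^ (n + 2) * extParam τ k / N = extParam τ k * (2 ^ (n + 2) / N) := by ring
      refine ⟨k, hkn, by linarith, by linarith, by linarith, by linarith⟩
    · have e1 : min s₁ (2 * n - s₁) + 1 = s₂ := by omega
      have e2 : min s₂ (2 * n - s₂) = s₂ := by omega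
      rw [e1] at c4 c6
      rw [e2] at d1 d3 d4 d6
      have e3 : breakPoint τ s₂ = extParam τ s₂ := breakPoint_eq_extParam hns
      have c5 := hsmall s₂ hns
      have e4 := hτ.lt_succ hns
      have e5 : 2 ^ (n + 2) * extParam τ s₂ / N ≤ 2 ^ (n + 2) * extParam τ (s₂ + 1) / N := by
        gcongr
      have e6 : 2 ^ (n + 2) * extParam τ s₂ / N = extParam τ s₂ * (2 ^ (n + 2) / N) := by ring
      refine ⟨s₂, hns, by linarith, by linarith, by linarith, by linarith⟩

end mesh

/-! ### Resolved and negligible layers. -/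

section

variable {n : ℕ} {α : ℝ} {ε : Fin n → ℝ} {N : ℕ}

/-- The convention τ_{n+1} = 1/2 turns the cap 1/4 into τ_{n+1}/2, so the recursion has one form for
all indices. -/
theorem extParam_transitionParam (i : Fin n) :
    extParam (transitionParam ε α N) (i + 1) =
      min (extParam (transitionParam ε α N) (i + 2) / 2) (2 * √(ε i / α) * Real.log N) := by
  rw [extParam_succ, transitionParam]
  split_ifs with h
  · have := extParam_succ (τ := transitionParam ε α N) ⟨i + 1, h⟩
    rw [show (i : ℕ) + 2 = (i : ℕ) + 1 + 1 from rfl, this]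
  · have h1 : (i : ℕ) + 2 = n + 1 := by omega
    rw [h1, extParam_last]; norm_num

theorem isTransition_transitionParam (hα : 0 < α) (hε : ∀ i, 0 < ε i) (hN : 1 < N) :
    IsTransition (transitionParam ε α N) := by
  have hlog : 0 < Real.log N := Real.log_pos (by exact_mod_cast hN)
  have hpos : ∀ d s, d + s = n + 1 → 1 ≤ s → 0 < extParam (transitionParam ε α N) s := by
    intro d
    induction d with
    | zero =>
      intro s hs _
      obtain rfl : s = n + 1 := by omega
      rw [extParam_last]; norm_num
    | succ d ih =>
      intro s hs hs1
      obtain ⟨r, rfl⟩ : ∃ r, s = r + 1 := ⟨s - 1, by omega⟩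
      have h1 := extParam_transitionParam (ε := ε) (α := α) (N := N) ⟨r, by omega⟩
      simp only at h1
      have h2 := ih (r + 2) (by omega) (by omega)
      have h3 := hε ⟨r, by omega⟩
      rw [h1]
      positivity
  refine ⟨fun s h1 h2 => hpos (n + 1 - s) s (by omega) h1, fun s hs => ?_⟩
  rcases Nat.eq_zero_or_pos s with rfl | h0
  · rw [extParam_zero]
    have := hpos n 1 rfl le_rfl
    simp only [zero_add]; linarith
  · obtain ⟨r, rfl⟩ : ∃ r, s = r + 1 := ⟨s - 1, by omega⟩
    have h1 := extParam_transitionParam (ε := ε) (α := α) (N := N) ⟨r, by omega⟩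
    simp only at h1
    rw [h1]
    exact min_le_left _ _

/-- Going down from k, the index p is the first at which the minimum is taken to be the logarithmic
term, or 0 if there is none. Above p every minimum is a halving, so those transition points are
comparable. -/
theorem exists_threshold {k : ℕ} (hk : k ≤ n) : ∃ p ≤ k,
    (∀ i : Fin n, (i : ℕ) + 1 = p →
      extParam (transitionParam ε α N) p = 2 * √(ε i / α) * Real.log N) ∧
    ∀ s, p < s → s ≤ k → extParam (transitionParam ε α N) s =
      extParam (transitionParam ε α N) (s + 1) / 2 := by
  induction k with
  | zero => exact ⟨0, le_rfl, fun i hi => by omega, fun s h1 h2 => by omega⟩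
  | succ k ih =>
    have h1 := extParam_transitionParam (ε := ε) (α := α) (N := N) ⟨k, by omega⟩
    simp only at h1
    rcases min_choice (extParam (transitionParam ε α N) (k + 2) / 2)
      (2 * √(ε ⟨k, by omega⟩ / α) * Real.log N) with h2 | h2
    · obtain ⟨p, hp, hp1, hp2⟩ := ih (by omega)
      refine ⟨p, by omega, hp1, fun s hs1 hs2 => ?_⟩
      rcases Nat.lt_or_ge k s with h3 | h3
      · obtain rfl : s = k + 1 := by omega
        rw [h1, h2]
      · exact hp2 s hs1 h3
    · refine ⟨k + 1, le_rfl, fun i hi => ?_, fun s hs1 hs2 => by omega⟩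
      have hik : i = ⟨k, by omega⟩ := Fin.ext (by simp only; omega)
      rw [hik, h1, h2]

theorem mul_exp_neg_mul_le {r z : ℝ} (hr : 1 ≤ r) (hz : 1 ≤ z) :
    r * Real.exp (-(r * z)) ≤ Real.exp (-z) := by
  have h1 : r ≤ Real.exp ((r - 1) * z) := by
    have h2 := Real.add_one_le_exp ((r - 1) * z)
    nlinarith
  calc r * Real.exp (-(r * z)) ≤ Real.exp ((r - 1) * z) * Real.exp (-(r * z)) := by gcongr
    _ = Real.exp (-z) := by rw [← Real.exp_add]; congr 1; ring

/-- The factor 2 in the transition parameters yields N⁻². The relative loss c/N of distance costs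
only exp(2c), because log N ≤ N. -/
theorem exp_neg_two_mul_log_le {c N : ℝ} (hc : 0 ≤ c) (hN : 0 < N) :
    Real.exp (-(2 * Real.log N * (1 - c / N))) ≤ Real.exp (2 * c) * (N⁻¹) ^ 2 := by
  have h1 : Real.log N ≤ N := (Real.log_le_sub_one_of_pos hN).trans (by linarith)
  have h2 : Real.exp (2 * c) * (N⁻¹) ^ 2 = Real.exp (2 * c + -(2 * Real.log N)) := by
    rw [Real.exp_add, Real.exp_neg, two_mul (Real.log N), Real.exp_add, Real.exp_log hN, ← sq,
      inv_pow]
  rw [h2, Real.exp_le_exp]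
  have h3 : Real.log N * (c / N) ≤ c := by
    rw [mul_div_assoc', div_le_iff₀ hN, mul_comm c N]
    gcongr
  linarith

/-- The distance y is measured with e₀ ≥ e, so the layer of e decays like exp(-rz) with r = √e₀/√e ≥
1 and z ≥ 1. This absorbs an extra factor r. -/
theorem mul_layerSup_le {e e₀ a b y : ℝ} (hα : 0 < α) (he : 0 < e) (he₀ : e ≤ e₀) {c L : ℝ}
    (hc : 0 ≤ c) (hL : 2 * c ≤ L) (hL1 : 1 ≤ Real.log L) (hL0 : 0 < L)
    (hy : y = 2 * √(e₀ / α) * Real.log L * (1 - c / L)) (ha : y ≤ a) (hb : y ≤ 1 - b) :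
    √e₀ * layerSup α e a b ≤ √e * (2 * Real.exp (2 * c) * (L⁻¹) ^ 2) ∧
      layerSup α e a b ≤ 2 * Real.exp (2 * c) * (L⁻¹) ^ 2 := by
  have he₀' : 0 < e₀ := he.trans_le he₀
  have hse : 0 < √e := Real.sqrt_pos.2 he
  have hsα : 0 < √α := Real.sqrt_pos.2 hα
  set r := √e₀ / √e with hr
  set z := 2 * Real.log L * (1 - c / L) with hz
  have hr1 : 1 ≤ r := by
    rw [hr, one_le_div hse]; exact Real.sqrt_le_sqrt he₀
  have hcL : c / L ≤ 1 / 2 := by rw [div_le_div_iff₀ hL0 two_pos]; linarith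
  have hz1 : 1 ≤ z := by nlinarith
  have hry : layerRate α e * y = r * z := by
    rw [hy, hz, hr, layerRate, Real.sqrt_div hα.le, Real.sqrt_div he₀'.le]
    field_simp
  have hrate := layerRate_nonneg α e
  have h1 : layerSup α e a b ≤ 2 * Real.exp (-(r * z)) := by
    have p1 : Real.exp (-(layerRate α e * a)) ≤ Real.exp (-(r * z)) := by
      rw [← hry]; gcongr
    have p2 : Real.exp (-(layerRate α e * (1 - b))) ≤ Real.exp (-(r * z)) := by
      rw [← hry]; gcongr
    unfold layerSup; linarith
  have h2 := mul_exp_neg_mul_le hr1 hz1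
  have h3 := exp_neg_two_mul_log_le hc hL0
  have h4 : r * layerSup α e a b ≤ 2 * Real.exp (2 * c) * (L⁻¹) ^ 2 := by
    have := mul_le_mul_of_nonneg_left h1 (by linarith : 0 ≤ r)
    linarith
  constructor
  · have h5 : √e₀ = √e * r := by rw [hr]; field_simp
    rw [h5, mul_assoc]
    gcongr
  · have := layerSup_pos α e a b
    nlinarith

/-- Every parameter is either resolved by the mesh near a mesh point, or its layer function is
negligible there. -/
theorem exists_mesh_resolution (n : ℕ) (hn : 1 ≤ n) {α : ℝ} (hα : 0 < α) :
    ∃ C, 0 < C ∧ ∀ ε : Fin n → ℝ, StrictMono ε → (∀ i, 0 < ε i) →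
      ∀ N : ℕ, 2 ^ (n + 3) ≤ N → 2 ^ (n + 1) ∣ N → ∀ j, 1 ≤ j → j < N → ∀ a b,
      a = meshPoint (transitionParam ε α N) N (j - 1) →
      b = meshPoint (transitionParam ε α N) N (j + 1) →
      b - a ≤ C * (N : ℝ)⁻¹ ∧ ∃ p : ℕ,
        (∀ m : Fin n, p ≤ m → b - a ≤ C * √(ε m) * ((N : ℝ)⁻¹ * Real.log N)) ∧
        (∀ m : Fin n, (m : ℕ) < p → layerSup α (ε m) a b ≤ C * (N : ℝ)⁻¹ ^ 2) ∧
        (∀ i m : Fin n, (i : ℕ) < p → (m : ℕ) < p →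
          √(ε i) * layerSup α (ε m) a b ≤ √(ε m) * (C * (N : ℝ)⁻¹ ^ 2)) := by
  have hsα : 0 < √α := Real.sqrt_pos.2 hα
  obtain ⟨c, hc⟩ : ∃ c : ℝ, c = 2 ^ (n + 2) := ⟨_, rfl⟩
  have hc0 : 0 < c := by rw [hc]; positivity
  obtain ⟨C₁, hC₁⟩ : ∃ C₁ : ℝ, C₁ = 2 * Real.exp (2 * c) := ⟨_, rfl⟩
  have hC₁0 : 0 < C₁ := by rw [hC₁]; positivity
  obtain ⟨C₂, hC₂⟩ : ∃ C₂ : ℝ, C₂ = 4 * c * 2 ^ n / √α := ⟨_, rfl⟩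
  have hC₂0 : 0 < C₂ := by rw [hC₂]; positivity
  refine ⟨c + C₁ + C₂, by positivity, fun ε hmono hε N hN hdvd j hj hjN a b ha hb => ?_⟩
  have hN2 : 1 < N := lt_of_lt_of_le (Nat.one_lt_two_pow (by omega)) hN
  have hNr : (2 : ℝ) * c ≤ N := by
    have : ((2 ^ (n + 3) : ℕ) : ℝ) ≤ N := by exact_mod_cast hN
    push_cast at this
    rw [hc]
    calc (2 : ℝ) * 2 ^ (n + 2) = 2 ^ (n + 3) := by ring
      _ ≤ N := this
  have hN0 : (0 : ℝ) < N := by linarith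
  have hlog : 1 ≤ Real.log N := by
    rw [Real.le_log_iff_exp_le hN0]
    have h1 : (8 : ℝ) ≤ 2 * c := by
      rw [hc]
      have : (1 : ℝ) ≤ 2 ^ n := one_le_pow₀ (by norm_num)
      rw [pow_add]; linarith
    linarith [Real.exp_one_lt_d9]
  have hτ := isTransition_transitionParam hα hε hN2
  obtain ⟨⟨k, hk, q1, q2, q3, q4⟩, -⟩ := mesh_local hτ hn hdvd hj hjN
  rw [← hc, ← ha] at q1
  rw [← hc, ← hb] at q2
  rw [← hc, ← ha] at q3
  rw [← hc, ← hb] at q4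
  set t := extParam (transitionParam ε α N) with ht
  have hba : b - a ≤ 2 * (c * t (k + 1) / N) := by linarith
  -- Layers below p have decayed at distance about τ_p from the boundary, and the stencil is at
  -- least (1 - c/N)τ_k away. For those from p on, τ_{k+1} is comparable to a parameter bounded by
  -- √ε_m ln N.
  obtain ⟨p, hp, hp1, hp2⟩ := exists_threshold (ε := ε) (α := α) (N := N) hk
  rw [← ht] at hp1 hp2
  have htk : t (k + 1) ≤ 1 / 2 := by
    rw [← extParam_last (τ := transitionParam ε α N)]
    exact hτ.mono (by omega) le_rfl
  have hlayer : ∀ i m : Fin n, (i : ℕ) + 1 = p → m ≤ i →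
      √(ε i) * layerSup α (ε m) a b ≤ √(ε m) * (C₁ * (N : ℝ)⁻¹ ^ 2) ∧
        layerSup α (ε m) a b ≤ C₁ * (N : ℝ)⁻¹ ^ 2 := by
    intro i m hi hmi
    have h2 : c / N ≤ 1 / 2 := by rw [div_le_div_iff₀ hN0 two_pos]; linarith
    have h1 : t p * (1 - c / N) ≤ t k * (1 - c / N) :=
      mul_le_mul_of_nonneg_right (hτ.mono hp (by omega)) (by linarith)
    rw [hC₁]
    exact mul_layerSup_le hα (hε m) (hmono.monotone hmi) hc0.le hNr hlog hN0
      (y := t p * (1 - c / N)) (by rw [hp1 i hi]) (by linarith) (by linarith)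
  refine ⟨?_, p, fun m hm => ?_, fun m hm => ?_, fun i m hi hm => ?_⟩
  · calc b - a ≤ 2 * (c * t (k + 1) / N) := hba
      _ ≤ 2 * (c * (1 / 2) / N) := by gcongr
      _ = c * (N : ℝ)⁻¹ := by ring
      _ ≤ _ := by gcongr; linarith
  · have hbm : t (m + 1) ≤ 2 * √(ε m / α) * Real.log N := by
      rw [ht, extParam_transitionParam]; exact min_le_right _ _
    have htm : t (k + 1) ≤ 2 ^ n * t (m + 1) := by
      have hm0 : 0 ≤ t (m + 1) := hτ.nonneg (by omega)
      rcases Nat.lt_or_ge k (m + 1) with h | h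
      · have h1 : t (k + 1) ≤ t (m + 1) := hτ.mono (by omega) (by omega)
        have h2 : (1 : ℝ) ≤ 2 ^ n := one_le_pow₀ (by norm_num)
        nlinarith
      -- All transition points from m+1 to k arise by halving, so τ_{k+1} = 2^(k-m) τ_{m+1}.
      · have hit : ∀ d, m + 1 + d ≤ k + 1 → t (m + 1 + d) = 2 ^ d * t (m + 1) := by
          intro d
          induction d with
          | zero => intro _; simp
          | succ d ih =>
            intro hd
            have h1 := hp2 (m + 1 + d) (by omega) (by omega)
            rw [ih (by omega)] at h1
            rw [← add_assoc, pow_succ]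
            linarith
        have h1 := hit (k - m) (by omega)
        rw [show (m : ℕ) + 1 + (k - m) = k + 1 by omega] at h1
        rw [h1]
        gcongr
        · norm_num
        · omega
    calc b - a ≤ 2 * (c * t (k + 1) / N) := hba
      _ ≤ 2 * (c * (2 ^ n * (2 * √(ε m / α) * Real.log N)) / N) := by
        gcongr
        exact htm.trans (by gcongr)
      _ = C₂ * √(ε m) * ((N : ℝ)⁻¹ * Real.log N) := by
        rw [hC₂, Real.sqrt_div (hε m).le]; ring
      _ ≤ _ := by
        gcongr
        linarith
  · have h := (hlayer ⟨p - 1, by omega⟩ m (by simp only; omega)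
      (Fin.le_def.2 (by simp only; omega))).2
    refine h.trans ?_
    gcongr
    linarith
  · have h := (hlayer ⟨p - 1, by omega⟩ m (by simp only; omega)
      (Fin.le_def.2 (by simp only; omega))).1
    have h1 : √(ε i) ≤ √(ε ⟨p - 1, by omega⟩) :=
      Real.sqrt_le_sqrt (hmono.monotone (Fin.le_def.2 (by simp only; omega)))
    calc √(ε i) * layerSup α (ε m) a b ≤ √(ε ⟨p - 1, by omega⟩) * layerSup α (ε m) a b := by
          have := layerSup_pos α (ε m) a b
          gcongr
      _ ≤ _ := h
      _ ≤ _ := by gcongr; linarith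

end

/-! ### The discrete operator and its comparison principle. -/

theorem secondDiff_comp (x : ℕ → ℝ) (V : ℝ → ℝ) (j : ℕ) :
    secondDiff x (fun l => V (x l)) j = diffQuot₂ V (x (j - 1)) (x j) (x (j + 1)) := rfl

theorem secondDiff_add (x V W : ℕ → ℝ) (j : ℕ) :
    secondDiff x (fun l => V l + W l) j = secondDiff x V j + secondDiff x W j := by
  unfold secondDiff forwardDiff backwardDiff; ring

theorem secondDiff_sub (x V W : ℕ → ℝ) (j : ℕ) :
    secondDiff x (fun l => V l - W l) j = secondDiff x V j - secondDiff x W j := by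
  unfold secondDiff forwardDiff backwardDiff; ring

theorem secondDiff_const (x : ℕ → ℝ) (c : ℝ) (j : ℕ) : secondDiff x (fun _ => c) j = 0 := by
  unfold secondDiff forwardDiff backwardDiff; ring

theorem secondDiff_const_mul (x V : ℕ → ℝ) (c : ℝ) (j : ℕ) :
    secondDiff x (fun l => c * V l) j = c * secondDiff x V j := by
  unfold secondDiff forwardDiff backwardDiff; ring

theorem secondDiff_sum {ι : Type*} (s : Finset ι) (x : ℕ → ℝ) (V : ι → ℕ → ℝ) (j : ℕ) :
    secondDiff x (fun l => ∑ i ∈ s, V i l) j = ∑ i ∈ s, secondDiff x (V i) j := by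
  classical
  induction s using Finset.induction_on with
  | empty => simpa using secondDiff_const x 0 j
  | insert i s hi ih =>
    simp only [Finset.sum_insert hi]
    rw [secondDiff_add, ih]

section comparison

variable {n : ℕ} {α δ M : ℝ} {A : ℝ → Matrix (Fin n) (Fin n) ℝ}
  {A' A'' : Fin n → Fin n → ℝ → ℝ} {f : ℝ → Fin n → ℝ} {f' f'' : Fin n → ℝ → ℝ}
  {g₀ g₁ : Fin n → ℝ} {ε : Fin n → ℝ} {N : ℕ} {x : ℕ → ℝ}

/-- The discrete comparison principle. -/
theorem SystemData.discrete_comparison (hD : SystemData α δ M A A' A'' f f' f'' g₀ g₁)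
    (hε : ∀ i, 0 < ε i) (hx : ∀ j < N, x j < x (j + 1)) (hmem : ∀ j ≤ N, x j ∈ Icc (0 : ℝ) 1)
    {v : ℕ → Fin n → ℝ} (h0 : ∀ i, 0 ≤ v 0 i) (hN : ∀ i, 0 ≤ v N i)
    (hL : ∀ j, 1 ≤ j → j < N → ∀ i,
      0 ≤ -(ε i * secondDiff x (fun l => v l i) j) + ∑ k, A (x j) i k * v j k) :
    ∀ j ≤ N, ∀ i, 0 ≤ v j i := by
  intro j₁ hj₁ i₁
  obtain ⟨⟨j, i⟩, hmemji, hmin⟩ := Finset.exists_min_image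
    (Finset.range (N + 1) ×ˢ (Finset.univ : Finset (Fin n))) (fun z => v z.1 z.2)
    ⟨(j₁, i₁), by simp; omega⟩
  have hmin' : ∀ l ≤ N, ∀ k, v j i ≤ v l k := fun l hl k => hmin (l, k) (by simp; omega)
  have hjN : j ≤ N := by simp at hmemji; omega
  refine le_trans ?_ (hmin' j₁ hj₁ i₁)
  by_contra! hneg
  have hj0 : j ≠ 0 := fun h => by rw [h] at hneg; linarith [h0 i]
  have hjN' : j ≠ N := fun h => by rw [h] at hneg; linarith [hN i]
  have d1 := hx (j - 1) (by omega)
  rw [Nat.sub_add_cancel (by omega)] at d1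
  have d2 := hx j (by omega)
  have e1 : 0 ≤ forwardDiff x (fun l => v l i) j :=
    div_nonneg (sub_nonneg.2 (hmin' (j + 1) (by omega) i)) (by linarith)
  have e2 : backwardDiff x (fun l => v l i) j ≤ 0 :=
    div_nonpos_of_nonpos_of_nonneg (sub_nonpos.2 (hmin' (j - 1) (by omega) i)) (by linarith)
  have e3 : 0 ≤ secondDiff x (fun l => v l i) j := div_nonneg (by linarith) (by linarith)
  have h4 := hD.row_mul_le (hmem j hjN) (i := i) (y := v j) fun k => hmin' j hjN k
  have h5 := hD.row (x j) (hmem j hjN) i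
  have h6 := mul_nonneg (hε i).le e3
  have h7 : (∑ k, A (x j) i k) * v j i < 0 :=
    mul_neg_of_pos_of_neg (by linarith [hD.alpha_pos, hD.delta_pos]) hneg
  have h8 := hL j (by omega) (by omega) i
  linarith

theorem SystemData.discrete_abs_le_of_barrier
    (hD : SystemData α δ M A A' A'' f f' f'' g₀ g₁)
    (hε : ∀ i, 0 < ε i) (hx : ∀ j < N, x j < x (j + 1)) (hmem : ∀ j ≤ N, x j ∈ Icc (0 : ℝ) 1)
    {v b : ℕ → Fin n → ℝ} (h0 : ∀ i, |v 0 i| ≤ b 0 i) (hN : ∀ i, |v N i| ≤ b N i)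
    (hL : ∀ j, 1 ≤ j → j < N → ∀ i,
      |-(ε i * secondDiff x (fun l => v l i) j) + ∑ k, A (x j) i k * v j k| ≤
        -(ε i * secondDiff x (fun l => b l i) j) + ∑ k, A (x j) i k * b j k) :
    ∀ j ≤ N, ∀ i, |v j i| ≤ b j i := by
  intro j hj i
  rw [abs_le]
  constructor
  · have := hD.discrete_comparison hε hx hmem (v := fun l k => b l k + v l k)
      (fun i => by have := (abs_le.1 (h0 i)).1; linarith)
      (fun i => by have := (abs_le.1 (hN i)).1; linarith)
      (fun j h1 h2 i => by
        have := (abs_le.1 (hL j h1 h2 i)).1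
        rw [secondDiff_add]
        simp only [mul_add, Finset.sum_add_distrib]; linarith) j hj i
    linarith
  · have := hD.discrete_comparison hε hx hmem (v := fun l k => b l k - v l k)
      (fun i => by have := (abs_le.1 (h0 i)).2; linarith)
      (fun i => by have := (abs_le.1 (hN i)).2; linarith)
      (fun j h1 h2 i => by
        have := (abs_le.1 (hL j h1 h2 i)).2
        rw [secondDiff_sub]
        simp only [mul_sub, Finset.sum_sub_distrib]; linarith) j hj i
    linarith

end comparison

/-! ### Spikes absorbing the consistency loss at transition points. -/

/-- A spike at `y₀` of width `1 / μ`. -/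
noncomputable def spike (μ y₀ y : ℝ) : ℝ := 1 / (1 + μ * |y - y₀|)

theorem spike_pos {μ y₀ y : ℝ} (hμ : 0 < μ) : 0 < spike μ y₀ y := by unfold spike; positivity

theorem spike_le_one {μ y₀ y : ℝ} (hμ : 0 < μ) : spike μ y₀ y ≤ 1 := by
  unfold spike
  rw [div_le_one (by positivity)]
  have : 0 ≤ μ * |y - y₀| := by positivity
  linarith

/-- For the reciprocal of an affine function the quotient is exactly 2μ²/(pqr), where p, q, r ≥ 1
are the denominators at the three points. -/
theorem diffQuot₂_inv_le {p q r h k : ℝ} (hp : 1 ≤ p) (hq : 1 ≤ q) (hr : 1 ≤ r) (hh : 0 < h)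
    (hk : 0 < k) {μ : ℝ} (e1 : q - p = μ * h) (e2 : r - q = μ * k) :
    ((1 / r - 1 / q) / k - (1 / q - 1 / p) / h) / ((h + k) / 2) ≤ 2 * μ ^ 2 := by
  have hp0 : 0 < p := by linarith
  have hq0 : 0 < q := by linarith
  have hr0 : 0 < r := by linarith
  have f1 : (1 / r - 1 / q) / k = -μ / (q * r) := by
    rw [div_sub_div _ _ hr0.ne' hq0.ne', div_div, div_eq_div_iff (by positivity) (by positivity)]
    have : q = r - μ * k := by linarith
    rw [this]; ring
  have f2 : (1 / q - 1 / p) / h = -μ / (p * q) := by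
    rw [div_sub_div _ _ hq0.ne' hp0.ne', div_div, div_eq_div_iff (by positivity) (by positivity)]
    have : p = q - μ * h := by linarith
    rw [this]; ring
  have f3 : -μ / (q * r) - -μ / (p * q) = μ ^ 2 * (h + k) / (p * q * r) := by
    rw [div_sub_div _ _ (by positivity) (by positivity),
      div_eq_div_iff (by positivity) (by positivity)]
    have : μ ^ 2 * (h + k) = μ * (r - p) := by rw [show r - p = μ * h + μ * k by linarith]; ring
    rw [this]; ring
  rw [f1, f2, f3]
  have h1 : 1 ≤ p * q * r := one_le_mul_of_one_le_of_one_le (one_le_mul_of_one_le_of_one_le hp hq) hr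
  rw [div_le_iff₀ (by positivity), div_le_iff₀ (by positivity)]
  have h2 : 0 ≤ μ ^ 2 * (h + k) := by positivity
  nlinarith

theorem diffQuot₂_spike_le {μ y₀ a c b : ℝ} (hμ : 0 < μ) (hac : a < c) (hcb : c < b)
    (hy : y₀ ≤ a ∨ b ≤ y₀) : diffQuot₂ (spike μ y₀) a c b ≤ 2 * μ ^ 2 := by
  have hge : ∀ y, 1 ≤ 1 + μ * |y - y₀| := fun y => by
    have : 0 ≤ μ * |y - y₀| := by positivity
    linarith
  have hh : 0 < c - a := sub_pos.2 hac
  have hk : 0 < b - c := sub_pos.2 hcb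
  rcases hy with hy | hy
  · have e1 : (1 + μ * |c - y₀|) - (1 + μ * |a - y₀|) = μ * (c - a) := by
      rw [abs_of_nonneg (by linarith), abs_of_nonneg (by linarith)]; ring
    have e2 : (1 + μ * |b - y₀|) - (1 + μ * |c - y₀|) = μ * (b - c) := by
      rw [abs_of_nonneg (by linarith), abs_of_nonneg (by linarith)]; ring
    exact diffQuot₂_inv_le (hge a) (hge c) (hge b) hh hk e1 e2
  · have e1 : (1 + μ * |c - y₀|) - (1 + μ * |a - y₀|) = -μ * (c - a) := by
      rw [abs_of_nonpos (by linarith), abs_of_nonpos (by linarith)]; ring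
    have e2 : (1 + μ * |b - y₀|) - (1 + μ * |c - y₀|) = -μ * (b - c) := by
      rw [abs_of_nonpos (by linarith), abs_of_nonpos (by linarith)]; ring
    have := diffQuot₂_inv_le (hge a) (hge c) (hge b) hh hk e1 e2
    rw [neg_sq] at this
    exact this

/-- With H = b - a, both one-sided slopes at the peak have modulus at least μ/(1 + μH). Hence the
left side is at most -4X²/(1+X) for X = √e/H, and 4X² ≥ (2X - 2)(1 + X) finishes. The term -2X is
the gain exploited in the stability bound. -/
theorem mul_diffQuot₂_spike_le {e y₀ a b : ℝ} (he : 0 < e) (hac : a < y₀) (hcb : y₀ < b) :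
    e * diffQuot₂ (spike (√e)⁻¹ y₀) a y₀ b ≤ 2 - 2 * (√e / (b - a)) := by
  have hs : 0 < √e := Real.sqrt_pos.2 he
  set H := b - a with hH
  have hH0 : 0 < H := by linarith
  set μ := (√e)⁻¹ with hμ
  have hμ0 : 0 < μ := inv_pos.2 hs
  have hslope : ∀ h, 0 < h → h ≤ H → μ / (1 + μ * H) ≤ (1 - 1 / (1 + μ * h)) / h := by
    intro h hh hhH
    have : (1 - 1 / (1 + μ * h)) / h = μ / (1 + μ * h) := by
      have : 1 + μ * h ≠ 0 := by positivity
      field_simp; ring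
    rw [this]
    gcongr
  have h1 := hslope (y₀ - a) (by linarith) (by linarith)
  have h2 := hslope (b - y₀) (by linarith) (by linarith)
  have h3 : diffQuot₂ (spike μ y₀) a y₀ b ≤ -(2 * (μ / (1 + μ * H))) / (H / 2) := by
    unfold diffQuot₂ spike
    rw [sub_self, abs_zero, mul_zero, add_zero, div_one, abs_of_pos (by linarith : 0 < b - y₀),
      abs_of_neg (by linarith : a - y₀ < 0), neg_sub, show y₀ - a + (b - y₀) = H by rw [hH]; ring]
    have : (1 / (1 + μ * (b - y₀)) - 1) / (b - y₀) = -((1 - 1 / (1 + μ * (b - y₀))) / (b - y₀)) := by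
      ring
    rw [this]
    gcongr
    linarith
  have h4 := mul_le_mul_of_nonneg_left h3 he.le
  refine h4.trans ?_
  set X := √e / H with hX
  have hX0 : 0 < X := by positivity
  have hee : e = √e * √e := (Real.mul_self_sqrt he.le).symm
  have h5 : e * (-(2 * (μ / (1 + μ * H))) / (H / 2)) = -(4 * X ^ 2 / (1 + X)) := by
    rw [hX, hμ]
    nth_rewrite 1 [hee]
    field_simp
    ring
  rw [h5, neg_le, neg_sub, le_div_iff₀ (by positivity)]
  nlinarith

/-! ### Consistency on the mesh. -/

section consistency

variable {n : ℕ} {α K C e a b l : ℝ} {ε : Fin n → ℝ} {V V' q q' q'' : ℝ → ℝ} {p : ℕ} {N : ℝ}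

/-- Consistency at equidistant points, in terms of the resolution of the mesh. -/
theorem ReactionBound.consistency_uniform (hα : 0 < α) (hε : ∀ i, 0 < ε i)
    (hq : ReactionBound α K e ε q q' q'') (hK0 : 0 ≤ K) (hVc : ContinuousOn V (Icc 0 1))
    (hV : TwiceDeriv V V' q) {c : ℝ} (hac : a < c) (heq : c - a = b - c) (ha : 0 ≤ a)
    (hb : b ≤ 1) (hl : 1 ≤ l) (hC : 0 ≤ C) (hN : 0 < N) (hNb : b - a ≤ C * N⁻¹)
    (hres : ∀ m : Fin n, p ≤ m → b - a ≤ C * √(ε m) * (N⁻¹ * l))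
    (hneg : ∀ m : Fin n, (m : ℕ) < p → layerSup α (ε m) a b ≤ C * N⁻¹ ^ 2) :
    |diffQuot₂ V a c b - q c| ≤
      K * (2 + 2 / α) * ((n + 1) * (C ^ 2 + C)) * (N⁻¹ * l) ^ 2 := by
  have hNi : 0 < N⁻¹ := inv_pos.2 hN
  set h := c - a with hh
  have hh0 : 0 < h := sub_pos.2 hac
  have e1 : a = c - h := by rw [hh]; ring
  have e2 : b = c + h := by rw [heq]; ring
  have hH : b - a = 2 * h := by rw [e1, e2]; ring
  have hNl : N⁻¹ ≤ N⁻¹ * l := le_mul_of_one_le_right hNi.le hl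
  have hT : N⁻¹ ^ 2 ≤ (N⁻¹ * l) ^ 2 := by gcongr
  have key := hq.consistency_of_equidistant hα hε hK0 hVc hV hh0 (by rw [← e1]; exact ha)
    (by rw [← e2]; exact hb)
  rw [← e1, ← e2] at key
  refine key.trans ?_
  rw [mul_assoc (K * (2 + 2 / α))]
  have h2α : 0 ≤ 2 / α := by positivity
  refine mul_le_mul_of_nonneg_left ?_ (by positivity)
  have hsq : h ^ 2 ≤ (C ^ 2 + C) * (N⁻¹ * l) ^ 2 := by
    have h1 : h ≤ C * (N⁻¹ * l) := by
      have : C * N⁻¹ ≤ C * (N⁻¹ * l) := by gcongr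
      linarith
    calc h ^ 2 ≤ (C * (N⁻¹ * l)) ^ 2 := by gcongr
      _ ≤ _ := by nlinarith [mul_nonneg hC (sq_nonneg (N⁻¹ * l))]
  have hsum : ∑ m, min (layerSup α (ε m) a b) (h ^ 2 / ε m) ≤
      ∑ _m : Fin n, (C ^ 2 + C) * (N⁻¹ * l) ^ 2 := by
    refine Finset.sum_le_sum fun m _ => ?_
    rcases Nat.lt_or_ge m p with hm | hm
    · refine (min_le_left _ _).trans ((hneg m hm).trans ?_)
      calc C * N⁻¹ ^ 2 ≤ C * (N⁻¹ * l) ^ 2 := by gcongr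
        _ ≤ _ := by nlinarith [mul_nonneg (sq_nonneg C) (sq_nonneg (N⁻¹ * l))]
    · refine (min_le_right _ _).trans ?_
      have hεm := hε m
      rw [div_le_iff₀ hεm]
      have h1 : h ≤ C * √(ε m) * (N⁻¹ * l) := by linarith [hres m hm]
      calc h ^ 2 ≤ (C * √(ε m) * (N⁻¹ * l)) ^ 2 := by gcongr
        _ = C ^ 2 * (N⁻¹ * l) ^ 2 * ε m := by
          rw [mul_pow, mul_pow, Real.sq_sqrt hεm.le]; ring
        _ ≤ (C ^ 2 + C) * (N⁻¹ * l) ^ 2 * ε m := by gcongr; linarith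
  simp only [Finset.sum_const, Finset.card_univ, Fintype.card_fin, nsmul_eq_mul] at hsum
  linarith

/-- Consistency at arbitrary points, in terms of the resolution of the mesh. -/
theorem ReactionBound.consistency_general (hα : 0 < α) (hε : ∀ i, 0 < ε i)
    {i : Fin n} (hq : ReactionBound α K (ε i) ε q q' q'') (hK0 : 0 ≤ K)
    (hVc : ContinuousOn V (Icc 0 1)) (hV : TwiceDeriv V V' q) {c : ℝ} (hac : a < c)
    (hcb : c < b) (ha : 0 ≤ a) (hb : b ≤ 1) (hl : 1 ≤ l) (hC : 0 ≤ C) (hN : 0 < N)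
    (hNb : b - a ≤ C * N⁻¹)
    (hres : ∀ m : Fin n, p ≤ m → b - a ≤ C * √(ε m) * (N⁻¹ * l))
    (hneg : ∀ m : Fin n, (m : ℕ) < p → layerSup α (ε m) a b ≤ C * N⁻¹ ^ 2)
    (hneg' : ∀ i m : Fin n, (i : ℕ) < p → (m : ℕ) < p →
      √(ε i) * layerSup α (ε m) a b ≤ √(ε m) * (C * N⁻¹ ^ 2)) :
    |diffQuot₂ V a c b - q c| ≤ K * (2 + 2 / √α) * ((n + 1) * (C ^ 2 + C)) *
      ((N⁻¹ * l) ^ 2 * (1 + √(ε i) / (b - a))) := by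
  have hNi : 0 < N⁻¹ := inv_pos.2 hN
  have hNl : N⁻¹ ≤ N⁻¹ * l := le_mul_of_one_le_right hNi.le hl
  have hT : N⁻¹ ^ 2 ≤ (N⁻¹ * l) ^ 2 := by gcongr
  set T := (N⁻¹ * l) ^ 2 with hTdef
  have hT0 : 0 ≤ T := sq_nonneg _
  set H := b - a with hH
  have hH0 : 0 < H := by linarith
  have hs : ∀ m, 0 < √(ε m) := fun m => Real.sqrt_pos.2 (hε m)
  set X := √(ε i) / H with hX
  have hX0 : 0 ≤ X := div_nonneg (hs i).le hH0.le
  have hHX : H * X = √(ε i) := by rw [hX]; field_simp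
  have hHNl : H ≤ C * (N⁻¹ * l) := hNb.trans (by gcongr)
  have hHT : H ^ 2 ≤ C ^ 2 * T := by
    calc H ^ 2 ≤ (C * (N⁻¹ * l)) ^ 2 := by gcongr
      _ = _ := by rw [hTdef]; ring
  have hCT : C * N⁻¹ ^ 2 ≤ (C ^ 2 + C) * (T * (1 + X)) := by
    calc C * N⁻¹ ^ 2 ≤ C * T := by gcongr
      _ ≤ (C ^ 2 + C) * (T * (1 + X)) := by
        apply mul_le_mul (by nlinarith [sq_nonneg C]) (by nlinarith [mul_nonneg hT0 hX0]) hT0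
        positivity
  have hCX : C ^ 2 * T * X ≤ (C ^ 2 + C) * (T * (1 + X)) := by
    have h1 : C ^ 2 * (T * X) ≤ (C ^ 2 + C) * (T * (1 + X)) := by
      apply mul_le_mul (by linarith) (by nlinarith) (by positivity) (by positivity)
    linarith
  -- Common end of both cases: the scale s is √ε_i if component i is not resolved (i < p) and 1 if
  -- it is.
  have hfin : ∀ {L s : ℝ} {g : Fin n → ℝ}, |diffQuot₂ V a c b - q c| ≤
      L * (2 + 2 / √α) * (H + ∑ m, g m) → L = K * s → 0 ≤ s →
      s * H ≤ (C ^ 2 + C) * (T * (1 + X)) → (∀ m, s * g m ≤ (C ^ 2 + C) * (T * (1 + X))) →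
      |diffQuot₂ V a c b - q c| ≤ K * (2 + 2 / √α) * ((n + 1) * (C ^ 2 + C)) * (T * (1 + X)) := by
    intro L s g h1 hL hs0 h2 h3
    refine h1.trans ?_
    have h4 : s * ∑ m, g m ≤ n * ((C ^ 2 + C) * (T * (1 + X))) := by
      rw [Finset.mul_sum]
      refine (Finset.sum_le_sum fun m _ => h3 m).trans (le_of_eq ?_)
      simp
    have h5 : 0 ≤ 2 / √α := by positivity
    have h6 : L * (2 + 2 / √α) * (H + ∑ m, g m) =
      K * (2 + 2 / √α) * (s * H + s * ∑ m, g m) := by rw [hL]; ring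
    have h7 : K * (2 + 2 / √α) * ((n + 1) * (C ^ 2 + C)) * (T * (1 + X)) =
      K * (2 + 2 / √α) * ((C ^ 2 + C) * (T * (1 + X)) + n * ((C ^ 2 + C) * (T * (1 + X)))) := by
      ring
    rw [h6, h7]
    exact mul_le_mul_of_nonneg_left (add_le_add h2 h4) (by positivity)
  rcases Nat.lt_or_ge i p with hi | hi
  -- Unresolved component: the factor √ε_i = H·X supplies both the second power of H and the factor
  -- X.
  · have hfs : ∀ x ∈ Ioo (0 : ℝ) 1, |q' x| ≤ (K * √(ε i)) *
        (1 + ∑ m, (√(ε m))⁻¹ * (layer α (ε m) x / √(ε m))) := by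
      intro x hx
      refine (hq.first_sqrt x hx).trans (le_of_eq ?_)
      unfold layerWeight
      congr 2
      refine Finset.sum_congr rfl fun m _ => ?_
      rw [inv_mul_eq_div, div_div, Real.mul_self_sqrt (hε m).le]
    have key := abs_consistency_le hα hε (fun m => (inv_pos.2 (hs m)).le)
      (mul_nonneg hK0 (hs i).le) hq.cont hq.twiceDeriv hfs hVc hV hac hcb ha hb
    refine hfin key rfl (hs i).le ?_ fun m => ?_
    · rw [← hHX]
      calc H * X * H = H ^ 2 * X := by ring
        _ ≤ C ^ 2 * T * X := by gcongr
        _ ≤ _ := hCX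
    · have hinv : 0 ≤ (√(ε m))⁻¹ := (inv_pos.2 (hs m)).le
      rcases Nat.lt_or_ge m p with hm | hm
      · calc √(ε i) * ((√(ε m))⁻¹ * min (layerSup α (ε m) a b) (H / √(ε m)))
            ≤ √(ε i) * ((√(ε m))⁻¹ * layerSup α (ε m) a b) := by
              have := (hs i).le
              gcongr
              exact min_le_left _ _
          _ = (√(ε m))⁻¹ * (√(ε i) * layerSup α (ε m) a b) := by ring
          _ ≤ (√(ε m))⁻¹ * (√(ε m) * (C * N⁻¹ ^ 2)) := by
              exact mul_le_mul_of_nonneg_left (hneg' i m hi hm) hinv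
          _ = C * N⁻¹ ^ 2 := inv_mul_cancel_left₀ (hs m).ne' _
          _ ≤ _ := hCT
      · have h1 : H / √(ε m) ≤ C * (N⁻¹ * l) := by
          rw [div_le_iff₀ (hs m)]; linarith [hres m hm]
        calc √(ε i) * ((√(ε m))⁻¹ * min (layerSup α (ε m) a b) (H / √(ε m)))
            ≤ √(ε i) * ((√(ε m))⁻¹ * (H / √(ε m))) := by
              have := (hs i).le
              gcongr
              exact min_le_right _ _
          _ = (H / √(ε m)) ^ 2 * X := by rw [← hHX]; ring
          _ ≤ (C * (N⁻¹ * l)) ^ 2 * X := by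
              have : 0 ≤ H / √(ε m) := div_nonneg hH0.le (hs m).le
              gcongr
          _ = C ^ 2 * T * X := by rw [hTdef]; ring
          _ ≤ _ := hCX
  -- Resolved component: (H/√ε_i)·X = 1 and H/√ε_i is itself O(N⁻¹ ln N), so inserting this product
  -- supplies the missing order.
  · have hfs : ∀ x ∈ Ioo (0 : ℝ) 1, |q' x| ≤ K *
        (1 + ∑ m, 1 * (layer α (ε m) x / √(ε m))) := by
      intro x hx
      simpa using hq.first x hx
    have key := abs_consistency_le hα hε (fun m => zero_le_one)
      hK0 hq.cont hq.twiceDeriv hfs hVc hV hac hcb ha hb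
    have h0 : H / √(ε i) ≤ C * (N⁻¹ * l) := by
      rw [div_le_iff₀ (hs i)]; linarith [hres i hi]
    have h0' : 0 ≤ H / √(ε i) := div_nonneg hH0.le (hs i).le
    have hXc : H / √(ε i) * X = 1 := by rw [hX]; have := (hs i).ne'; field_simp
    refine hfin key (mul_one K).symm zero_le_one ?_ fun m => ?_
    · rw [one_mul]
      calc H = (H * (H / √(ε i))) * X := by rw [mul_assoc, hXc, mul_one]
        _ ≤ ((C * (N⁻¹ * l)) * (C * (N⁻¹ * l))) * X := by gcongr
        _ = C ^ 2 * T * X := by rw [hTdef]; ring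
        _ ≤ _ := hCX
    · rw [one_mul, one_mul]
      rcases Nat.lt_or_ge m p with hm | hm
      · exact (min_le_left _ _).trans ((hneg m hm).trans hCT)
      · refine (min_le_right _ _).trans ?_
        have h1 : H / √(ε m) ≤ C * (N⁻¹ * l) := by
          rw [div_le_iff₀ (hs m)]; linarith [hres m hm]
        have h2 : 0 ≤ H / √(ε m) := div_nonneg hH0.le (hs m).le
        calc H / √(ε m) = (H / √(ε m) * (H / √(ε i))) * X := by rw [mul_assoc, hXc, mul_one]
          _ ≤ ((C * (N⁻¹ * l)) * (C * (N⁻¹ * l))) * X := by gcongr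
          _ = C ^ 2 * T * X := by rw [hTdef]; ring
          _ ≤ _ := hCX

end consistency

/-! ### Stability with exceptional mesh points. -/

section stability

variable {n : ℕ} {α δ M : ℝ} {A : ℝ → Matrix (Fin n) (Fin n) ℝ}
  {A' A'' : Fin n → Fin n → ℝ → ℝ} {f : ℝ → Fin n → ℝ} {f' f'' : Fin n → ℝ → ℝ}
  {g₀ g₁ : Fin n → ℝ} {ε : Fin n → ℝ} {N : ℕ} {x : ℕ → ℝ}

/-- Stability of the discrete operator: at finitely many mesh points the residual may be larger
by the factor `√ε_i / (x_{j+1} - x_{j-1})`. -/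
theorem SystemData.discrete_stability (hD : SystemData α δ M A A' A'' f f' f'' g₀ g₁)
    (hε : ∀ i, 0 < ε i) (hx : ∀ j < N, x j < x (j + 1)) (hmem : ∀ j ≤ N, x j ∈ Icc (0 : ℝ) 1)
    (hmono : ∀ i j, i ≤ j → j ≤ N → x i ≤ x j) (J : ℕ → ℕ) (S : ℕ)
    (hJ : ∀ s < S, J s ≤ N) {v : ℕ → Fin n → ℝ} {R : ℝ} (hR : 0 ≤ R) (h0 : v 0 = 0)
    (hN : v N = 0)
    (hreg : ∀ j, 1 ≤ j → j < N → (∀ s < S, j ≠ J s) → ∀ i,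
      |-(ε i * secondDiff x (fun l => v l i) j) + ∑ k, A (x j) i k * v j k| ≤ R)
    (hsing : ∀ j, 1 ≤ j → j < N → ∀ i,
      |-(ε i * secondDiff x (fun l => v l i) j) + ∑ k, A (x j) i k * v j k| ≤
        R * (1 + √(ε i) / (x (j + 1) - x (j - 1)))) :
    ∀ j ≤ N, ∀ i, |v j i| ≤ R * ((1 + S * (2 + n * M)) / α + S) := by
  have hα := hD.alpha_pos
  have hM : 0 ≤ M := by linarith [hD.one_le]
  set μ : Fin n → ℝ := fun i => (√(ε i))⁻¹ with hμ
  have hμ0 : ∀ i, 0 < μ i := fun i => inv_pos.2 (Real.sqrt_pos.2 (hε i))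
  -- The constant part of the barrier: ακ pays for the residual R, for at most 2 per spike from the
  -- diffusion term, and for the coupling, at most nM per spike.
  set κ := R * ((1 + S * (2 + n * M)) / α) with hκ
  have hκ0 : 0 ≤ κ := by positivity
  set ψ : Fin n → ℕ → ℝ := fun i l => ∑ s ∈ Finset.range S, spike (μ i) (x (J s)) (x l) with hψ
  have hψ0 : ∀ i l, 0 ≤ ψ i l := fun i l => Finset.sum_nonneg fun s _ => (spike_pos (hμ0 i)).le
  have hψS : ∀ i l, ψ i l ≤ S := fun i l => by
    have : ψ i l ≤ ∑ _s ∈ Finset.range S, (1 : ℝ) :=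
      Finset.sum_le_sum fun s _ => spike_le_one (hμ0 i)
    simpa using this
  have hbound := hD.discrete_abs_le_of_barrier hε hx hmem (v := v)
    (b := fun l i => κ + R * ψ i l)
    (fun i => by rw [h0]; have := hψ0 i 0; simp only [Pi.zero_apply, abs_zero]; positivity)
    (fun i => by rw [hN]; have := hψ0 i N; simp only [Pi.zero_apply, abs_zero]; positivity)
    (fun j hj1 hjN i => ?_)
  · intro j hj i
    refine (hbound j hj i).trans ?_
    rw [mul_add]
    have := hψS i j
    gcongr
  have hd1 := hx (j - 1) (by omega)
  rw [Nat.sub_add_cancel hj1] at hd1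
  have hd2 := hx j hjN
  have hεi := hε i
  have hsi : 0 < √(ε i) := Real.sqrt_pos.2 hεi
  have hμsq : ε i * (2 * μ i ^ 2) = 2 := by
    rw [hμ]; simp only [inv_pow]; rw [Real.sq_sqrt hεi.le]; field_simp
  set X := √(ε i) / (x (j + 1) - x (j - 1)) with hX
  have hX0 : 0 ≤ X := div_nonneg hsi.le (by linarith)
  have hspike : ∀ s < S, ε i * secondDiff x (fun l => spike (μ i) (x (J s)) (x l)) j ≤
      if j = J s then 2 - 2 * X else 2 := by
    intro s hs
    rw [secondDiff_comp]
    split_ifs with hjs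
    · rw [← hjs]
      exact mul_diffQuot₂_spike_le hεi hd1 hd2
    · rw [← hμsq]
      refine mul_le_mul_of_nonneg_left (diffQuot₂_spike_le (hμ0 i) hd1 hd2 ?_) hεi.le
      rcases Nat.lt_or_ge (J s) j with h | h
      · exact Or.inl (hmono _ _ (by omega) (by omega))
      · exact Or.inr (hmono _ _ (by omega) (hJ s hs))
  have hsd : secondDiff x (fun l => κ + R * ψ i l) j =
      R * ∑ s ∈ Finset.range S, secondDiff x (fun l => spike (μ i) (x (J s)) (x l)) j := by
    rw [secondDiff_add x (fun _ => κ) (fun l => R * ψ i l), secondDiff_const, zero_add,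
      secondDiff_const_mul, secondDiff_sum]
  have hrow : α * κ - R * (n * (M * S)) ≤ ∑ k, A (x j) i k * (κ + R * ψ k j) := by
    have h1 : ∑ k, A (x j) i k * (κ + R * ψ k j) =
        (∑ k, A (x j) i k) * κ + R * ∑ k, A (x j) i k * ψ k j := by
      rw [Finset.sum_mul, Finset.mul_sum, ← Finset.sum_add_distrib]
      exact Finset.sum_congr rfl fun k _ => by ring
    have h2 := abs_sum_mul_le (fun k => (hD.boundA (x j) (hmem j hjN.le) i k).1)
      (fun k => (abs_of_nonneg (hψ0 k j)).le.trans (hψS k j))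
    have h3 := (abs_le.1 h2).1
    have h4 := hD.row (x j) (hmem j hjN.le) i
    have h5 : α * κ ≤ (∑ k, A (x j) i k) * κ :=
      mul_le_mul_of_nonneg_right (by linarith [hD.delta_pos]) hκ0
    have h6 := mul_le_mul_of_nonneg_left h3 hR
    rw [h1]; linarith
  have hακ : α * κ = R * (1 + S * (2 + n * M)) := by rw [hκ]; field_simp
  rw [hsd]
  have hsum : ε i * ∑ s ∈ Finset.range S,
      secondDiff x (fun l => spike (μ i) (x (J s)) (x l)) j ≤
      ∑ s ∈ Finset.range S, if j = J s then 2 - 2 * X else 2 := by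
    rw [Finset.mul_sum]
    exact Finset.sum_le_sum fun s hs => hspike s (Finset.mem_range.1 hs)
  by_cases hjJ : ∀ s < S, j ≠ J s
  · have h1 : ∑ s ∈ Finset.range S, (if j = J s then 2 - 2 * X else 2) = S * 2 := by
      rw [Finset.sum_congr rfl fun s hs => if_neg (hjJ s (Finset.mem_range.1 hs))]
      simp
    rw [h1] at hsum
    have h2 := mul_le_mul_of_nonneg_left hsum hR
    have h3 := hreg j hj1 hjN hjJ i
    linarith
  · push Not at hjJ
    obtain ⟨s₀, hs₀, hjs₀⟩ := hjJ
    -- Several indices may name the same mesh point. The gain 2X of one of them is enough, since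
    -- only X is needed.
    have h1 : ∑ s ∈ Finset.range S, (if j = J s then 2 - 2 * X else 2) ≤
        ∑ s ∈ Finset.range S, (2 - if s = s₀ then 2 * X else 0) := by
      refine Finset.sum_le_sum fun s _ => ?_
      split_ifs with c1 c2 c2
      · exact le_rfl
      · linarith
      · exact absurd (c2 ▸ hjs₀) c1
      · linarith
    rw [Finset.sum_sub_distrib, Finset.sum_ite_eq', if_pos (Finset.mem_range.2 hs₀)] at h1
    simp only [Finset.sum_const, Finset.card_range, nsmul_eq_mul] at h1
    have h2 := mul_le_mul_of_nonneg_left (hsum.trans h1) hR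
    have h3 := hsing j hj1 hjN i
    have h4 := mul_nonneg hR hX0
    linarith

end stability

/-! ### Error equation and conclusion. -/

theorem IsExactSolution.twiceDeriv_mul {n : ℕ} {A : ℝ → Matrix (Fin n) (Fin n) ℝ}
    {f : ℝ → Fin n → ℝ} {g₀ g₁ : Fin n → ℝ} {ε : Fin n → ℝ} {u : ℝ → Fin n → ℝ}
    (hu : IsExactSolution ε A f g₀ g₁ u) (hε : ∀ i, 0 < ε i) (i : Fin n) :
    TwiceDeriv (fun x => ε i * u x i) (fun x => ε i * deriv (fun x => u x i) x)
      (reaction A f u i) := by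
  have h := (hu.twiceDeriv hε i).const_mul (ε i)
  simp only [mul_inv_cancel_left₀ (hε i).ne'] at h
  exact h

/-- The error of the discrete solution satisfies the discrete equations with the consistency error
as right-hand side. -/
theorem discrete_error_equation {n : ℕ} {A : ℝ → Matrix (Fin n) (Fin n) ℝ}
    {f : ℝ → Fin n → ℝ} {g₀ g₁ : Fin n → ℝ} {ε : Fin n → ℝ} {u : ℝ → Fin n → ℝ} {N : ℕ}
    {x : ℕ → ℝ} {U : ℕ → Fin n → ℝ} (hU : IsDiscreteSolution ε A f g₀ g₁ N x U) {j : ℕ}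
    (hj : 1 ≤ j) (hjN : j < N) (i : Fin n) :
    -(ε i * secondDiff x (fun l => U l i - u (x l) i) j) +
      ∑ k, A (x j) i k * (U j k - u (x j) k) =
      diffQuot₂ (fun y => ε i * u y i) (x (j - 1)) (x j) (x (j + 1)) -
        reaction A f u i (x j) := by
  have h1 := hU.equation j hj hjN i
  have h2 : diffQuot₂ (fun y => ε i * u y i) (x (j - 1)) (x j) (x (j + 1)) =
      ε i * secondDiff x (fun l => u (x l) i) j := by
    rw [← secondDiff_comp, secondDiff_const_mul x (fun l => u (x l) i)]
  rw [h2, secondDiff_sub x (fun l => U l i) (fun l => u (x l) i), reaction]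
  simp only [mul_sub, Finset.sum_sub_distrib]
  linarith

theorem mainTheorem2 (n : ℕ) (hn : 1 ≤ n) (α : ℝ) (hα : 0 < α)
    (A : ℝ → Matrix (Fin n) (Fin n) ℝ) (f : ℝ → Fin n → ℝ) (g₀ g₁ : Fin n → ℝ)
    (hA : ∀ i k, ContDiffOn ℝ 2 (fun x => A x i k) (Icc 0 1))
    (hf : ∀ i, ContDiffOn ℝ 2 (fun x => f x i) (Icc 0 1))
    (hdom : ∀ x ∈ Icc (0 : ℝ) 1, ∀ i, ∑ k ∈ Finset.univ.erase i, |A x i k| < A x i i)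
    (hoff : ∀ x ∈ Icc (0 : ℝ) 1, ∀ i k, i ≠ k → A x i k ≤ 0)
    (hrow : ∀ x ∈ Icc (0 : ℝ) 1, ∀ i, α < ∑ k, A x i k) :
    ∃ C : ℝ, 0 < C ∧
      ∀ ε : Fin n → ℝ, StrictMono ε → (∀ i, 0 < ε i) → (∀ i, ε i ≤ 1) →
        (∀ i, √(ε i) ≤ √α / 4) →
      ∀ N : ℕ, 1 < N → 2 ^ (n + 1) ∣ N →
      ∀ (u : ℝ → Fin n → ℝ) (U : ℕ → Fin n → ℝ),
        IsExactSolution ε A f g₀ g₁ u →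
        IsDiscreteSolution ε A f g₀ g₁ N (meshPoint (transitionParam ε α N) N) U →
        ∀ j ≤ N, ‖U j - u (meshPoint (transitionParam ε α N) N j)‖
          ≤ C * ((N : ℝ)⁻¹ * Real.log N) ^ 2 := by
  obtain ⟨δ, M, A', A'', f', f'', hD⟩ := exists_systemData hα g₀ g₁ hA hf hoff hrow
  obtain ⟨K, hK, hreact⟩ := hD.exists_reactionBound
  obtain ⟨Cm, hCm, hmesh⟩ := exists_mesh_resolution n hn hα
  have hM : 0 ≤ M := by linarith [hD.one_le]
  obtain ⟨R₀, hR₀⟩ : ∃ R₀, R₀ = K * (2 + 2 / α) * ((n + 1) * (Cm ^ 2 + Cm)) +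
    K * (2 + 2 / √α) * ((n + 1) * (Cm ^ 2 + Cm)) := ⟨_, rfl⟩
  have hR₀1 : K * (2 + 2 / α) * ((n + 1) * (Cm ^ 2 + Cm)) ≤ R₀ := by
    have : 0 ≤ K * (2 + 2 / √α) * ((n + 1) * (Cm ^ 2 + Cm)) := by positivity
    linarith
  have hR₀2 : K * (2 + 2 / √α) * ((n + 1) * (Cm ^ 2 + Cm)) ≤ R₀ := by
    have : 0 ≤ K * (2 + 2 / α) * ((n + 1) * (Cm ^ 2 + Cm)) := by positivity
    linarith
  have hR₀0 : 0 ≤ R₀ := le_trans (by positivity) hR₀1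
  obtain ⟨Q, hQ⟩ : ∃ Q : ℝ, Q = (1 + (2 * n + 1 : ℕ) * (2 + n * M)) / α + (2 * n + 1 : ℕ) :=
    ⟨_, rfl⟩
  have hQ0 : 0 ≤ Q := by rw [hQ]; positivity
  have hlog2 : 0 < Real.log 2 := Real.log_pos (by norm_num)
  -- A positive lower bound of (N⁻¹ ln N)² over 2 ≤ N ≤ 2^(n+3), turning a bounded error into one of
  -- the desired form.
  obtain ⟨T₀, hT₀⟩ : ∃ T₀ : ℝ, T₀ = ((2 ^ (n + 3))⁻¹ * Real.log 2) ^ 2 := ⟨_, rfl⟩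
  have hT₀0 : 0 < T₀ := by rw [hT₀]; positivity
  refine ⟨R₀ * Q + 2 * K / α / T₀ + 1, by positivity,
    fun ε hmono hε hε1 _ N hN hdvd u U hu hU j hj => ?_⟩
  have hN0 : 0 < N := by omega
  have hNr : (0 : ℝ) < N := by exact_mod_cast hN0
  have hτ := isTransition_transitionParam hα hε hN
  set x := meshPoint (transitionParam ε α N) N with hx
  set T := ((N : ℝ)⁻¹ * Real.log N) ^ 2 with hT
  have hT0 : 0 ≤ T := sq_nonneg _
  have hxlt : ∀ j < N, x j < x (j + 1) := fun j hj => meshPoint_lt_succ hτ hn hdvd hj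
  have hxmem : ∀ j ≤ N, x j ∈ Icc (0 : ℝ) 1 := fun j hj => meshPoint_mem hτ hn hdvd hN0 hj
  have hxmono : ∀ i j, i ≤ j → j ≤ N → x i ≤ x j := fun i j hij hj =>
    meshPoint_mono hτ hn hdvd hij hj
  have hx0 : x 0 = 0 := meshPoint_zero
  have hxN : x N = 1 := meshPoint_last hτ hn hdvd hN0
  have hcomp : ∀ i, |U j i - u (x j) i| ≤ (R₀ * Q + 2 * K / α / T₀ + 1) * T := by
    intro i
    have e0 : (fun i => U 0 i - u (x 0) i) = 0 := by
      ext i; simp [hx0, hU.left_value, hu.left_value]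
    have eN : (fun i => U N i - u (x N) i) = 0 := by
      ext i; simp [hxN, hU.right_value, hu.right_value]
    have hVc : ∀ i, ContinuousOn (fun y => ε i * u y i) (Icc 0 1) := fun i =>
      continuousOn_const.mul (hu.continuousOn_apply i)
    have hpt : ∀ j, 1 ≤ j → j < N → x (j - 1) < x j ∧ x j < x (j + 1) ∧ 0 ≤ x (j - 1) ∧
        x (j + 1) ≤ 1 := fun j h1 h2 => by
      have d1 := hxlt (j - 1) (by omega)
      rw [Nat.sub_add_cancel h1] at d1
      exact ⟨d1, hxlt j h2, (hxmem (j - 1) (by omega)).1, (hxmem (j + 1) (by omega)).2⟩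
    -- Few mesh points: |q| ≤ K bounds the consistency error by 2K, and stability is applied without
    -- exceptional points.
    rcases Nat.lt_or_ge N (2 ^ (n + 3)) with hsmall | hlarge
    · have hcons : ∀ j, 1 ≤ j → j < N → ∀ i,
          |-(ε i * secondDiff x (fun l => U l i - u (x l) i) j) +
            ∑ k, A (x j) i k * (U j k - u (x j) k)| ≤ 2 * K := by
        intro j h1 h2 i
        obtain ⟨q', q'', hq⟩ := hreact ε hmono hε hε1 u hu i
        obtain ⟨d1, d2, d3, d4⟩ := hpt j h1 h2
        rw [discrete_error_equation hU h1 h2 i]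
        refine abs_diffQuot₂_sub_le d1 d2
          ((hVc i).mono fun z hz => ⟨by linarith [hz.1], by linarith [hz.2]⟩)
          (fun z hz => hu.twiceDeriv_mul hε i z ⟨by linarith [hz.1], by linarith [hz.2]⟩)
          (fun z hz => ?_)
        have b1 := hq.bound z ⟨by linarith [hz.1], by linarith [hz.2]⟩
        have b2 := hq.bound (x j) (hxmem j h2.le)
        have := abs_sub (reaction A f u i z) (reaction A f u i (x j))
        linarith
      have hst := hD.discrete_stability hε hxlt hxmem hxmono (fun _ => 0) 0 (by simp)
        (v := fun l i => U l i - u (x l) i) (R := 2 * K) (by positivity) e0 eN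
        (fun j h1 h2 _ i => hcons j h1 h2 i)
        (fun j h1 h2 i => (hcons j h1 h2 i).trans (by
          obtain ⟨d1, d2, -, -⟩ := hpt j h1 h2
          have : 0 ≤ √(ε i) / (x (j + 1) - x (j - 1)) :=
            div_nonneg (Real.sqrt_nonneg _) (by linarith)
          nlinarith)) j hj i
      have hTT : T₀ ≤ T := by
        have h1 : (N : ℝ) ≤ 2 ^ (n + 3) := by exact_mod_cast hsmall.le
        have h2 : (2 : ℝ) ≤ N := by exact_mod_cast hN
        rw [hT₀, hT]
        gcongr
      have h3 : 2 * K / α ≤ 2 * K / α / T₀ * T := by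
        rw [div_mul_eq_mul_div, le_div_iff₀ hT₀0]
        gcongr
      have h4 : 0 ≤ (R₀ * Q + 1) * T := by positivity
      have h5 : 2 * K * ((1 + ((0 : ℕ) : ℝ) * (2 + n * M)) / α + ((0 : ℕ) : ℝ)) = 2 * K / α := by
        push_cast; ring
      rw [h5] at hst
      linarith
    · have hl1 : 1 ≤ Real.log N := by
        rw [Real.le_log_iff_exp_le hNr]
        have h1 : 3 ≤ N := le_trans (by
          calc 3 ≤ 2 ^ 3 := by norm_num
            _ ≤ 2 ^ (n + 3) := Nat.pow_le_pow_right two_pos (by omega)) hlarge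
        have h2 : (3 : ℝ) ≤ N := by exact_mod_cast h1
        linarith [Real.exp_one_lt_d9]
      -- The exceptional indices are the starts of the 2n+1 subintervals. At all other interior
      -- indices the two adjacent steps agree.
      have hst := hD.discrete_stability hε hxlt hxmem hxmono (intervalStart n N) (2 * n + 1)
        (fun s hs => (intervalStart_mono (by omega)).trans (intervalStart_last hn hdvd).le)
        (v := fun l i => U l i - u (x l) i) (R := R₀ * T) (by positivity) e0 eN
        (fun j h1 h2 hns i => ?_) (fun j h1 h2 i => ?_) j hj i
      · have h3 : R₀ * T * ((1 + (2 * n + 1 : ℕ) * (2 + n * M)) / α + (2 * n + 1 : ℕ)) =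
            R₀ * Q * T := by rw [← hQ]; ring
        rw [h3] at hst
        have h4 : 0 ≤ (2 * K / α / T₀ + 1) * T := by positivity
        linarith
      · obtain ⟨q', q'', hq⟩ := hreact ε hmono hε hε1 u hu i
        obtain ⟨d1, d2, d3, d4⟩ := hpt j h1 h2
        obtain ⟨r1, p, r2, r3, r4⟩ := hmesh ε hmono hε N hlarge hdvd j h1 h2 _ _ rfl rfl
        have hequi := (mesh_local hτ hn hdvd h1 h2).2 fun s hs => hns s (by omega)
        rw [discrete_error_equation hU h1 h2 i]
        refine (hq.consistency_uniform hα hε hK.le (hVc i) (hu.twiceDeriv_mul hε i) d1 hequi d3 d4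
          hl1 hCm.le hNr r1 r2 r3).trans ?_
        gcongr
      · obtain ⟨q', q'', hq⟩ := hreact ε hmono hε hε1 u hu i
        obtain ⟨d1, d2, d3, d4⟩ := hpt j h1 h2
        obtain ⟨r1, p, r2, r3, r4⟩ := hmesh ε hmono hε N hlarge hdvd j h1 h2 _ _ rfl rfl
        rw [discrete_error_equation hU h1 h2 i]
        refine (hq.consistency_general hα hε hK.le (hVc i) (hu.twiceDeriv_mul hε i) d1 d2 d3 d4
          hl1 hCm.le hNr r1 r2 r3 r4).trans ?_
        rw [mul_assoc R₀]
        have : 0 ≤ √(ε i) / (x (j + 1) - x (j - 1)) :=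
          div_nonneg (Real.sqrt_nonneg _) (by linarith)
        exact mul_le_mul_of_nonneg_right hR₀2 (by positivity)
  rw [pi_norm_le_iff_of_nonneg (by positivity)]
  exact fun i => hcomp i
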